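/- Let $V$ be a finite connected graph with base vertex $v$. Let $\phi:V\to V$ be a map with $\phi(v)=v$ that sends vertices to vertices and such that each edge has a finite subdivision whose pieces are mapped linearly onto edges, so that $\phi(e)$ is an edge path for each edge $e$. Suppose that $\phi$ is injective on $\pi_1(V,v)$. Let $X=V\times[0,1]/(x,1)\sim(\phi(x),0)$ be the mapping torus, with its cell structure consisting of vertical edges (the edges of $V$), a horizontal edge $t_w$ from $w$ to $\phi(w)$ for each vertex $w$ of $V$, and a 2-cell $R_e$ for each edge $e$ of $V$. Let $\widetilde X$ be its universal cover and let $\widetilde V\subset\widetilde X$ be the preimage of $V$. Let $\tilde\phi:\widetilde V\to\widetilde V$ be the forward flow by time one. Give the lifts of each edge $e$ of $V$ an arbitrary length $|e|>0$ and the horizontal edges length $1$. Let $\mathsf d$ be the resulting path metric on the 1-skeleton $\widetilde X^1$. Assume that $(\widetilde X^1,\mathsf d)$ is $\delta$-hyperbolic, where $\delta\ge0$. For $x\in\widetilde V$, the midsegment $m_x$ is the flow segment from $x$ to $\tilde\phi(x)$. The forward path $\sigma_M(x)$ of length $M\in\mathbb N$ is the concatenation of the midsegments from $x$ to $\tilde\phi^M(x)$.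 For a forward path $\sigma$, let $N(\sigma)$ be the smallest subcomplex of $\widetilde X$ that contains $\sigma$. The level $T^o_n(x)$ is the union of the forward paths of length $n$ that start at the points of the finite set $\tilde\phi^{-n}(x)$. It is a tree with root $x$ and leaves $\tilde\phi^{-n}(x)$, and it carries the path metric in which each midsegment has length $1$. A subset $Y\subset\widetilde X^1$ is $\xi$-quasiconvex if each geodesic of $\widetilde X^1$ with endpoints in $Y$ lies in the closed $\xi$-neighbourhood of $Y$. Let $\lambda\ge0$, and let $\gamma$ be a geodesic line or geodesic ray in $\widetilde X^1$ whose image is $\xi$-quasiconvex, where $\xi\ge0$. We say that $\gamma$ is $M$-ladderlike if for some forward path $\sigma$ of length $M$, some geodesic of $N(\sigma)^1$ joining the endpoints of $\sigma$ is at Hausdorff distance at most $2\delta+\lambda+\xi$ from a subpath of $\gamma$. Otherwise $\gamma$ is $M$-deviating. We say that $\widetilde X$ is level-separated (with respect to $\delta,\lambda$) if for all integers $M>0$, all real $K\ge0$, and all such $\xi$ and $M$-deviating $\gamma$, there exists $y\in\widetilde V$ such that for all sufficiently large $n$ the set $\gamma\cap T^o_n(\tilde\phi^n(y))$ is finite of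 odd cardinality and the distance in $T^o_n(\tilde\phi^n(y))$ from each of its points to the root and to each leaf of $T^o_n(\tilde\phi^n(y))$ exceeds $M+K$. **Lemma.** Suppose that $\phi$ is a train track map (for every edge $e$ and every $n\ge0$ the path $\phi^n(e)$ is immersed), that every edge $e$ of $V$ is expanding ($\phi^k(e)\neq e$ for all $k>0$), and that the transition matrix of $\phi$, whose $(e,e')$ entry is the number of times $\phi(e)$ traverses $e'$ in either direction, is irreducible. Then there is $\lambda_0\ge0$ such that for every $\lambda\ge\lambda_0$, the subgraph $N(\sigma)^1$ is $\lambda$-quasiconvex in $\widetilde X^1$ for each forward path $\sigma$, and $\widetilde X$ is level-separated with respect to $\delta,\lambda$. -/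

import Mathlib

noncomputable section

open scoped Classical

namespace MappingTorus

/-! ### Graphs and combinatorial maps -/

/-- A graph with vertex set `V` and set of (unoriented) edges `E`; each edge is given with a
reference orientation from `src e` to `tgt e`.  Loops and multiple edges are allowed. The pair
`(e, true)` is the edge `e` with its reference orientation, `(e, false)` is its reverse. -/
structure OrientedGraph (V E : Type*) where
  src : E → V
  tgt : E → V

section GraphDefs

variable {V E : Type*} (Γ : OrientedGraph V E)

/-- Initial vertex of an oriented edge. -/
def OrientedGraph.init (a : E × Bool) : V := cond a.2 (Γ.src a.1) (Γ.tgt a.1)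

/-- Terminal vertex of an oriented edge. -/
def OrientedGraph.term (a : E × Bool) : V := cond a.2 (Γ.tgt a.1) (Γ.src a.1)

/-- `Γ.IsPath w p w'`: the list `p` of oriented edges is an edge path from `w` to `w'`. -/
def OrientedGraph.IsPath : V → List (E × Bool) → V → Prop
  | w, [], w' => w = w'
  | w, a :: p, w' => Γ.init a = w ∧ OrientedGraph.IsPath (Γ.term a) p w'

/-- Every two vertices are joined by an edge path. -/
def OrientedGraph.Connected : Prop := ∀ w w' : V, ∃ p, Γ.IsPath w p w'

theorem OrientedGraph.IsPath.append {w w' w'' : V} {p q : List (E × Bool)}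
    (hp : Γ.IsPath w p w') (hq : Γ.IsPath w' q w'') : Γ.IsPath w (p ++ q) w'' := by
  induction p generalizing w with
  | nil => cases hp; exact hq
  | cons a p ih => exact ⟨hp.1, ih hp.2⟩

/-- A combinatorial self-map of the graph `Γ`: vertices go to vertices, and each edge `e` is
subdivided into finitely many (at least one) consecutive pieces; the `i`-th entry `(a, r)` of
`onEdge e` says that the `i`-th piece has length `r` (where `e` is identified with `[0,1]`) and is
mapped linearly onto the oriented edge `a`. -/
structure GraphMap where
  onVert : V → V
  onEdge : E → List ((E × Bool) × ℝ)
  isPath : ∀ e, Γ.IsPath (onVert (Γ.src e)) ((onEdge e).map Prod.fst) (onVert (Γ.tgt e))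
  pos : ∀ e, ∀ a ∈ onEdge e, 0 < a.2
  sum_eq : ∀ e, ((onEdge e).map Prod.snd).sum = 1

end GraphDefs

namespace GraphMap

variable {V E : Type*} {Γ : OrientedGraph V E} (φ : GraphMap Γ)

/-- The edge path `φ(e)`. -/
def edgePath (e : E) : List (E × Bool) := (φ.onEdge e).map Prod.fst

/-- The image of an oriented edge (reversed edges go to reversed paths). -/
def orientedImage (a : E × Bool) : List (E × Bool) :=
  cond a.2 (φ.edgePath a.1) ((φ.edgePath a.1).reverse.map fun b => (b.1, !b.2))

/-- The image of an edge path. -/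
def mapPath (p : List (E × Bool)) : List (E × Bool) := p.flatMap φ.orientedImage

/-- The edge path `φⁿ(e)`. -/
def iteratePath (n : ℕ) (e : E) : List (E × Bool) := φ.mapPath^[n] [(e, true)]

/-- `φ` is a train track map: each path `φⁿ(e)` is immersed, that is, has no backtracking. -/
def IsTrainTrack : Prop := ∀ (e : E) (n : ℕ), FreeGroup.IsReduced (φ.iteratePath n e)

/-- The edge `e` is expanding: `φᵏ(e) ≠ e` for all `k > 0`. -/
def IsExpanding (e : E) : Prop := ∀ k : ℕ, 0 < k → ∀ b : Bool, φ.iteratePath k e ≠ [(e, b)]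

/-- The transition matrix: the `(e, e')` entry is the number of times that `φ(e)` traverses `e'`
in either direction. -/
def transitionMatrix : Matrix E E ℝ := fun e e' => (((φ.edgePath e).map Prod.fst).count e' : ℝ)

/-- `φ` fixes the base vertex `v` and induces an injection on `π₁(V, v)`.  A closed edge path is
null-homotopic in a graph iff it freely reduces to the empty path. -/
def PiOneInjective (v : V) : Prop :=
  φ.onVert v = v ∧ ∀ p : List (E × Bool), Γ.IsPath v p v →
    FreeGroup.mk (φ.mapPath p) = 1 → FreeGroup.mk p = 1

/-! ### The mapping torus and its universal cover -/

/-- The 1-skeleton of the mapping torus `X`: its edges are the vertical edges `Sum.inl e` and, for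
each vertex `w`, the horizontal edge `t_w = Sum.inr w` from `w` to `φ(w)`. -/
def torusGraph : OrientedGraph V (E ⊕ V) where
  src := Sum.elim Γ.src id
  tgt := Sum.elim Γ.tgt φ.onVert

/-- Elementary homotopies of edge paths in `X`: inserting a backtrack, or pushing across the 2-cell
`R_e`, whose boundary says that `e · t_b` is homotopic to `t_a · φ(e)` if `e` goes from `a` to `b`. -/
inductive ElementaryHomotopy : List ((E ⊕ V) × Bool) → List ((E ⊕ V) × Bool) → Prop
  | backtrack (p q : List ((E ⊕ V) × Bool)) (a : (E ⊕ V) × Bool) :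
      ElementaryHomotopy (p ++ q) (p ++ [a, (a.1, !a.2)] ++ q)
  | cell (p q : List ((E ⊕ V) × Bool)) (e : E) :
      ElementaryHomotopy
        (p ++ [(Sum.inl e, true), (Sum.inr (Γ.tgt e), true)] ++ q)
        (p ++ ((Sum.inr (Γ.src e), true) ::
          (φ.edgePath e).map fun b => ((Sum.inl b.1 : E ⊕ V), b.2)) ++ q)

/-- Edge paths in `X` from `v` to `w`. -/
abbrev PathsTo (v w : V) : Type _ := {p : List ((E ⊕ V) × Bool) // φ.torusGraph.IsPath v p w}

/-- The 0-cells of the universal cover of `X` that lie over the vertex `w`: homotopy classes of edge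
paths in `X` from the base vertex `v` to `w`. -/
def Over (v w : V) : Type _ :=
  Quot fun p q : φ.PathsTo v w => φ.ElementaryHomotopy p.1 q.1

variable {φ}

theorem ElementaryHomotopy.append {p q : List ((E ⊕ V) × Bool)}
    (h : φ.ElementaryHomotopy p q) (r : List ((E ⊕ V) × Bool)) :
    φ.ElementaryHomotopy (p ++ r) (q ++ r) := by
  cases h with
  | backtrack p q a =>
    have := ElementaryHomotopy.backtrack (φ := φ) p (q ++ r) a
    simpa [List.append_assoc] using this
  | cell p q e =>
    have := ElementaryHomotopy.cell (φ := φ) p (q ++ r) e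
    simpa [List.append_assoc] using this

/-- Appending an oriented edge of `X` to a homotopy class of paths; in other words, the terminal
point of the lift of the edge `a` that starts at the given 0-cell. -/
def Over.step {v : V} (a : (E ⊕ V) × Bool) :
    φ.Over v (φ.torusGraph.init a) → φ.Over v (φ.torusGraph.term a) :=
  Quot.map (fun p => ⟨p.1 ++ [a], OrientedGraph.IsPath.append _ p.2 ⟨rfl, rfl⟩⟩)
    fun _ _ h => h.append [a]

variable (φ)

/-- The 0-cells of the universal cover `X̃`. -/
def Node (v : V) : Type _ := Σ w : V, φ.Over v w

/-- The vertical 1-cells of `X̃`: lifts of edges of `V`, given by the lift of their initial vertex. -/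
def VEdge (v : V) : Type _ := Σ e : E, φ.Over v (Γ.src e)

variable {φ} {v : V}

/-- Initial 0-cell of a vertical 1-cell. -/
def VEdge.tail (c : φ.VEdge v) : φ.Node v := ⟨Γ.src c.1, c.2⟩

/-- Terminal 0-cell of a vertical 1-cell. -/
def VEdge.head (c : φ.VEdge v) : φ.Node v :=
  ⟨Γ.tgt c.1, Over.step (φ := φ) (v := v) (Sum.inl c.1, true) c.2⟩

/-- The terminal 0-cell of the horizontal 1-cell of `X̃` that starts at a given 0-cell. -/
def Node.next (x : φ.Node v) : φ.Node v :=
  ⟨φ.onVert x.1, Over.step (φ := φ) (v := v) (Sum.inr x.1, true) x.2⟩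

variable (φ v)

/-- The points of the preimage in `X̃` of the graph `V`, that is, of the union of all vertical
1-cells: 0-cells, and interior points of vertical 1-cells (with a parameter in `(0,1)`). -/
inductive VPoint : Type _
  | node (x : φ.Node v) : VPoint
  | inner (c : φ.VEdge v) (s : Set.Ioo (0 : ℝ) 1) : VPoint

variable {φ v}

/-- The point with parameter `s ∈ [0,1]` on a vertical 1-cell. -/
def VEdge.point (c : φ.VEdge v) (s : ℝ) : φ.VPoint v :=
  if h : s ∈ Set.Ioo (0 : ℝ) 1 then .inner c ⟨s, h⟩
  else if s ≤ 0 then .node c.tail else .node c.head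

/-- The point at fraction `s ∈ [0,1]` of the way along the lift of the oriented edge `a` of `V`
that starts at the 0-cell `x`. -/
def Over.along : (a : E × Bool) → φ.Over v (Γ.init a) → ℝ → φ.VPoint v
  | (e, true), x, s => VEdge.point (⟨e, x⟩ : φ.VEdge v) s
  | (e, false), x, s =>
      VEdge.point (⟨e, Over.step (φ := φ) (v := v) (Sum.inl e, false) x⟩ : φ.VEdge v) (1 - s)

/-- The terminal 0-cell of the lift of the oriented edge `a` of `V` that starts at the 0-cell `x`. -/
def Over.stepV : (a : E × Bool) → φ.Over v (Γ.init a) → φ.Over v (Γ.term a)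
  | (e, true), x => Over.step (φ := φ) (v := v) (Sum.inl e, true) x
  | (e, false), x => Over.step (φ := φ) (v := v) (Sum.inl e, false) x

/-- Travel along the lift, starting at the 0-cell `x`, of an edge path of `V` whose consecutive
edges are traversed linearly in times given by the real entries; the point reached at time `s`. -/
def Over.walk {w' : V} : {w : V} → (x : φ.Over v w) → (l : List ((E × Bool) × ℝ)) →
    Γ.IsPath w (l.map Prod.fst) w' → ℝ → φ.VPoint v
  | w, x, [], _, _ => .node ⟨w, x⟩
  | w, x, a :: l, h, s =>
      let x' : φ.Over v (Γ.init a.1) := (show w = Γ.init a.1 from h.1.symm) ▸ x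
      if s ≤ a.2 then Over.along a.1 x' (s / a.2)
      else Over.walk (Over.stepV a.1 x') l h.2 (s - a.2)

/-- The forward flow by time one on the vertical part of `X̃`: a 0-cell moves across its outgoing
horizontal edge, and a vertical edge over `e` from `a` to `b` is mapped to the lift of the path
`φ(e)` that starts at the end of the horizontal edge `t_a`, with the parametrization of `φ`. -/
def flow : φ.VPoint v → φ.VPoint v
  | .node x => .node x.next
  | .inner c s => Over.walk (φ := φ) (v := v) c.tail.next.2 (φ.onEdge c.1) (φ.isPath c.1) s

variable (φ v)

/-- The points of the universal cover `X̃` of the mapping torus. As a set, the mapping torus is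
`V × [0,1)`; likewise the pair `(x, r)` is the point reached from the point `x` of the vertical part
by moving a distance `r ∈ [0,1)` forward along the midsegment that starts at `x`. -/
abbrev Cover : Type _ := φ.VPoint v × Set.Ico (0 : ℝ) 1

variable {φ v}

/-- The point reached from the vertical point `x` by flowing forward a distance `s ≥ 0`. -/
def fwd (x : φ.VPoint v) (s : ℝ) : φ.Cover v :=
  (flow^[⌊s⌋₊] x, ⟨Int.fract s, Int.fract_nonneg s, Int.fract_lt_one s⟩)

variable (φ v)

/-- The cells of `X̃`. -/
inductive Cell : Type _
  | zero (x : φ.Node v) : Cell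
  | vert (c : φ.VEdge v) : Cell
  | horiz (x : φ.Node v) : Cell
  | two (c : φ.VEdge v) : Cell

variable {φ v}

/-- Closed cells. The closed 2-cell at the vertical edge `c` is the union of the midsegments that
start on `c`. -/
def Cell.closed : φ.Cell v → Set (φ.Cover v)
  | .zero x => {fwd (.node x) 0}
  | .vert c => {p | ∃ s ∈ Set.Icc (0 : ℝ) 1, p = fwd (c.point s) 0}
  | .horiz x => {p | ∃ r ∈ Set.Icc (0 : ℝ) 1, p = fwd (.node x) r}
  | .two c => {p | ∃ s ∈ Set.Icc (0 : ℝ) 1, ∃ r ∈ Set.Icc (0 : ℝ) 1, p = fwd (c.point s) r}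

/-- Subcomplexes of `X̃`: unions of closed cells. -/
def IsSubcomplex (A : Set (φ.Cover v)) : Prop :=
  ∃ C : Set (φ.Cell v), A = ⋃ c ∈ C, c.closed

/-- The smallest subcomplex that contains a given set. -/
def hull (B : Set (φ.Cover v)) : Set (φ.Cover v) := ⋂₀ {A | IsSubcomplex A ∧ B ⊆ A}

variable (φ v)

/-- The 1-skeleton of `X̃`. -/
def oneSkeleton : Set (φ.Cover v) :=
  (⋃ c : φ.VEdge v, (Cell.vert c).closed) ∪ ⋃ x : φ.Node v, (Cell.horiz x).closed

variable {φ v}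

/-! ### Forward paths, ladders and levels -/

/-- The forward path of length `M` that starts at `x`. -/
def forwardPath (M : ℕ) (x : φ.VPoint v) : Set (φ.Cover v) := fwd x '' Set.Icc 0 (M : ℝ)

/-- The 1-skeleton of the forward ladder of the forward path of length `M` that starts at `x`. -/
def ladder (M : ℕ) (x : φ.VPoint v) : Set (φ.Cover v) := hull (forwardPath M x) ∩ φ.oneSkeleton v

/-- The leaves of the level of length `n` rooted at `x`, as points of the vertical part. -/
def levelLeaves (n : ℕ) (x : φ.VPoint v) : Set (φ.VPoint v) := {y | flow^[n] y = x}

/-- The level of length `n` rooted at `x`. -/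
def level (n : ℕ) (x : φ.VPoint v) : Set (φ.Cover v) := ⋃ y ∈ levelLeaves n x, forwardPath n y

end GraphMap

/-! ### Path metrics on graphs -/

section Metric

variable {ι P : Type*} (arc : ι → ℝ → P) (wt : ι → ℝ) (S : Set P)

/-- Let the edges of a metric graph be parametrized by `arc i : [0,1] → P`, with lengths `wt i`.
`ChainLength arc wt S x y ℓ`: some finite concatenation of subsegments of edges contained in the
subgraph `S` joins `x` to `y` and has total length `ℓ`. -/
inductive ChainLength : P → P → ℝ → Prop
  | nil (x : P) : ChainLength x x 0
  | cons (i : ι) (s t : ℝ) (y : P) (ℓ : ℝ) (hs : s ∈ Set.Icc (0 : ℝ) 1)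
      (ht : t ∈ Set.Icc (0 : ℝ) 1) (hi : ∀ u ∈ Set.Icc (0 : ℝ) 1, arc i u ∈ S)
      (h : ChainLength (arc i t) y ℓ) : ChainLength (arc i s) y (|s - t| * wt i + ℓ)

/-- The path metric of the subgraph `S`. -/
def pathDist (x y : P) : ℝ := sInf {ℓ | ChainLength arc wt S x y ℓ}

/-- `c` restricted to the interval `I` is a geodesic, parametrized by arc length, of `S`. -/
def IsGeodesicOn (c : ℝ → P) (I : Set ℝ) : Prop :=
  (∀ t ∈ I, c t ∈ S) ∧ ∀ s ∈ I, ∀ t ∈ I, pathDist arc wt S (c s) (c t) = |s - t|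

/-- `A` is (the image of) a geodesic segment of `S` from `x` to `y`. -/
def IsGeodesicSegment (x y : P) (A : Set P) : Prop :=
  ∃ (ℓ : ℝ) (c : ℝ → P), 0 ≤ ℓ ∧ IsGeodesicOn arc wt S c (Set.Icc 0 ℓ) ∧ c 0 = x ∧ c ℓ = y ∧
    A = c '' Set.Icc 0 ℓ

/-- `A` lies in the closed `r`-neighbourhood of `B` in `S`. -/
def InNeighborhood (r : ℝ) (A B : Set P) : Prop := ∀ a ∈ A, ∃ b ∈ B, pathDist arc wt S a b ≤ r

/-- `S` is `δ`-hyperbolic: each side of each geodesic triangle lies in the `δ`-neighbourhood of the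
union of the other two sides. -/
def IsHyperbolic (δ : ℝ) : Prop :=
  ∀ (x y z : P) (A B C : Set P), IsGeodesicSegment arc wt S x y A →
    IsGeodesicSegment arc wt S y z B → IsGeodesicSegment arc wt S x z C →
    InNeighborhood arc wt S δ A (B ∪ C)

/-- `Y` is `ξ`-quasiconvex in `S`: each geodesic of `S` that starts and ends on `Y` lies in the
closed `ξ`-neighbourhood of `Y`. -/
def IsQuasiconvex (ξ : ℝ) (Y : Set P) : Prop :=
  ∀ x ∈ Y, ∀ y ∈ Y, ∀ A, IsGeodesicSegment arc wt S x y A → InNeighborhood arc wt S ξ A Y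

end Metric

namespace GraphMap

variable {V E : Type*} {Γ : OrientedGraph V E} {φ : GraphMap Γ} {v : V}

/-- The edges of the 1-skeleton of `X̃`, parametrized by `[0,1]`. -/
def edgeArc : φ.VEdge v ⊕ φ.Node v → ℝ → φ.Cover v
  | .inl c, s => fwd (c.point s) 0
  | .inr x, s => fwd (.node x) s

/-- The lengths of the edges of the 1-skeleton of `X̃`: a lift of the edge `e` of `V` has length
`wt e`, and all horizontal edges have length one. -/
def edgeLength (wt : E → ℝ) : φ.VEdge v ⊕ φ.Node v → ℝ
  | .inl c => wt c.1
  | .inr _ => 1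

/-- The metric on the subgraph `N` of the 1-skeleton of `X̃`. -/
def subgraphDist (wt : E → ℝ) (N : Set (φ.Cover v)) : φ.Cover v → φ.Cover v → ℝ :=
  pathDist edgeArc (edgeLength wt) N

/-- The metric on the level `T`, a tree whose edges are midsegments, all of length one. -/
def levelDist (T : Set (φ.Cover v)) : φ.Cover v → φ.Cover v → ℝ :=
  pathDist (fwd (φ := φ) (v := v)) (fun _ => 1) T

variable (φ v)

/-- The 1-skeleton of `X̃` is `δ`-hyperbolic. -/
def CoverHyperbolic (wt : E → ℝ) (δ : ℝ) : Prop :=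
  IsHyperbolic edgeArc (edgeLength wt) (φ.oneSkeleton v) δ

/-- The 1-skeleton of every forward ladder is `lam`-quasiconvex in the 1-skeleton of `X̃`. -/
def LaddersQuasiconvex (wt : E → ℝ) (lam : ℝ) : Prop :=
  ∀ (M : ℕ) (x : φ.VPoint v),
    IsQuasiconvex edgeArc (edgeLength wt) (φ.oneSkeleton v) lam (ladder M x)

variable {φ v}

/-- The path `γ`, defined on the interval `I`, is `M`-ladderlike at scale `D`: for some forward path
`σ` of length `M`, a geodesic of the forward ladder of `σ` that joins the endpoints of `σ` is at
Hausdorff distance at most `D` from a subpath of `γ`. -/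
def IsLadderlike (wt : E → ℝ) (D : ℝ) (M : ℕ) (γ : ℝ → φ.Cover v) (I : Set ℝ) : Prop :=
  ∃ (x : φ.VPoint v) (A : Set (φ.Cover v)) (a b : ℝ),
    IsGeodesicSegment edgeArc (edgeLength wt) (ladder M x) (fwd x 0) (fwd x M) A ∧
    a ∈ I ∧ b ∈ I ∧ a ≤ b ∧
    InNeighborhood edgeArc (edgeLength wt) (φ.oneSkeleton v) D A (γ '' Set.Icc a b) ∧
    InNeighborhood edgeArc (edgeLength wt) (φ.oneSkeleton v) D (γ '' Set.Icc a b) A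

/-- `γ` is `M`-deviating with respect to the constants `δ` and `lam`: its image is `ξ`-quasiconvex
and it is not `M`-ladderlike at scale `2 * δ + lam + ξ`. -/
def IsDeviating (wt : E → ℝ) (δ lam ξ : ℝ) (M : ℕ) (γ : ℝ → φ.Cover v) (I : Set ℝ) : Prop :=
  IsQuasiconvex edgeArc (edgeLength wt) (φ.oneSkeleton v) ξ (γ '' I) ∧
    ¬ IsLadderlike wt (2 * δ + lam + ξ) M γ I

variable (φ v)

/-- `X̃` is `(M, K)`-separated with respect to the constants `δ` and `lam`. The geodesics are geodesic
lines and geodesic rays. (An infinite set has `Set.ncard` zero, so that a set whose `Set.ncard` is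
odd is finite.) -/
def IsSeparated (wt : E → ℝ) (δ lam : ℝ) (M : ℕ) (K : ℝ) : Prop :=
  ∀ (γ : ℝ → φ.Cover v) (I : Set ℝ) (ξ : ℝ), I = Set.univ ∨ I = Set.Ici 0 → 0 ≤ ξ →
    IsGeodesicOn edgeArc (edgeLength wt) (φ.oneSkeleton v) γ I →
    IsDeviating wt δ lam ξ M γ I →
    ∃ (y : φ.VPoint v) (n₀ : ℕ), ∀ n ≥ n₀,
      Odd (γ '' I ∩ level n (flow^[n] y)).ncard ∧
      ∀ c ∈ γ '' I ∩ level n (flow^[n] y),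
        M + K < levelDist (level n (flow^[n] y)) c (fwd (flow^[n] y) 0) ∧
        ∀ z ∈ levelLeaves n (flow^[n] y),
          M + K < levelDist (level n (flow^[n] y)) c (fwd z 0)

/-- `X̃` is level-separated: `(M, K)`-separated for all `M > 0` and `K ≥ 0`. -/
def LevelSeparated (wt : E → ℝ) (δ lam : ℝ) : Prop :=
  ∀ (M : ℕ) (K : ℝ), 0 < M → 0 ≤ K → φ.IsSeparated v wt δ lam M K

end GraphMap

end MappingTorus

end

noncomputable section

open scoped Classical
open Set

namespace MappingTorus

/-! ### Hyperbolic geodesic spaces with a height function -/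

section Hyperbolic

variable {X : Type*} [PseudoMetricSpace X]

/-! Two mechanisms are combined: hyperbolicity makes forward paths rigid, and the train track
property makes some crossings impossible to cancel.

Coarse part. Height is 1-Lipschitz on the 1-skeleton and grows by one along each midsegment, while
consecutive points of a forward orbit are at bounded distance. Forward orbits are therefore uniform
quasigeodesics, and a Morse lemma for such ascending sequences (`IsHyp.morse`) applies with
constants that do not depend on their length. Ladders stay near orbits, hence are uniformly
quasiconvex (`exists_laddersQuasiconvex`). Suppose that the orbits of two points of a geodesic γ
merge, or are still close to each other far above γ. A thin triangle or quadrilateral then puts the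
subpath of γ between the two points near the union of the two orbits. If that subpath is long, part
of it follows one of the orbits for time M (`IsHyp.fellow_travel`), so γ is M-ladderlike.
Consequently, on a deviating γ, the orbits of points at least B apart never meet and diverge with
height (`exists_deviation`).

Combinatorial part. Injectivity on π₁ makes the components of Ṽ trees (`isForest_coverGraph`). In a
tree, an edge occurring in the reduced form of a path is crossed an odd number of times by the path.
Injectivity and finiteness also give properness, hence bounded cancellation. Together with
expansion, this shows that a subword lying deep inside a legal segment of a reduced path survives in
the reduced images under all iterates (`IsTreeTrainTrack.persist`).

Combination. Take a segment of γ with k edges and flow it to a common height H. Horizontal edges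
collapse and vertical edges become legal paths, so the result consists of at most k legal pieces,
whatever H is (`SkelTrav.flowTo`). For large H, divergence makes the reduced path long, so it
contains a long legal word. A generic point P on the middle edge of that word is crossed an odd
number of times, and so is every forward image of P by the flowed path (`exists_odd_point`). Choose
y far below P on a backward orbit of P. The level rooted at a high forward image of y meets γ
exactly at the points whose orbits pass through the corresponding image of P. By the absence of
merging, all of these lie in the chosen segment, so their number is odd. The segment has bounded
height while root and leaves recede, and height bounds distances in the level from below
(`exists_separating`).

For a line, the segment needs a buffer of length B on both sides, and a tripod argument prevents its
initial part from cancelling the chosen edge. For a ray, the difficulty is the edge in which the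
flowed initial point lies. -/

/-- `A` is the image of a geodesic segment from `x` to `y`. -/
def GeodSeg (x y : X) (A : Set X) : Prop :=
  ∃ (l : ℝ) (c : ℝ → X), 0 ≤ l ∧ (∀ s ∈ Icc 0 l, ∀ t ∈ Icc 0 l, dist (c s) (c t) = |s - t|) ∧
    c 0 = x ∧ c l = y ∧ A = c '' Icc 0 l

theorem GeodSeg.symm {x y : X} {A : Set X} (h : GeodSeg x y A) : GeodSeg y x A := by
  obtain ⟨l, c, hl, hc, h0, h1, rfl⟩ := h
  refine ⟨l, fun t => c (l - t), hl, ?_, by simpa using h1, by simpa using h0, ?_⟩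
  · intro s hs t ht
    rw [hc _ ⟨by linarith [hs.2], by linarith [hs.1]⟩ _ ⟨by linarith [ht.2], by linarith [ht.1]⟩,
      abs_sub_comm]
    congr 1; ring
  · ext p
    constructor
    · rintro ⟨t, ht, rfl⟩
      exact ⟨l - t, ⟨by linarith [ht.2], by linarith [ht.1]⟩, by simp⟩
    · rintro ⟨t, ht, rfl⟩
      exact ⟨l - t, ⟨by linarith [ht.2], by linarith [ht.1]⟩, rfl⟩

theorem GeodSeg.dist_add {x y : X} {A : Set X} (h : GeodSeg x y A) {a : X} (ha : a ∈ A) :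
    dist x a + dist a y = dist x y := by
  obtain ⟨l, c, hl, hc, rfl, rfl, rfl⟩ := h
  obtain ⟨t, ht, rfl⟩ := ha
  rw [hc _ ⟨le_rfl, hl⟩ _ ht, hc _ ht _ ⟨hl, le_rfl⟩, hc _ ⟨le_rfl, hl⟩ _ ⟨hl, le_rfl⟩]
  rw [abs_of_nonpos (by linarith [ht.1]), abs_of_nonpos (by linarith [ht.2]),
    abs_of_nonpos (by linarith)]
  ring

theorem GeodSeg.dist_left {x y : X} {A : Set X} (h : GeodSeg x y A) {a : X} (ha : a ∈ A) :
    dist a x ≤ dist x y := by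
  have := h.dist_add ha
  rw [dist_comm a x]; linarith [dist_nonneg (x := a) (y := y)]

theorem GeodSeg.dist_right {x y : X} {A : Set X} (h : GeodSeg x y A) {a : X} (ha : a ∈ A) :
    dist a y ≤ dist x y := by
  have := h.dist_add ha
  linarith [dist_nonneg (x := x) (y := a)]

/-- Geodesics exist and geodesic triangles are `δ`-thin. -/
structure IsHyp (X : Type*) [PseudoMetricSpace X] (δ : ℝ) : Prop where
  geod : ∀ x y : X, ∃ A, GeodSeg x y A
  thin : ∀ (x y z : X) (A B C : Set X), GeodSeg x y A → GeodSeg y z B → GeodSeg x z C →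
    ∀ a ∈ A, ∃ b ∈ B ∪ C, dist a b ≤ δ

variable {δ : ℝ}

theorem IsHyp.quad (hX : IsHyp X δ) {x y z w : X} {A B C D : Set X} (hA : GeodSeg x y A)
    (hB : GeodSeg x z B) (hC : GeodSeg z w C) (hD : GeodSeg w y D) {a : X} (ha : a ∈ A) :
    (∃ b ∈ B, dist a b ≤ 2 * δ) ∨ (∃ b ∈ C, dist a b ≤ 2 * δ) ∨ (∃ b ∈ D, dist a b ≤ 2 * δ) := by
  obtain ⟨F, hF⟩ := hX.geod z y
  obtain ⟨b, hb, hab⟩ := hX.thin x y z A F B hA hF.symm hB a ha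
  have hδ : 0 ≤ δ := dist_nonneg.trans hab
  rcases hb with hb | hb
  · obtain ⟨e, he, hbe⟩ := hX.thin z y w F D C hF hD.symm hC b hb
    have : dist a e ≤ 2 * δ := by linarith [dist_triangle a b e]
    rcases he with he | he
    · exact Or.inr (Or.inr ⟨e, he, this⟩)
    · exact Or.inr (Or.inl ⟨e, he, this⟩)
  · exact Or.inl ⟨b, hb, by linarith⟩

/-- Bisect the index interval: each halving replaces a geodesic by two sides of a thin triangle at
the cost of δ, and after k halvings a single step of length at most C remains. -/
theorem IsHyp.log_near (hX : IsHyp X δ) {p : ℕ → X} {C : ℝ}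
    (hp : ∀ i, dist (p i) (p (i + 1)) ≤ C) : ∀ (k i n : ℕ), n ≤ 2 ^ k → ∀ A,
    GeodSeg (p i) (p (i + n)) A → ∀ a ∈ A, ∃ j, i ≤ j ∧ j ≤ i + n ∧ dist a (p j) ≤ k * δ + C := by
  have hC : 0 ≤ C := dist_nonneg.trans (hp 0)
  intro k
  induction k with
  | zero =>
    intro i n hn A hA a ha
    refine ⟨i, le_rfl, by omega, ?_⟩
    have h1 := hA.dist_left ha
    have : dist (p i) (p (i + n)) ≤ C := by
      rcases Nat.eq_zero_or_pos n with rfl | h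
      · simpa using hC
      · obtain rfl : n = 1 := by simp at hn; omega
        exact hp i
    simp; linarith
  | succ k ih =>
    intro i n hn A hA a ha
    obtain ⟨B, hB⟩ := hX.geod (p i) (p (i + n / 2))
    obtain ⟨D, hD⟩ := hX.geod (p (i + n / 2)) (p (i + n))
    rw [pow_succ] at hn
    obtain ⟨b, hb, hab⟩ := hX.thin _ _ _ A D B hA hD.symm hB a ha
    rcases hb with hb | hb
    · have hD' : GeodSeg (p (i + n / 2)) (p (i + n / 2 + (n - n / 2))) D := by
        have : i + n / 2 + (n - n / 2) = i + n := by omega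
        rwa [this]
      obtain ⟨j, h1, h2, h3⟩ := ih (i + n / 2) (n - n / 2) (by omega) D hD' b hb
      refine ⟨j, by omega, by omega, ?_⟩
      push_cast
      linarith [dist_triangle a b (p j)]
    · obtain ⟨j, h1, h2, h3⟩ := ih i (n / 2) (by omega) B hB b hb
      refine ⟨j, by omega, by omega, ?_⟩
      push_cast
      linarith [dist_triangle a b (p j)]

/-- A sequence of points with bounded steps along which the height increases by one. -/
structure IsAscending (ht : X → ℝ) (C : ℝ) (q : ℕ → X) : Prop where
  lip : ∀ x y, |ht x - ht y| ≤ dist x y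
  step : ∀ i, dist (q i) (q (i + 1)) ≤ C
  up : ∀ i, ht (q (i + 1)) = ht (q i) + 1

variable {ht : X → ℝ} {C : ℝ} {q : ℕ → X}

theorem IsAscending.nonneg (hq : IsAscending ht C q) : 0 ≤ C := dist_nonneg.trans (hq.step 0)

theorem IsAscending.ht_eq (hq : IsAscending ht C q) (i : ℕ) : ht (q i) = ht (q 0) + i := by
  induction i with
  | zero => simp
  | succ i ih => rw [hq.up, ih]; push_cast; ring

theorem IsAscending.shift (hq : IsAscending ht C q) (k : ℕ) : IsAscending ht C (fun i => q (k + i)) :=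
  ⟨hq.lip, fun i => hq.step (k + i), fun i => hq.up (k + i)⟩

theorem IsAscending.dist_add_le (hq : IsAscending ht C q) (i n : ℕ) :
    dist (q i) (q (i + n)) ≤ C * n := by
  induction n with
  | zero => simp
  | succ n ih =>
    have := dist_triangle (q i) (q (i + n)) (q (i + n + 1))
    have h2 := hq.step (i + n)
    push_cast
    rw [← add_assoc]; linarith

theorem IsAscending.dist_le (hq : IsAscending ht C q) (i j : ℕ) :
    dist (q i) (q j) ≤ C * |(i : ℝ) - j| := by
  rcases le_total i j with h | h
  · obtain ⟨n, rfl⟩ := Nat.exists_eq_add_of_le h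
    have := hq.dist_add_le i n
    have e : |(i : ℝ) - ((i + n : ℕ) : ℝ)| = n := by
      push_cast; rw [sub_add_cancel_left, abs_neg, abs_of_nonneg (by positivity)]
    rwa [e]
  · obtain ⟨n, rfl⟩ := Nat.exists_eq_add_of_le h
    have := hq.dist_add_le j n
    have e : |((j + n : ℕ) : ℝ) - (j : ℝ)| = n := by
      push_cast; rw [add_sub_cancel_left, abs_of_nonneg (by positivity)]
    rwa [e, dist_comm]

theorem IsAscending.le_dist (hq : IsAscending ht C q) (i j : ℕ) :
    |(i : ℝ) - j| ≤ dist (q i) (q j) := by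
  have := hq.lip (q i) (q j)
  rw [hq.ht_eq i, hq.ht_eq j] at this
  simpa using this

theorem geodSeg_image_Icc {g : ℝ → X} {s t : ℝ} (hst : s ≤ t)
    (hg : ∀ u ∈ Icc s t, ∀ w ∈ Icc s t, dist (g u) (g w) = |u - w|) :
    GeodSeg (g s) (g t) (g '' Icc s t) := by
  refine ⟨t - s, fun u => g (s + u), by linarith, ?_, by simp, by simp, ?_⟩
  · intro u hu w hw
    rw [hg _ ⟨by linarith [hu.1], by linarith [hu.2]⟩ _ ⟨by linarith [hw.1], by linarith [hw.2]⟩]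
    congr 1; ring
  · ext p; constructor
    · rintro ⟨u, hu, rfl⟩; exact ⟨u - s, ⟨by linarith [hu.1], by linarith [hu.2]⟩, by simp⟩
    · rintro ⟨u, hu, rfl⟩; exact ⟨s + u, ⟨by linarith [hu.1], by linarith [hu.2]⟩, rfl⟩

/-- A quantity dominated by the logarithm of a multiple of itself is bounded. This closes the Morse
argument, where 6r bounds an index gap. -/
theorem exists_log_bound (δ C : ℝ) :
    ∃ R : ℝ, 0 ≤ R ∧ ∀ r : ℝ, (∀ k : ℕ, 6 * r ≤ 2 ^ k → r ≤ (2 + k) * δ + C) → r ≤ R := by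
  have h : Filter.Tendsto (fun k : ℕ => ((k : ℝ) ^ 1) / (2 : ℝ) ^ k) Filter.atTop (nhds 0) :=
    tendsto_pow_const_div_const_pow_of_one_lt 1 (by norm_num)
  have h2 : Filter.Tendsto (fun k : ℕ => (1 : ℝ) / (2 : ℝ) ^ k) Filter.atTop (nhds 0) := by
    simpa using tendsto_pow_const_div_const_pow_of_one_lt 0 (by norm_num : (1 : ℝ) < 2)
  have h3 : Filter.Tendsto (fun k : ℕ => δ * (((k : ℝ) ^ 1) / (2 : ℝ) ^ k) +
      (3 * δ + C) * ((1 : ℝ) / (2 : ℝ) ^ k)) Filter.atTop (nhds 0) := by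
    simpa using (h.const_mul δ).add (h2.const_mul (3 * δ + C))
  obtain ⟨K, hK⟩ := (h3.eventually (gt_mem_nhds (show (0 : ℝ) < 1 / 6 by norm_num))).exists_forall_of_atTop
  refine ⟨2 ^ K, by positivity, fun r hr => ?_⟩
  by_contra hcon
  push Not at hcon
  obtain ⟨m, hm⟩ := pow_unbounded_of_one_lt (6 * r) (by norm_num : (1 : ℝ) < 2)
  -- The least admissible exponent k + 1 gives r > 2^k / 6, while beyond K the logarithmic bound is
  -- below 2^k / 6.
  have hex : ∃ m : ℕ, 6 * r ≤ 2 ^ m := ⟨m, hm.le⟩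
  have hmin : ∀ {m : ℕ}, m < Nat.find hex → ¬ 6 * r ≤ 2 ^ m := fun h => Nat.find_min hex h
  have hsp := Nat.find_spec hex
  generalize Nat.find hex = n at hmin hsp
  have hpos : K < n := by
    by_contra hle
    push Not at hle
    have : (2 : ℝ) ^ n ≤ 2 ^ K := pow_le_pow_right₀ (by norm_num) hle
    have : 0 < (2 : ℝ) ^ K := by positivity
    linarith
  obtain ⟨k, rfl : n = k + 1⟩ : ∃ k, n = k + 1 := ⟨n - 1, by omega⟩
  have h4 := hmin (m := k) (by omega)
  push Not at h4
  have h5 := hr _ hsp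
  have h6 := hK k (by omega)
  have hp : (0 : ℝ) < 2 ^ k := by positivity
  have h7 : δ * k + (3 * δ + C) < 1 / 6 * 2 ^ k := by
    have : δ * ((k : ℝ) ^ 1 / 2 ^ k) + (3 * δ + C) * (1 / 2 ^ k) = (δ * k + (3 * δ + C)) / 2 ^ k := by
      field_simp
    rw [this, div_lt_iff₀ hp] at h6
    exact h6
  push_cast at h5
  nlinarith

/-- Let r be the greatest distance from a point of the geodesic to the sequence. Go 2r to both sides
of such a point and then across to the sequence. The resulting quadrilateral puts the point within
2δ of a geodesic between two terms whose indices differ by at most 6r, unless r ≤ 2δ. Now `log_near`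
bounds r by a logarithm of r. -/
theorem IsHyp.morse_forward (hX : IsHyp X δ) (hδ : 0 ≤ δ) (C : ℝ) :
    ∃ R : ℝ, 0 ≤ R ∧ ∀ (ht : X → ℝ) (q : ℕ → X), IsAscending ht C q → ∀ (n : ℕ) (A : Set X),
      GeodSeg (q 0) (q n) A → ∀ a ∈ A, ∃ j ≤ n, dist a (q j) ≤ R := by
  obtain ⟨R, hR0, hR⟩ := exists_log_bound δ C
  refine ⟨R, hR0, fun ht q hq n A hA a ha => ?_⟩
  have hC := hq.nonneg
  have hA' := hA
  obtain ⟨l, c, hl, hc, h0, h1, rfl⟩ := hA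
  set f : X → ℝ := fun x => Metric.infDist x (q '' (Set.Iic n)) with hf
  have hfin : (q '' (Set.Iic n)).Finite := (Set.finite_Iic n).image q
  have hne : (q '' (Set.Iic n)).Nonempty := ⟨q 0, 0, by simp, rfl⟩
  have hatt : ∀ x, ∃ j ≤ n, dist x (q j) = f x := by
    intro x
    obtain ⟨y, ⟨j, hj, rfl⟩, h⟩ := hfin.isCompact.exists_infDist_eq_dist hne x
    exact ⟨j, hj, h.symm⟩
  have hle : ∀ x, ∀ j ≤ n, f x ≤ dist x (q j) := fun x j hj =>
    Metric.infDist_le_dist_of_mem ⟨j, hj, rfl⟩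
  have hcont : ContinuousOn c (Icc 0 l) := by
    apply LipschitzOnWith.continuousOn (K := 1)
    apply LipschitzOnWith.of_dist_le_mul
    intro s hs t ht
    rw [hc s hs t ht, Real.dist_eq]; simp
  have hfc : ContinuousOn (fun t => f (c t)) (Icc 0 l) :=
    (Metric.continuous_infDist_pt _).comp_continuousOn hcont
  obtain ⟨u, hu, hmax⟩ := isCompact_Icc.exists_isMaxOn ⟨0, le_rfl, hl⟩ hfc
  have hmax' : ∀ t ∈ Icc 0 l, f (c t) ≤ f (c u) := hmax
  suffices f (c u) ≤ R by
    obtain ⟨t, ht, rfl⟩ := ha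
    obtain ⟨j, hj, h⟩ := hatt (c t)
    exact ⟨j, hj, by linarith [hmax' t ht]⟩
  set r := f (c u) with hr
  have hr0 : 0 ≤ r := Metric.infDist_nonneg
  -- The connecting sides are harmless: they have length at most r and start 2r away from the
  -- extremal point, so being within 2δ of it forces r ≤ 2δ. If an end of the geodesic is reached
  -- first, the side degenerates to a term of the sequence, which is at distance at least r anyway.
  have key : ∀ t ∈ Icc 0 l, (t = 0 ∨ t = l ∨ |t - u| = 2 * r) → ∃ j ≤ n, ∃ B, GeodSeg (c t) (q j) B ∧
      dist (c t) (q j) ≤ r ∧ ∀ b ∈ B, dist (c u) b ≤ 2 * δ → r ≤ 2 * δ := by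
    intro t ht h
    have hend : ∀ j ≤ n, c t = q j → ∃ j ≤ n, ∃ B, GeodSeg (c t) (q j) B ∧
      dist (c t) (q j) ≤ r ∧ ∀ b ∈ B, dist (c u) b ≤ 2 * δ → r ≤ 2 * δ := by
      intro j hj hcj
      refine ⟨j, hj, {q j}, ⟨0, fun _ => q j, le_rfl, ?_, hcj.symm, rfl, ?_⟩, ?_, ?_⟩
      · intro s hs t ht
        have : s = 0 := le_antisymm hs.2 hs.1
        have : t = 0 := le_antisymm ht.2 ht.1
        simp [*]
      · simp
      · rw [hcj]; simpa using hr0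
      · rintro b rfl hb
        exact (hle _ j hj).trans hb
    rcases h with rfl | rfl | h
    · exact hend 0 (by omega) h0
    · exact hend n le_rfl h1
    · obtain ⟨j, hj, hjd⟩ := hatt (c t)
      obtain ⟨B, hB⟩ := hX.geod (c t) (q j)
      refine ⟨j, hj, B, hB, by linarith [hmax' t ht], fun b hb hub => ?_⟩
      have h2 : dist (c t) (c u) = 2 * r := by rw [hc t ht u hu, h]
      have h3 := hB.dist_left hb
      have := dist_triangle (c t) b (c u)
      rw [dist_comm (c t) b, dist_comm b (c u)] at this
      linarith [hmax' t ht]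
  obtain ⟨i, hi, B, hB, hBr, hBu⟩ := key (max 0 (u - 2 * r)) ⟨le_max_left _ _, max_le hl (by linarith [hu.2])⟩
    (by
      rcases le_total 0 (u - 2 * r) with h | h
      · right; right; rw [max_eq_right h, abs_of_nonpos (by linarith)]; ring
      · left; rw [max_eq_left h])
  obtain ⟨j, hj, D, hD, hDr, hDu⟩ := key (min l (u + 2 * r)) ⟨le_min hl (by linarith [hu.1]), min_le_left _ _⟩
    (by
      rcases le_total l (u + 2 * r) with h | h
      · right; left; rw [min_eq_left h]
      · right; right; rw [min_eq_right h, abs_of_nonneg (by linarith)]; ring)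
  set u1 := max 0 (u - 2 * r)
  set u2 := min l (u + 2 * r)
  have h1' : u1 ∈ Icc 0 l := ⟨le_max_left _ _, max_le hl (by linarith [hu.2])⟩
  have h2' : u2 ∈ Icc 0 l := ⟨le_min hl (by linarith [hu.1]), min_le_left _ _⟩
  have h1u : u1 ≤ u := max_le hu.1 (by linarith)
  have hu2 : u ≤ u2 := le_min hu.2 (by linarith)
  have hA2 : GeodSeg (c u1) (c u2) (c '' Icc u1 u2) :=
    geodSeg_image_Icc (h1u.trans hu2) fun s hs t ht =>
      hc s ⟨h1'.1.trans hs.1, hs.2.trans h2'.2⟩ t ⟨h1'.1.trans ht.1, ht.2.trans h2'.2⟩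
  obtain ⟨F, hF⟩ := hX.geod (q i) (q j)
  have hd12 : dist (c u1) (c u2) ≤ 4 * r := by
    rw [hc _ h1' _ h2', abs_of_nonpos (by linarith)]
    have : u - 2 * r ≤ u1 := le_max_right _ _
    have : u2 ≤ u + 2 * r := min_le_right _ _
    linarith
  have hij : dist (q i) (q j) ≤ 6 * r := by
    have e1 := dist_triangle (q i) (c u1) (q j)
    have e2 := dist_triangle (c u1) (c u2) (q j)
    rw [dist_comm (q i) (c u1)] at e1
    linarith
  have hijn : |(i : ℝ) - j| ≤ 6 * r := (hq.le_dist i j).trans hij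
  apply hR
  intro k hk
  have hk0 : 0 ≤ (k : ℝ) * δ := by positivity
  rcases hX.quad hA2 hB hF hD.symm ⟨u, ⟨h1u, hu2⟩, rfl⟩ with ⟨b, hb, hbu⟩ | ⟨b, hb, hbu⟩ | ⟨b, hb, hbu⟩
  · linarith [hBu b hb hbu]
  · have : ∃ m ≤ n, dist b (q m) ≤ k * δ + C := by
      rcases le_total i j with h | h
      · obtain ⟨m, rfl⟩ := Nat.exists_eq_add_of_le h
        have hm : m ≤ 2 ^ k := by
          have h9 : ((m : ℕ) : ℝ) ≤ 2 ^ k := by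
            refine le_trans ?_ (hijn.trans hk)
            rw [abs_sub_comm]; push_cast; rw [add_sub_cancel_left]; exact le_abs_self _
          exact_mod_cast h9
        obtain ⟨j', -, h8, h9⟩ := hX.log_near hq.step k i m hm F hF b hb
        exact ⟨j', by omega, h9⟩
      · obtain ⟨m, rfl⟩ := Nat.exists_eq_add_of_le h
        have hm : m ≤ 2 ^ k := by
          have h9 : ((m : ℕ) : ℝ) ≤ 2 ^ k := by
            refine le_trans ?_ (hijn.trans hk)
            push_cast; rw [add_sub_cancel_left]; exact le_abs_self _
          exact_mod_cast h9
        obtain ⟨j', -, h8, h9⟩ := hX.log_near hq.step k j m hm F hF.symm b hb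
        exact ⟨j', by omega, h9⟩
    obtain ⟨m, hm, hbm⟩ := this
    have := hle (c u) m hm
    linarith [dist_triangle (c u) b (q m)]
  · linarith [hDu b hb hbu]

/-- A curve with `1`-Lipschitz height passes close to a term of an ascending sequence as soon as the
curve stays close to the sequence and joins its ends. -/
theorem IsAscending.near_of_curve (hq : IsAscending ht C q) {l : ℝ} (hl : 0 ≤ l) {c : ℝ → X}
    (hc : ContinuousOn (fun t => ht (c t)) (Icc 0 l)) {n : ℕ} {R : ℝ}
    (h0 : dist (c 0) (q 0) ≤ R) (h1 : dist (c l) (q n) ≤ R)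
    (hR : ∀ t ∈ Icc 0 l, ∃ j ≤ n, dist (c t) (q j) ≤ R) {i : ℕ} (hi : i ≤ n) :
    ∃ t ∈ Icc 0 l, dist (q i) (c t) ≤ R + C * R := by
  have hC := hq.nonneg
  have main : ∀ t ∈ Icc 0 l, ∀ j : ℕ, dist (c t) (q j) ≤ R → |(i : ℝ) - j| ≤ R →
      ∃ t ∈ Icc 0 l, dist (q i) (c t) ≤ R + C * R := by
    intro t ht j hj hij
    refine ⟨t, ht, ?_⟩
    have h2 := hq.dist_le i j
    have h3 := dist_triangle (q i) (q j) (c t)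
    rw [dist_comm (q j)] at h3
    have := mul_le_mul_of_nonneg_left hij hC
    linarith
  have e0 := (hq.lip (c 0) (q 0)).trans h0
  have e1 := (hq.lip (c l) (q n)).trans h1
  rw [abs_le] at e0 e1
  rw [hq.ht_eq n] at e1
  by_cases ha : ht (c 0) ≤ ht (q 0) + i
  · by_cases hb : ht (q 0) + i ≤ ht (c l)
    -- The curve attains the height of `q i`. A term close to the curve at that time has almost the
    -- same height, hence an index within R of i. In the remaining cases an end of the curve already
    -- serves.
    · obtain ⟨t, ht', hti⟩ := intermediate_value_Icc hl hc ⟨ha, hb⟩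
      obtain ⟨j, hj, hjd⟩ := hR t ht'
      refine main t ht' j hjd ?_
      have := (hq.lip (c t) (q j)).trans hjd
      rw [hq.ht_eq j] at this
      have e : (i : ℝ) - j = ht (c t) - (ht (q 0) + j) := by simp only at hti; rw [hti]; ring
      rwa [e]
    · push Not at hb
      refine main l ⟨hl, le_rfl⟩ n h1 ?_
      have : (i : ℝ) ≤ n := by exact_mod_cast hi
      rw [abs_le]; constructor <;> linarith
  · push Not at ha
    refine main 0 ⟨le_rfl, hl⟩ 0 h0 ?_
    have : (0 : ℝ) ≤ i := by positivity
    rw [abs_le]; push_cast; constructor <;> linarith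

/-- Stability of ascending sequences: geodesics that join points near the ends of an ascending
sequence stay at bounded Hausdorff distance from the sequence. -/
theorem IsHyp.morse (hX : IsHyp X δ) (hδ : 0 ≤ δ) (C D : ℝ) (hD : 0 ≤ D) :
    ∃ R : ℝ, D ≤ R ∧ ∀ (ht : X → ℝ) (q : ℕ → X), IsAscending ht C q → ∀ (n : ℕ) (x y : X)
      (A : Set X), GeodSeg x y A → dist x (q 0) ≤ D → dist y (q n) ≤ D →
      (∀ a ∈ A, ∃ j ≤ n, dist a (q j) ≤ R) ∧ ∀ j ≤ n, ∃ a ∈ A, dist (q j) a ≤ R := by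
  obtain ⟨R, hR0, hR⟩ := hX.morse_forward hδ C
  have hS : 0 ≤ R + 2 * δ + D := by positivity
  refine ⟨(R + 2 * δ + D) + |C| * (R + 2 * δ + D), by nlinarith [abs_nonneg C], ?_⟩
  intro ht q hq n x y A hA hx hy
  have hC := hq.nonneg
  have h1 : ∀ a ∈ A, ∃ j ≤ n, dist a (q j) ≤ R + 2 * δ + D := by
    intro a ha
    obtain ⟨B1, hB1⟩ := hX.geod x (q 0)
    obtain ⟨B2, hB2⟩ := hX.geod (q 0) (q n)
    obtain ⟨B3, hB3⟩ := hX.geod (q n) y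
    rcases hX.quad hA hB1 hB2 hB3 ha with ⟨b, hb, hab⟩ | ⟨b, hb, hab⟩ | ⟨b, hb, hab⟩
    · have := hB1.dist_right hb
      exact ⟨0, by omega, by linarith [dist_triangle a b (q 0)]⟩
    · obtain ⟨j, hj, hbj⟩ := hR ht q hq n B2 hB2 b hb
      exact ⟨j, hj, by linarith [dist_triangle a b (q j)]⟩
    · have := hB3.dist_left hb
      rw [dist_comm (q n) y] at this
      exact ⟨n, le_rfl, by linarith [dist_triangle a b (q n)]⟩
  have hab : 0 ≤ |C| * (R + 2 * δ + D) := by positivity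
  refine ⟨fun a ha => ?_, fun i hi => ?_⟩
  · obtain ⟨j, hj, h⟩ := h1 a ha
    exact ⟨j, hj, by linarith⟩
  · obtain ⟨l, c, hl, hc, rfl, rfl, rfl⟩ := hA
    have hcont : ContinuousOn (fun t => ht (c t)) (Icc 0 l) := by
      apply LipschitzOnWith.continuousOn (K := 1)
      apply LipschitzOnWith.of_dist_le_mul
      intro s hs t ht'
      rw [Real.dist_eq, Real.dist_eq]
      refine (hq.lip _ _).trans ?_
      rw [hc s hs t ht']; simp
    obtain ⟨t, ht', h⟩ := hq.near_of_curve hl hcont (R := R + 2 * δ + D) (by linarith) (by linarith)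
      (fun t ht' => h1 _ ⟨t, ht', rfl⟩) hi
    refine ⟨c t, ⟨t, ht', rfl⟩, ?_⟩
    rwa [abs_of_nonneg hC]

/-- Let `g` be a geodesic path whose points all lie near two ascending sequences that start near its
ends. If `g` is long, then one of its subpaths is close to an initial piece of one of the sequences. -/
theorem IsHyp.fellow_travel (hX : IsHyp X δ) (hδ : 0 ≤ δ) (C D : ℝ) (hC : 0 ≤ C) (hD : 0 ≤ D) :
    ∃ R : ℝ, D ≤ R ∧ ∀ M : ℕ, ∃ B : ℝ, 0 < B ∧ ∀ (ht : X → ℝ) (q q' : ℕ → X), IsAscending ht C q →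
      IsAscending ht C q' → ∀ (g : ℝ → X) (s t : ℝ), s + B ≤ t →
      (∀ u ∈ Icc s t, ∀ w ∈ Icc s t, dist (g u) (g w) = |u - w|) →
      dist (g s) (q 0) ≤ D → dist (g t) (q' 0) ≤ D →
      (∀ u ∈ Icc s t, (∃ i, dist (g u) (q i) ≤ D) ∨ (∃ i, dist (g u) (q' i) ≤ D)) →
      ∃ p : ℕ → X, (p = q ∨ p = q') ∧ ∃ a b, s ≤ a ∧ a ≤ b ∧ b ≤ t ∧
        (∀ u ∈ Icc a b, ∃ j ≤ M, dist (g u) (p j) ≤ R) ∧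
        ∀ j ≤ M, ∃ u ∈ Icc a b, dist (p j) (g u) ≤ R := by
  obtain ⟨R1, hDR1, hR1⟩ := hX.morse hδ C (D + 1) (by linarith)
  obtain ⟨R2, hDR2, hR2⟩ := hX.morse hδ C R1 (by linarith)
  -- Half of B is enough length to force the index reached along a sequence to be at least M, since
  -- steps are bounded by C and both ends are located up to D + 1.
  refine ⟨R2, by linarith, fun M => ⟨2 * (C * M + 2 * (D + 1) + 1), by positivity, ?_⟩⟩
  intro ht q q' hq hq' g s t hB hg hs ht' hnear
  have hCM : 0 ≤ C * M := by positivity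
  have hst : s ≤ t := by linarith
  -- Near the last time at which `g` is close to `q`, it is also close to `q'`; moving by at most
  -- one unit of time costs the extra 1.
  obtain ⟨u0, hu0, ⟨i, hi⟩, i', hi'⟩ : ∃ u0 ∈ Icc s t, (∃ i, dist (g u0) (q i) ≤ D + 1) ∧
      ∃ i, dist (g u0) (q' i) ≤ D + 1 := by
    set S := {u | u ∈ Icc s t ∧ ∃ i, dist (g u) (q i) ≤ D} with hS
    have hne : S.Nonempty := ⟨s, ⟨le_rfl, hst⟩, 0, hs⟩
    have hbd : BddAbove S := ⟨t, fun u hu => hu.1.2⟩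
    obtain ⟨u0, hu0, hlt⟩ := exists_lt_of_lt_csSup hne (show sSup S - 1 / 2 < sSup S by linarith)
    obtain ⟨i, hi⟩ := hu0.2
    refine ⟨u0, hu0.1, ⟨i, by linarith⟩, ?_⟩
    have hu1 : min t (u0 + 1) ∈ Icc s t :=
      ⟨le_min hst (by linarith [hu0.1.1]), min_le_left _ _⟩
    have hd : dist (g u0) (g (min t (u0 + 1))) ≤ 1 := by
      rw [hg _ hu0.1 _ hu1, abs_sub_comm, abs_of_nonneg]
      · linarith [min_le_right t (u0 + 1)]
      · have := le_min hu0.1.2 (show u0 ≤ u0 + 1 by linarith); linarith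
    obtain ⟨j, hj⟩ : ∃ i, dist (g (min t (u0 + 1))) (q' i) ≤ D := by
      rcases le_total t (u0 + 1) with h | h
      · rw [min_eq_left h]; exact ⟨0, ht'⟩
      · rcases hnear _ hu1 with h2 | h2
        · have := le_csSup hbd (show min t (u0 + 1) ∈ S from ⟨hu1, h2⟩)
          rw [min_eq_right h] at this
          linarith
        · exact h2
    exact ⟨j, by linarith [dist_triangle (g u0) (g (min t (u0 + 1))) (q' j)]⟩
  have big : ∀ (p : ℕ → X), IsAscending ht C p → ∀ (w : ℝ) (k : ℕ), w ∈ Icc s t →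
      dist (g w) (p 0) ≤ D → dist (g u0) (p k) ≤ D + 1 →
      C * M + 2 * (D + 1) + 1 ≤ |w - u0| → M ≤ k := by
    intro p hp w k hw h1 h2 h3
    by_contra hk
    push Not at hk
    have h4 := hp.dist_add_le 0 k
    rw [zero_add] at h4
    have h5 : C * k ≤ C * M := by
      apply mul_le_mul_of_nonneg_left _ hC; exact_mod_cast hk.le
    rw [← hg _ hw _ hu0] at h3
    have e1 := dist_triangle (g w) (p 0) (g u0)
    have e2 := dist_triangle (p 0) (p k) (g u0)
    rw [dist_comm (p k) (g u0)] at e2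
    linarith
  have hsub : ∀ a b, s ≤ a → b ≤ t → ∀ u ∈ Icc a b, ∀ w ∈ Icc a b,
      dist (g u) (g w) = |u - w| := fun a b ha hb u hu w hw =>
    hg u ⟨ha.trans hu.1, hu.2.trans hb⟩ w ⟨ha.trans hw.1, hw.2.trans hb⟩
  -- One of the two halves of the path has length at least B / 2. Applying stability twice, first up
  -- to `u0` and then up to a time close to the M-th term, cuts out exactly the initial piece of
  -- length M.
  rcases le_total (C * M + 2 * (D + 1) + 1) (u0 - s) with hcase | hcase
  · have hMi := big q hq s i ⟨le_rfl, hst⟩ hs hi (by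
      rw [abs_sub_comm, abs_of_nonneg] <;> linarith)
    obtain ⟨-, h2⟩ := hR1 ht q hq i _ _ _ (geodSeg_image_Icc hu0.1 (hsub s u0 le_rfl hu0.2))
      (by linarith) hi
    obtain ⟨_, ⟨uM, huM, rfl⟩, hM⟩ := h2 M hMi
    obtain ⟨h3, h4⟩ := hR2 ht q hq M _ _ _
      (geodSeg_image_Icc huM.1 (hsub s uM le_rfl (huM.2.trans hu0.2))) (by linarith)
      (by rwa [dist_comm])
    refine ⟨q, Or.inl rfl, s, uM, le_rfl, huM.1, huM.2.trans hu0.2, ?_, ?_⟩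
    · exact fun u hu => h3 _ ⟨u, hu, rfl⟩
    · intro j hj
      obtain ⟨_, ⟨u, hu, rfl⟩, h⟩ := h4 j hj
      exact ⟨u, hu, h⟩
  · have hMi := big q' hq' t i' ⟨hst, le_rfl⟩ ht' hi' (by
      rw [abs_of_nonneg] <;> linarith)
    obtain ⟨-, h2⟩ := hR1 ht q' hq' i' _ _ _
      (geodSeg_image_Icc hu0.2 (hsub u0 t hu0.1 le_rfl)).symm (by linarith) hi'
    obtain ⟨_, ⟨uM, huM, rfl⟩, hM⟩ := h2 M hMi
    obtain ⟨h3, h4⟩ := hR2 ht q' hq' M _ _ _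
      (geodSeg_image_Icc huM.2 (hsub uM t (hu0.1.trans huM.1) le_rfl)).symm (by linarith)
      (by rwa [dist_comm])
    refine ⟨q', Or.inr rfl, uM, t, hu0.1.trans huM.1, huM.2, le_rfl, ?_, ?_⟩
    · exact fun u hu => h3 _ ⟨u, hu, rfl⟩
    · intro j hj
      obtain ⟨_, ⟨u, hu, rfl⟩, h⟩ := h4 j hj
      exact ⟨u, hu, h⟩

end Hyperbolic

/-! ### Free reduction of words -/

section Words

open FreeGroup

variable {α : Type*}

/-- The reduced word that is freely equal to a given word. -/
def red (p : List (α × Bool)) : List (α × Bool) := FreeGroup.reduce p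

/-- The number of times that a word contains the letter `c`, with either sign. -/
def cnt (c : α) (p : List (α × Bool)) : ℕ := (p.map Prod.fst).count c

@[simp] theorem mk_red (p : List (α × Bool)) : FreeGroup.mk (red p) = FreeGroup.mk p :=
  FreeGroup.reduce.self

theorem isReduced_red (p : List (α × Bool)) : IsReduced (red p) := by
  have := FreeGroup.isReduced_toWord (x := FreeGroup.mk p)
  rwa [FreeGroup.toWord_mk] at this

theorem red_congr {p q : List (α × Bool)} (h : FreeGroup.mk p = FreeGroup.mk q) : red p = red q :=
  FreeGroup.reduce.sound h

theorem red_eq_self {p : List (α × Bool)} (h : IsReduced p) : red p = p := h.reduce_eq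

theorem eq_of_mk_eq {p q : List (α × Bool)} (hp : IsReduced p) (hq : IsReduced q)
    (h : FreeGroup.mk p = FreeGroup.mk q) : p = q := by
  rw [← red_eq_self hp, ← red_eq_self hq, red_congr h]

theorem mk_append (p q : List (α × Bool)) :
    FreeGroup.mk (p ++ q) = FreeGroup.mk p * FreeGroup.mk q := FreeGroup.mul_mk.symm

theorem red_eq_of {p q : List (α × Bool)} (hq : IsReduced q)
    (h : FreeGroup.mk p = FreeGroup.mk q) : red p = q := by
  rw [red_congr h, red_eq_self hq]

theorem red_eq_nil {p : List (α × Bool)} (h : FreeGroup.mk p = 1) : red p = [] :=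
  red_eq_of IsReduced.nil h

theorem mk_invRev (p : List (α × Bool)) : FreeGroup.mk (invRev p) = (FreeGroup.mk p)⁻¹ :=
  FreeGroup.inv_mk.symm

theorem red_invRev (p : List (α × Bool)) : red (invRev p) = invRev (red p) :=
  FreeGroup.reduce_invRev

theorem isReduced_invRev {p : List (α × Bool)} (h : IsReduced p) : IsReduced (invRev p) := by
  have := isReduced_red (invRev p)
  rwa [red_invRev, red_eq_self h] at this

theorem red_length_le (p : List (α × Bool)) : (red p).length ≤ p.length := by
  have := FreeGroup.norm_mk_le (L₁ := p)
  rwa [FreeGroup.norm, FreeGroup.toWord_mk] at this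

theorem cnt_append (c : α) (p q : List (α × Bool)) : cnt c (p ++ q) = cnt c p + cnt c q := by
  simp [cnt]

/-- An elementary reduction deletes a letter together with its inverse, so it changes the count by 0
or 2. -/
theorem cnt_red (c : α) (p : List (α × Bool)) : cnt c (red p) % 2 = cnt c p % 2 := by
  have h : FreeGroup.Red p (red p) := FreeGroup.reduce.red
  generalize red p = q at h
  induction h with
  | refl => rfl
  | tail _ hs ih =>
    rw [← ih]
    cases hs with
    | @not L1 L2 x b =>
      simp only [cnt, List.map_append, List.map_cons, List.count_append, List.count_cons]
      by_cases hx : x = c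
      · simp [hx]; omega
      · simp [hx]

theorem isReduced_append_cons {A B : List (α × Bool)} {a b : α × Bool}
    (hA : IsReduced (A ++ [a])) (hB : IsReduced (b :: B)) (h : a.1 = b.1 → a.2 = b.2) :
    IsReduced (A ++ [a] ++ b :: B) := by
  unfold FreeGroup.IsReduced at *
  rw [List.isChain_append]
  refine ⟨hA, hB, ?_⟩
  intro x hx y hy
  simp at hx hy
  subst hx; subst hy; exact h

/-- The product of two reduced words reduces by cancelling a suffix against a prefix. -/
theorem exists_cancel {A : List (α × Bool)} : ∀ {B : List (α × Bool)}, IsReduced A → IsReduced B →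
    ∃ A₁ T B₂, A = A₁ ++ T ∧ B = invRev T ++ B₂ ∧ IsReduced (A₁ ++ B₂) := by
  induction A using List.reverseRecOn with
  | nil => intro B _ hB; exact ⟨[], [], B, rfl, by simp [invRev], hB⟩
  | append_singleton A a ih =>
    intro B hA hB
    cases B with
    | nil => exact ⟨A ++ [a], [], [], by simp, by simp [invRev], by simpa using hA⟩
    | cons b B =>
      by_cases h : a.1 = b.1 → a.2 = b.2
      · exact ⟨A ++ [a], [], b :: B, by simp, by simp [invRev], isReduced_append_cons hA hB h⟩
      · push Not at h
        obtain ⟨A₁, T, B₂, rfl, rfl, h3⟩ := ih (B := B) (hA.infix ⟨[], [a], by simp⟩)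
          (hB.infix ⟨[b], [], by simp⟩)
        refine ⟨A₁, T ++ [a], B₂, by simp, ?_, h3⟩
        have : b = (a.1, !a.2) := by
          ext
          · exact h.1.symm
          · have := h.2; revert this; cases a.2 <;> cases b.2 <;> simp
        rw [invRev_append, this]; simp [invRev]

theorem red_cancel {A₁ T B₂ A B : List (α × Bool)} (hA : A = A₁ ++ T) (hB : B = invRev T ++ B₂)
    (h : IsReduced (A₁ ++ B₂)) : red (A ++ B) = A₁ ++ B₂ := by
  apply red_eq_of h
  subst hA hB
  simp only [mk_append, mk_invRev]; group

/-- Appending one letter to a word either appends it to the reduced word or deletes the last letter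
of the reduced word. -/
theorem red_append_singleton (p : List (α × Bool)) (a : α × Bool) :
    red (p ++ [a]) = red p ++ [a] ∨ ∃ t, red p = red (p ++ [a]) ++ [t] := by
  obtain ⟨A₁, T, B₂, h1, h2, h3⟩ := exists_cancel (isReduced_red p) (IsReduced.singleton (a := a))
  have h4 : red (p ++ [a]) = A₁ ++ B₂ := by
    rw [← red_cancel h1 h2 h3]
    apply red_congr; rw [mk_append, mk_append]; simp only [mk_red]
  cases T with
  | nil => left; simp [invRev] at h1 h2; rw [h4, h1, h2]
  | cons t T =>
    right
    have := congrArg List.length h2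
    simp at this
    obtain rfl : T = [] := List.length_eq_zero_iff.1 (by omega)
    obtain rfl : B₂ = [] := List.length_eq_zero_iff.1 (by omega)
    exact ⟨t, by rw [h4, h1]; simp⟩

/-- Every prefix of the reduced form of a word is the reduced form of a prefix of the word. -/
theorem exists_prefix_red (p : List (α × Bool)) : ∀ r s, red p = r ++ s →
    ∃ p₁ p₂, p = p₁ ++ p₂ ∧ red p₁ = r := by
  induction p using List.reverseRecOn with
  | nil =>
    intro r s h
    have : red ([] : List (α × Bool)) = [] := red_eq_self IsReduced.nil
    rw [this] at h
    obtain ⟨rfl, rfl⟩ := List.nil_eq_append_iff.1 h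
    exact ⟨[], [], rfl, this⟩
  | append_singleton p a ih =>
    intro r s h
    rcases red_append_singleton p a with h1 | ⟨t, h1⟩
    · rcases List.eq_nil_or_concat s with rfl | ⟨s', b, rfl⟩
      · exact ⟨p ++ [a], [], by simp, by simpa using h⟩
      · rw [h1, List.concat_eq_append, ← List.append_assoc] at h
        have := (List.append_inj' h rfl).1
        obtain ⟨p₁, p₂, rfl, h2⟩ := ih r s' this
        exact ⟨p₁, p₂ ++ [a], by simp, h2⟩
    · rw [h] at h1
      obtain ⟨p₁, p₂, rfl, h2⟩ := ih r (s ++ [t]) (by rw [h1]; simp)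
      exact ⟨p₁, p₂ ++ [a], by simp, h2⟩

/-- As long as the reduced words stay long, their initial pieces do not change. -/
theorem take_red_append {C : ℕ} (Q : List (α × Bool)) : ∀ R : List (α × Bool),
    (∀ R₁ R₂, R = R₁ ++ R₂ → C ≤ (red (Q ++ R₁)).length) →
    (red (Q ++ R)).take C = (red Q).take C := by
  intro R
  induction R using List.reverseRecOn with
  | nil => simp
  | append_singleton R a ih =>
    intro h
    rw [← ih fun R₁ R₂ hR => h R₁ (R₂ ++ [a]) (by simp [hR])]
    have h1 := h R [a] rfl
    have h2 := h (R ++ [a]) [] (by simp)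
    rw [← List.append_assoc] at h2 ⊢
    rcases red_append_singleton (Q ++ R) a with h3 | ⟨t, h3⟩
    · rw [h3, List.take_append_of_le_length h1]
    · rw [h3, List.take_append_of_le_length h2]

theorem isReduced_append_append {A B D : List (α × Bool)} (h1 : IsReduced (A ++ B))
    (h2 : IsReduced (B ++ D)) (hB : B ≠ []) : IsReduced (A ++ B ++ D) :=
  IsReduced.append_overlap h1 h2 hB

/-- The tripod formed by two words: a prefix of the second and the rest of the first close up. -/
theorem exists_tripod (U W : List (α × Bool)) :
    ∃ U₁ U₂ W₁ W₂, U = U₁ ++ U₂ ∧ W = W₁ ++ W₂ ∧ FreeGroup.mk (U₂ ++ W₁) = 1 ∧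
      red (U ++ W) = red (U ++ W₁) ++ red W₂ := by
  obtain ⟨A, T, B, h1, h2, h3⟩ := exists_cancel (isReduced_red U) (isReduced_red W)
  obtain ⟨U₁, U₂, rfl, hU⟩ := exists_prefix_red U _ _ h1
  obtain ⟨W₁, W₂, rfl, hW⟩ := exists_prefix_red W _ _ h2
  have e1 := congrArg FreeGroup.mk h1
  have e2 := congrArg FreeGroup.mk h2
  have e3 := congrArg FreeGroup.mk hU
  have e4 := congrArg FreeGroup.mk hW
  simp only [mk_red, mk_append, mk_invRev] at e1 e2 e3 e4
  rw [e3] at e1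
  rw [e4] at e2
  have e5 : FreeGroup.mk U₂ = FreeGroup.mk T := mul_left_cancel e1
  have e6 : FreeGroup.mk W₂ = FreeGroup.mk B := mul_left_cancel e2
  refine ⟨U₁, U₂, W₁, W₂, rfl, rfl, ?_, ?_⟩
  · rw [mk_append, e4, e5]; group
  · have r1 : red (U₁ ++ U₂ ++ W₁) = A := by
      apply red_eq_of (h3.infix ⟨[], B, by simp⟩)
      simp only [mk_append, e3, e4, e5]; group
    have r2 : red W₂ = B := red_eq_of (h3.infix ⟨A, [], by simp⟩) e6
    rw [r1, r2]
    apply red_eq_of h3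
    simp only [mk_append, e3, e4, e5, e6]; group

end Words

/-! ### Edge paths -/

section Paths

open FreeGroup

variable {N C : Type*} {G : OrientedGraph N C}

theorem isPath_append {p q : List (C × Bool)} : ∀ {x y : N}, G.IsPath x (p ++ q) y ↔
    ∃ z, G.IsPath x p z ∧ G.IsPath z q y := by
  induction p with
  | nil => intro x y; simp [OrientedGraph.IsPath]
  | cons a p ih => intro x y; simp [OrientedGraph.IsPath, ih, and_assoc]

theorem OrientedGraph.IsPath.unique {p : List (C × Bool)} : ∀ {x y z : N}, G.IsPath x p y →
    G.IsPath x p z → y = z := by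
  induction p with
  | nil => intro x y z h1 h2; exact h1.symm.trans h2
  | cons a p ih => intro x y z h1 h2; exact ih h1.2 h2.2

@[simp] theorem init_not (a : C × Bool) : G.init (a.1, !a.2) = G.term a := by
  rcases a with ⟨c, _ | _⟩ <;> rfl

@[simp] theorem term_not (a : C × Bool) : G.term (a.1, !a.2) = G.init a := by
  rcases a with ⟨c, _ | _⟩ <;> rfl

theorem OrientedGraph.IsPath.invRev {p : List (C × Bool)} : ∀ {x y : N}, G.IsPath x p y →
    G.IsPath y (FreeGroup.invRev p) x := by
  induction p with
  | nil => intro x y h; exact h.symm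
  | cons a p ih =>
    intro x y h
    rw [invRev_cons, isPath_append]
    refine ⟨G.term a, ih h.2, ?_⟩
    simp only [FreeGroup.invRev, List.map_cons, List.map_nil, List.reverse_singleton]
    exact ⟨init_not a, by rw [term_not]; exact h.1⟩

theorem OrientedGraph.IsPath.step {p q : List (C × Bool)} (hs : Red.Step p q) {x y : N}
    (h : G.IsPath x p y) : G.IsPath x q y := by
  cases hs with
  | @not L1 L2 c b =>
    rw [isPath_append] at h ⊢
    obtain ⟨z, h1, h2, h3, h4⟩ := h
    refine ⟨z, h1, ?_⟩
    have : G.term (c, !b) = z := by rw [← h2]; exact term_not (c, b)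
    rwa [this] at h4

theorem OrientedGraph.IsPath.red {p : List (C × Bool)} {x y : N} (h : G.IsPath x p y) :
    G.IsPath x (red p) y := by
  have hr : FreeGroup.Red p (MappingTorus.red p) := FreeGroup.reduce.red
  generalize MappingTorus.red p = q at hr
  induction hr with
  | refl => exact h
  | tail _ hs ih => exact ih.step hs

/-- Reduced closed paths are trivial. -/
def IsForest (G : OrientedGraph N C) : Prop :=
  ∀ (x : N) (p : List (C × Bool)), G.IsPath x p x → IsReduced p → p = []

/-- A repetition in the same direction yields a nonempty reduced closed subpath. A repetition in
opposite directions encloses a reduced closed path, which must be empty, so the path backtracks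
there. -/
theorem IsForest.nodup (hG : IsForest G) {p : List (C × Bool)} : ∀ {x y : N}, G.IsPath x p y →
    IsReduced p → (p.map Prod.fst).Nodup := by
  induction p with
  | nil => simp
  | cons a p ih =>
    intro x y h hr
    rw [List.map_cons, List.nodup_cons]
    refine ⟨fun hmem => ?_, ih h.2 (hr.infix ⟨[a], [], by simp⟩)⟩
    obtain ⟨b, hb, hba⟩ := List.mem_map.1 hmem
    obtain ⟨q1, q2, rfl⟩ := List.append_of_mem hb
    obtain ⟨z, h1, h2, h3⟩ := isPath_append.1 h.2
    by_cases h4 : b.2 = a.2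
    · have hab : b = a := Prod.ext hba h4
      subst hab
      have := hG (G.init b) (b :: q1) ⟨rfl, by rw [h2]; exact h1⟩ (hr.infix ⟨[], b :: q2, by simp⟩)
      simp at this
    · have hb' : b = (a.1, !a.2) := by
        ext
        · exact hba
        · revert h4; cases a.2 <;> cases b.2 <;> simp
      have : G.init b = G.term a := by rw [hb']; exact init_not a
      rw [← h2, this] at h1
      obtain rfl := hG _ q1 h1 (hr.infix ⟨[a], b :: q2, by simp⟩)
      have := hr.infix (L₁ := [a, b]) ⟨[], q2, by simp⟩
      rw [isReduced_cons_cons] at this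
      exact h4 (this.1 hba.symm).symm

theorem IsForest.cnt_le_one (hG : IsForest G) {p : List (C × Bool)} {x y : N} (h : G.IsPath x p y)
    (hr : IsReduced p) (c : C) : cnt c p ≤ 1 :=
  List.nodup_iff_count_le_one.1 (hG.nodup h hr) c

theorem cnt_pos {p : List (C × Bool)} {c : C} : 0 < cnt c p ↔ c ∈ p.map Prod.fst :=
  List.count_pos_iff

/-- The reduced path crosses `c` exactly once, and reduction preserves parity. This is how
intersections that cannot be cancelled are turned into odd cardinalities. -/
theorem IsForest.odd_cnt (hG : IsForest G) {p : List (C × Bool)} {x y : N} (h : G.IsPath x p y)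
    {c : C} (hc : c ∈ (red p).map Prod.fst) : Odd (cnt c p) := by
  have h1 := hG.cnt_le_one h.red (isReduced_red p) c
  have h2 := cnt_pos.2 hc
  rw [Nat.odd_iff, ← cnt_red]; omega

end Paths

/-! ### Maps of graphs acting on edge paths -/

namespace GraphMap

open FreeGroup

variable {N C : Type*} {G : OrientedGraph N C} (Φ : GraphMap G)

theorem orientedImage_false (c : C) : Φ.orientedImage (c, false) = invRev (Φ.edgePath c) := by
  simp [orientedImage, invRev, List.map_reverse]

theorem orientedImage_true (c : C) : Φ.orientedImage (c, true) = Φ.edgePath c := rfl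

@[simp] theorem mapPath_nil : Φ.mapPath [] = [] := rfl

theorem mapPath_cons (a : C × Bool) (p : List (C × Bool)) :
    Φ.mapPath (a :: p) = Φ.orientedImage a ++ Φ.mapPath p := rfl

theorem mapPath_singleton (a : C × Bool) : Φ.mapPath [a] = Φ.orientedImage a := by
  simp [mapPath]

theorem mapPath_append (p q : List (C × Bool)) :
    Φ.mapPath (p ++ q) = Φ.mapPath p ++ Φ.mapPath q := by
  simp [mapPath]

theorem mapPath_invRev (p : List (C × Bool)) : Φ.mapPath (invRev p) = invRev (Φ.mapPath p) := by
  induction p with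
  | nil => rfl
  | cons a p ih =>
    rw [invRev_cons, mapPath_append, ih, mapPath_cons, invRev_append]
    congr 1
    rcases a with ⟨c, _ | _⟩
    · simp [invRev, mapPath_singleton, orientedImage, Function.comp_def]
    · simp only [invRev, List.map_cons, List.map_nil, List.reverse_singleton, Bool.not_true,
        mapPath_singleton, orientedImage_false]
      rfl

theorem isPath_orientedImage (a : C × Bool) :
    G.IsPath (Φ.onVert (G.init a)) (Φ.orientedImage a) (Φ.onVert (G.term a)) := by
  rcases a with ⟨c, _ | _⟩
  · rw [orientedImage_false]; exact OrientedGraph.IsPath.invRev (Φ.isPath c)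
  · exact Φ.isPath c

theorem isPath_mapPath {p : List (C × Bool)} : ∀ {x y : N}, G.IsPath x p y →
    G.IsPath (Φ.onVert x) (Φ.mapPath p) (Φ.onVert y) := by
  induction p with
  | nil => intro x y h; exact congrArg Φ.onVert h
  | cons a p ih =>
    intro x y h
    rw [mapPath_cons]
    refine OrientedGraph.IsPath.append _ ?_ (ih h.2)
    rw [← h.1]; exact Φ.isPath_orientedImage a

/-- The endomorphism of the free group on the edges induced by a graph map. -/
def hom : FreeGroup C →* FreeGroup C := FreeGroup.lift fun c => FreeGroup.mk (Φ.edgePath c)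

theorem hom_mk (p : List (C × Bool)) : Φ.hom (FreeGroup.mk p) = FreeGroup.mk (Φ.mapPath p) := by
  induction p with
  | nil => exact _root_.map_one _
  | cons a p ih =>
    have : FreeGroup.mk (a :: p) = FreeGroup.mk [a] * FreeGroup.mk p := by simp
    rw [this, _root_.map_mul, ih, mapPath_cons, mk_append]
    congr 1
    rcases a with ⟨c, _ | _⟩
    · rw [orientedImage_false, mk_invRev]; simp [hom]
    · simp [hom, orientedImage_true]

theorem mk_mapPath_congr {p q : List (C × Bool)} (h : FreeGroup.mk p = FreeGroup.mk q) :
    FreeGroup.mk (Φ.mapPath p) = FreeGroup.mk (Φ.mapPath q) := by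
  rw [← hom_mk, ← hom_mk, h]

theorem iterate_append (n : ℕ) : ∀ p q : List (C × Bool),
    Φ.mapPath^[n] (p ++ q) = Φ.mapPath^[n] p ++ Φ.mapPath^[n] q := by
  induction n with
  | zero => simp
  | succ n ih => intro p q; simp [mapPath_append, ih]

@[simp] theorem iterate_nil (n : ℕ) : Φ.mapPath^[n] [] = [] := by
  induction n with
  | zero => rfl
  | succ n ih => simp [ih]

theorem iterate_invRev (n : ℕ) : ∀ p : List (C × Bool),
    Φ.mapPath^[n] (invRev p) = invRev (Φ.mapPath^[n] p) := by
  induction n with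
  | zero => simp
  | succ n ih => intro p; simp [mapPath_invRev, ih]

theorem mk_iterate_congr (n : ℕ) : ∀ {p q : List (C × Bool)}, FreeGroup.mk p = FreeGroup.mk q →
    FreeGroup.mk (Φ.mapPath^[n] p) = FreeGroup.mk (Φ.mapPath^[n] q) := by
  induction n with
  | zero => intro p q h; exact h
  | succ n ih => intro p q h; exact ih (Φ.mk_mapPath_congr h)

theorem isPath_iterate (n : ℕ) : ∀ {p : List (C × Bool)} {x y : N}, G.IsPath x p y →
    G.IsPath (Φ.onVert^[n] x) (Φ.mapPath^[n] p) (Φ.onVert^[n] y) := by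
  induction n with
  | zero => intro p x y h; exact h
  | succ n ih => intro p x y h; exact ih (Φ.isPath_mapPath h)

/-- All iterates of the path are immersed. -/
def IsLegal (p : List (C × Bool)) : Prop := ∀ n, IsReduced (Φ.mapPath^[n] p)

variable {Φ}

theorem IsLegal.isReduced {p : List (C × Bool)} (h : Φ.IsLegal p) : IsReduced p := h 0

theorem IsLegal.infix {p q : List (C × Bool)} (h : Φ.IsLegal q) (hpq : p <:+: q) :
    Φ.IsLegal p := by
  obtain ⟨a, b, rfl⟩ := hpq
  intro n
  refine (h n).infix ⟨Φ.mapPath^[n] a, Φ.mapPath^[n] b, ?_⟩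
  rw [iterate_append, iterate_append]

theorem IsLegal.iterate {p : List (C × Bool)} (h : Φ.IsLegal p) (m : ℕ) :
    Φ.IsLegal (Φ.mapPath^[m] p) := by
  intro n
  rw [← Function.iterate_add_apply]; exact h _

theorem IsLegal.nil : Φ.IsLegal [] := fun n => by simp

variable (Φ)

/-- The word is a concatenation of `k` legal words. -/
inductive Pieces : ℕ → List (C × Bool) → Prop
  | nil : Pieces 0 []
  | cons (k : ℕ) (l p : List (C × Bool)) : Φ.IsLegal l → Pieces k p → Pieces (k + 1) (l ++ p)

variable {Φ}

theorem Pieces.drop {k : ℕ} {p : List (C × Bool)} (h : Φ.Pieces k p) : ∀ i, Φ.Pieces k (p.drop i) := by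
  induction h with
  | nil => intro i; simpa using Pieces.nil
  | cons k l p hl hp ih =>
    intro i
    rw [List.drop_append]
    exact Pieces.cons _ _ _ (hl.infix (List.drop_suffix i l).isInfix) (ih _)

theorem Pieces.take {k : ℕ} {p : List (C × Bool)} (h : Φ.Pieces k p) : ∀ i, Φ.Pieces k (p.take i) := by
  induction h with
  | nil => intro i; simpa using Pieces.nil
  | cons k l p hl hp ih =>
    intro i
    rw [List.take_append]
    exact Pieces.cons _ _ _ (hl.infix (List.take_prefix i l).isInfix) (ih _)

theorem Pieces.infix {k : ℕ} {p q : List (C × Bool)} (h : Φ.Pieces k q) (hpq : p <:+: q) :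
    Φ.Pieces k p := by
  obtain ⟨a, b, rfl⟩ := hpq
  have := (h.drop a.length).take p.length
  simpa using this

theorem Pieces.append {k m : ℕ} {p q : List (C × Bool)} (h : Φ.Pieces k p) (h2 : Φ.Pieces m q) :
    Φ.Pieces (k + m) (p ++ q) := by
  induction h with
  | nil => simpa using h2
  | cons k l p hl hp ih =>
    rw [List.append_assoc, Nat.add_right_comm]
    exact Pieces.cons _ _ _ hl ih

/-- Multiplying a reduced word by a legal one only trims the ends that meet, and trimming does not
increase the number of legal pieces. -/
theorem Pieces.red {k : ℕ} {p : List (C × Bool)} (h : Φ.Pieces k p) : Φ.Pieces k (red p) := by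
  induction h with
  | nil => rw [red_eq_self IsReduced.nil]; exact Pieces.nil
  | cons k l p hl hp ih =>
    obtain ⟨A, T, B, h1, h2, h3⟩ := exists_cancel hl.isReduced (isReduced_red p)
    have : MappingTorus.red (l ++ p) = A ++ B := by
      rw [← red_cancel h1 h2 h3]; apply red_congr; rw [mk_append, mk_append]; simp only [mk_red]
    rw [this]
    exact Pieces.cons _ _ _ (hl.infix ⟨[], T, by simp [h1]⟩) (ih.infix ⟨invRev T, [], by rw [h2]; simp⟩)

/-- A long concatenation of few legal words contains a long legal word. -/
theorem Pieces.exists_long {k n : ℕ} {p : List (C × Bool)} (h : Φ.Pieces k p)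
    (hp : k * n < p.length) : ∃ s, s <:+: p ∧ Φ.IsLegal s ∧ n < s.length := by
  induction h with
  | nil => simp at hp
  | cons k l p hl hp' ih =>
    by_cases hn : n < l.length
    · exact ⟨l, ⟨[], p, by simp⟩, hl, hn⟩
    · obtain ⟨s, h1, h2, h3⟩ := ih (by rw [List.length_append] at hp; nlinarith)
      exact ⟨s, h1.trans ⟨l, [], by simp⟩, h2, h3⟩

end GraphMap

/-! ### Train track maps on forests: bounded cancellation and persistence of legal segments -/

namespace GraphMap

open FreeGroup

variable {N C : Type*} {G : OrientedGraph N C} {Φ : GraphMap G}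

/-- The properties of the lift of an expanding train track map to a forest of universal covers. -/
structure IsTreeTrainTrack (Φ : GraphMap G) : Prop where
  forest : IsForest G
  proper : ∀ n : ℕ, ∃ K : ℕ, ∀ (x y : N) (p : List (C × Bool)), G.IsPath x p y → IsReduced p →
    (red (Φ.mapPath p)).length ≤ n → p.length ≤ K
  bounded : ∃ L : ℕ, ∀ a, (Φ.orientedImage a).length ≤ L
  legal : ∀ a, Φ.IsLegal [a]
  expand : ∃ k, ∀ a, 2 ≤ (Φ.mapPath^[k] [a]).length
  nonempty : ∀ a, Φ.orientedImage a ≠ []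

namespace IsTreeTrainTrack

theorem length_le_iterate (h : IsTreeTrainTrack Φ) (n : ℕ) : ∀ p : List (C × Bool),
    p.length ≤ (Φ.mapPath^[n] p).length := by
  have h1 : ∀ p : List (C × Bool), p.length ≤ (Φ.mapPath p).length := by
    intro p
    induction p with
    | nil => simp
    | cons a p ih =>
      rw [mapPath_cons, List.length_append, List.length_cons]
      have := List.length_pos_of_ne_nil (h.nonempty a)
      omega
  induction n with
  | zero => intro p; rfl
  | succ n ih => intro p; exact (h1 p).trans (ih _)

theorem two_mul_length_le {k : ℕ} (hk : ∀ a, 2 ≤ (Φ.mapPath^[k] [a]).length) :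
    ∀ p : List (C × Bool), 2 * p.length ≤ (Φ.mapPath^[k] p).length := by
  intro p
  induction p with
  | nil => simp
  | cons a p ih =>
    have : a :: p = [a] ++ p := rfl
    rw [this, iterate_append, List.length_append, List.length_append, List.length_singleton]
    have := hk a
    omega

theorem bounded_iterate (h : IsTreeTrainTrack Φ) (m : ℕ) : ∃ L : ℕ, ∀ p : List (C × Bool),
    (Φ.mapPath^[m] p).length ≤ L * p.length := by
  obtain ⟨L, hL⟩ := h.bounded
  have h1 : ∀ p : List (C × Bool), (Φ.mapPath p).length ≤ L * p.length := by
    intro p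
    induction p with
    | nil => simp
    | cons a p ih =>
      rw [mapPath_cons, List.length_append, List.length_cons]
      have := hL a
      nlinarith
  induction m with
  | zero => exact ⟨1, fun p => by simp⟩
  | succ m ih =>
    obtain ⟨L', hL'⟩ := ih
    refine ⟨L' * L, fun p => (hL' _).trans ?_⟩
    rw [mul_assoc]; exact Nat.mul_le_mul_left _ (h1 p)

theorem proper_iterate (h : IsTreeTrainTrack Φ) (m : ℕ) : ∀ n : ℕ, ∃ K : ℕ, ∀ (x y : N)
    (p : List (C × Bool)), G.IsPath x p y → IsReduced p →
    (red (Φ.mapPath^[m] p)).length ≤ n → p.length ≤ K := by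
  induction m with
  | zero =>
    intro n
    refine ⟨n, fun x y p _ hr hl => ?_⟩
    simpa [red_eq_self hr] using hl
  | succ m ih =>
    intro n
    obtain ⟨K1, hK1⟩ := ih n
    obtain ⟨K, hK⟩ := h.proper K1
    refine ⟨K, fun x y p hp hr hl => hK x y p hp hr ?_⟩
    refine hK1 _ _ _ (Φ.isPath_mapPath hp).red (isReduced_red _) ?_
    have : red (Φ.mapPath^[m] (red (Φ.mapPath p))) = red (Φ.mapPath^[m + 1] p) :=
      red_congr (Φ.mk_iterate_congr m (mk_red _))
    rwa [this]

/-- A cut in the image of a path comes from a cut of the path itself, up to part of the image of one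
letter. -/
theorem exists_prefix_iterate {m L : ℕ} (hL : ∀ a, (Φ.mapPath^[m] [a]).length ≤ L) :
    ∀ p r s : List (C × Bool), Φ.mapPath^[m] p = r ++ s →
    ∃ p₀ p₁ r', p = p₀ ++ p₁ ∧ r = Φ.mapPath^[m] p₀ ++ r' ∧ r'.length ≤ L := by
  intro p
  induction p with
  | nil =>
    intro r s h
    rw [iterate_nil] at h
    obtain ⟨rfl, rfl⟩ := List.nil_eq_append_iff.1 h
    exact ⟨[], [], [], rfl, by simp, by simp⟩
  | cons a p ih =>
    intro r s h
    have e : a :: p = [a] ++ p := rfl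
    rw [e, iterate_append] at h
    rcases List.append_eq_append_iff.1 h with ⟨t, h1, h2⟩ | ⟨t, h1, h2⟩
    · obtain ⟨p₀, p₁, r', rfl, rfl, h3⟩ := ih _ _ h2
      refine ⟨a :: p₀, p₁, r', rfl, ?_, h3⟩
      have : a :: p₀ = [a] ++ p₀ := rfl
      rw [h1, this, iterate_append, List.append_assoc]
    · refine ⟨[], a :: p, r, rfl, by simp, ?_⟩
      have := hL a
      rw [h1, List.length_append] at this
      omega

/-- Bounded cancellation. -/
theorem bounded_cancellation (h : IsTreeTrainTrack Φ) (m : ℕ) : ∃ K : ℕ, ∀ (x y : N)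
    (A B : List (C × Bool)), G.IsPath x (A ++ B) y → IsReduced (A ++ B) →
    IsReduced (Φ.mapPath^[m] B) → ∃ U D V, Φ.mapPath^[m] B = D ++ V ∧ D.length ≤ K ∧
      red (Φ.mapPath^[m] (A ++ B)) = U ++ V := by
  obtain ⟨L, hL⟩ := h.bounded_iterate m
  obtain ⟨K, hK⟩ := h.proper_iterate m (2 * L)
  have hL1 : ∀ a, (Φ.mapPath^[m] [a]).length ≤ L := fun a => by simpa using hL [a]
  refine ⟨L * K + L, fun x y A B hp hr hB => ?_⟩
  obtain ⟨U, T, V, h1, h2, h3⟩ := exists_cancel (isReduced_red (Φ.mapPath^[m] A)) hB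
  refine ⟨U, invRev T, V, h2, ?_, ?_⟩
  · obtain ⟨a1, a2, h4, h5⟩ := exists_prefix_red _ _ _ h1
    obtain ⟨A0, A1, r, rfl, rfl, hr1⟩ := exists_prefix_iterate hL1 _ _ _ h4
    obtain ⟨B0, B1, r', rfl, h6, hr2⟩ := exists_prefix_iterate hL1 _ _ _ h2
    have e1 := congrArg FreeGroup.mk h5
    have e2 := congrArg FreeGroup.mk h1
    have e3 := congrArg FreeGroup.mk h6
    simp only [mk_red, mk_append, iterate_append, mk_invRev] at e1 e2 e3
    have e4 : FreeGroup.mk (Φ.mapPath^[m] (A1 ++ B0)) = FreeGroup.mk (r ++ invRev r') := by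
      rw [iterate_append, mk_append, mk_append, mk_invRev]
      rw [← e1, mul_assoc] at e2
      rw [mul_left_cancel e2, ← inv_inv (FreeGroup.mk T), e3]
      group
    have hle : (red (Φ.mapPath^[m] (A1 ++ B0))).length ≤ 2 * L := by
      rw [red_congr e4]
      refine (red_length_le _).trans ?_
      rw [List.length_append, invRev_length]; omega
    obtain ⟨z, hz1, hz2⟩ := isPath_append.1 (show G.IsPath x (A0 ++ (A1 ++ B0 ++ B1)) y by
      simpa using hp)
    obtain ⟨w, hw1, hw2⟩ := isPath_append.1 hz2
    have h7 := hK z w (A1 ++ B0) hw1 (hr.infix ⟨A0, B1, by simp⟩) hle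
    rw [h6, List.length_append]
    rw [List.length_append] at h7
    have h8 := hL B0
    have : L * B0.length ≤ L * K := Nat.mul_le_mul_left _ (by omega)
    omega
  · apply red_eq_of h3
    have e2 := congrArg FreeGroup.mk h1
    rw [mk_red] at e2
    rw [iterate_append, mk_append, e2, h2]
    simp only [mk_append, mk_invRev]; group

/-- Bounded cancellation on both sides of a path with immersed image. -/
theorem bounded_cancellation_mid (h : IsTreeTrainTrack Φ) (m : ℕ) : ∃ K : ℕ, ∀ (x y : N)
    (A S B : List (C × Bool)), G.IsPath x (A ++ S ++ B) y → IsReduced (A ++ S ++ B) →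
    IsReduced (Φ.mapPath^[m] S) → 2 * K < (Φ.mapPath^[m] S).length →
    ∃ U D₁ V D₂ W, Φ.mapPath^[m] S = D₁ ++ V ++ D₂ ∧ D₁.length ≤ K ∧ D₂.length ≤ K ∧
      red (Φ.mapPath^[m] (A ++ S ++ B)) = U ++ V ++ W := by
  obtain ⟨K, hK⟩ := h.bounded_cancellation m
  refine ⟨K, fun x y A S B hp hr hS hlen => ?_⟩
  obtain ⟨z, hz1, hz2⟩ := isPath_append.1 hp
  obtain ⟨U, D₁, V₁, h1, h2, h3⟩ := hK x z A S hz1 (hr.infix ⟨[], B, by simp⟩) hS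
  obtain ⟨z', hz1', hz2'⟩ := isPath_append.1 (show G.IsPath x (A ++ (S ++ B)) y by simpa using hp)
  -- Cancellation on the right of `S` is cancellation on the left for the inverse path.
  obtain ⟨U', D', V', h4, h5, h6⟩ := hK y z' (invRev B) (invRev S)
    (by rw [← invRev_append]; exact hz2'.invRev)
    (by rw [← invRev_append]; exact isReduced_invRev (hr.infix ⟨A, [], by simp⟩))
    (by rw [iterate_invRev]; exact isReduced_invRev hS)
  rw [← invRev_append, iterate_invRev, red_invRev] at h6
  rw [iterate_invRev] at h4
  have h4' : Φ.mapPath^[m] S = invRev V' ++ invRev D' := by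
    rw [← invRev_append, ← h4, invRev_invRev]
  have h6' : red (Φ.mapPath^[m] (S ++ B)) = invRev V' ++ invRev U' := by
    rw [← invRev_append, ← h6, invRev_invRev]
  have hlenV : V'.length + D'.length = (Φ.mapPath^[m] S).length := by
    rw [h4', List.length_append, invRev_length, invRev_length]
  obtain ⟨V, hV⟩ : D₁ <+: invRev V' := by
    apply List.prefix_of_prefix_length_le (l₃ := Φ.mapPath^[m] S) ⟨V₁, h1.symm⟩ ⟨_, h4'.symm⟩
    rw [invRev_length]; omega
  have hV1 : V₁ = V ++ invRev D' := by
    rw [h1, ← hV, List.append_assoc] at h4'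
    exact List.append_cancel_left h4'
  -- The two cancelled ends are shorter than the image of `S`, so a nonempty overlap remains; two
  -- reduced words glued along a nonempty overlap are reduced.
  have hVne : V ≠ [] := by
    rintro rfl
    have := congrArg List.length hV
    rw [List.append_nil, invRev_length] at this
    omega
  have h1' : Φ.mapPath^[m] S = D₁ ++ V ++ invRev D' := by rw [h1, hV1, List.append_assoc]
  refine ⟨U, D₁, V, invRev D', invRev U', h1', h2, by rwa [invRev_length], ?_⟩
  have r1 := isReduced_red (Φ.mapPath^[m] (A ++ S))
  have r2 := isReduced_red (Φ.mapPath^[m] (S ++ B))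
  rw [h3, hV1] at r1
  rw [h6', ← hV] at r2
  apply red_eq_of
  · exact isReduced_append_append (r1.infix ⟨[], invRev D', by simp⟩)
      (r2.infix ⟨D₁, [], by simp⟩) hVne
  · have e1 := congrArg FreeGroup.mk h3
    have e2 := congrArg FreeGroup.mk h6'
    rw [hV1] at e1
    rw [← hV] at e2
    simp only [mk_red, mk_append, iterate_append, h1'] at e1 e2 ⊢
    have e3 : FreeGroup.mk (Φ.mapPath^[m] A) = FreeGroup.mk U * (FreeGroup.mk D₁)⁻¹ := by
      have := congrArg (· * (FreeGroup.mk D₁ * FreeGroup.mk V * FreeGroup.mk (invRev D'))⁻¹) e1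
      simp only [mul_inv_cancel_right] at this
      rw [this]; group
    have e4 : FreeGroup.mk (Φ.mapPath^[m] B) =
        (FreeGroup.mk (invRev D'))⁻¹ * FreeGroup.mk (invRev U') := by
      have := congrArg ((FreeGroup.mk D₁ * FreeGroup.mk V * FreeGroup.mk (invRev D'))⁻¹ * ·) e2
      simp only [inv_mul_cancel_left] at this
      rw [this]; group
    rw [e3, e4]; group

/-- `Z` lies deep inside a legal piece of the reduced path `R`. -/
def IsDeep (Φ : GraphMap G) (n : ℕ) (R Z : List (C × Bool)) : Prop :=
  ∃ R₁ S₁ S₂ R₂, R = R₁ ++ (S₁ ++ Z ++ S₂) ++ R₂ ∧ IsReduced R ∧ (∃ x y, G.IsPath x R y) ∧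
    Φ.IsLegal (S₁ ++ Z ++ S₂) ∧ Z ≠ [] ∧ n ≤ S₁.length ∧ n ≤ S₂.length

/-- Mapping forward multiplies the margins on the two sides of `Z` by the expansion factor `c`, and
bounded cancellation then costs at most a constant on each side. -/
theorem isDeep_step (h : IsTreeTrainTrack Φ) (m : ℕ) : ∃ K : ℕ, ∀ n ≥ K, ∀ (R Z : List (C × Bool)) (c : ℕ),
    IsDeep Φ n R Z → (∀ p : List (C × Bool), c * p.length ≤ (Φ.mapPath^[m] p).length) →
    1 ≤ c → IsDeep Φ (c * n - K) (red (Φ.mapPath^[m] R)) (Φ.mapPath^[m] Z) := by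
  obtain ⟨K, hK⟩ := h.bounded_cancellation_mid m
  refine ⟨K, fun n hn R Z c hd hc hc1 => ?_⟩
  obtain ⟨R₁, S₁, S₂, R₂, rfl, hr, ⟨x, y, hp⟩, hl, hZ, h1, h2⟩ := hd
  have hZ' : 1 ≤ (Φ.mapPath^[m] Z).length :=
    (List.length_pos_of_ne_nil hZ).trans_le (h.length_le_iterate m Z)
  have hS1 : c * n ≤ (Φ.mapPath^[m] S₁).length := (Nat.mul_le_mul_left _ h1).trans (hc S₁)
  have hS2 : c * n ≤ (Φ.mapPath^[m] S₂).length := (Nat.mul_le_mul_left _ h2).trans (hc S₂)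
  have hcn : n ≤ c * n := Nat.le_mul_of_pos_left n hc1
  have e : Φ.mapPath^[m] (S₁ ++ Z ++ S₂) = Φ.mapPath^[m] S₁ ++ Φ.mapPath^[m] Z ++ Φ.mapPath^[m] S₂ := by
    rw [iterate_append, iterate_append]
  obtain ⟨U, D₁, V, D₂, W, h3, h4, h5, h6⟩ := hK x y R₁ _ R₂ hp hr (hl m) (by
    rw [e, List.length_append, List.length_append]; omega)
  obtain ⟨S₁', hS₁'⟩ : D₁ <+: Φ.mapPath^[m] S₁ := by
    apply List.prefix_of_prefix_length_le (l₃ := Φ.mapPath^[m] (S₁ ++ Z ++ S₂))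
      ⟨V ++ D₂, by rw [h3, List.append_assoc]⟩ ⟨_, by rw [e, List.append_assoc]⟩
    omega
  obtain ⟨S₂', hS₂'⟩ : D₂ <:+ Φ.mapPath^[m] S₂ := by
    apply List.suffix_of_suffix_length_le (l₃ := Φ.mapPath^[m] (S₁ ++ Z ++ S₂))
      ⟨D₁ ++ V, h3.symm⟩ ⟨_, e.symm⟩
    omega
  have hV : V = S₁' ++ Φ.mapPath^[m] Z ++ S₂' := by
    rw [e, ← hS₁', ← hS₂'] at h3
    simp only [List.append_assoc] at h3
    have := List.append_cancel_left h3
    simp only [← List.append_assoc] at this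
    exact (List.append_cancel_right this).symm
  refine ⟨U, S₁', S₂', W, by rw [h6, hV], isReduced_red _, ⟨_, _, (Φ.isPath_iterate m hp).red⟩, ?_, ?_,
    ?_, ?_⟩
  · refine (hl.iterate m).infix ⟨D₁, D₂, ?_⟩
    rw [h3, hV]
  · exact List.ne_nil_of_length_pos hZ'
  · have := congrArg List.length hS₁'
    rw [List.length_append] at this; omega
  · have := congrArg List.length hS₂'
    rw [List.length_append] at this; omega

/-- Once the margins exceed the cancellation constants, k iterations double them and lose no more
than was gained, so they never shrink below the initial threshold at multiples of k. The remaining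
fewer than k iterations are absorbed by the threshold. -/
theorem persist (h : IsTreeTrainTrack Φ) : ∃ n₀ : ℕ, ∀ (R Z : List (C × Bool)), IsDeep Φ n₀ R Z →
    ∀ n, Φ.mapPath^[n] Z <:+: red (Φ.mapPath^[n] R) := by
  obtain ⟨k, hk⟩ := h.expand
  choose K hK using h.isDeep_step
  -- The sum serves as a common upper bound for the constants of the first k iterates.
  set n₀ := ∑ i ∈ Finset.range (k + 1), K i with hn₀
  have hle : ∀ i ≤ k, K i ≤ n₀ := fun i hi =>
    Finset.single_le_sum (f := K) (fun _ _ => Nat.zero_le _) (Finset.mem_range.2 (by omega))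
  refine ⟨n₀, fun R Z hd n => ?_⟩
  induction n using Nat.strong_induction_on generalizing R Z with
  | _ n ih =>
    by_cases hn : n ≤ k
    · obtain ⟨R₁, S₁, S₂, R₂, h1, -⟩ := hK n n₀ (hle n hn) R Z 1 hd
        (fun p => by simpa using h.length_le_iterate n p) le_rfl
      exact ⟨R₁ ++ S₁, S₂ ++ R₂, by rw [h1]; simp⟩
    · have hZ : Z ≠ [] := by obtain ⟨_, _, _, _, _, _, _, _, h, _⟩ := hd; exact h
      have hk1 : k ≠ 0 := by
        rintro rfl
        obtain ⟨a, Z', rfl⟩ := List.exists_cons_of_ne_nil hZ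
        have := hk a
        simp at this
      -- The new margin is 2 * n₀ - K k, which is again at least n₀.
      have hd' := hK k n₀ (hle k le_rfl) R Z 2 hd (two_mul_length_le hk) (by norm_num)
      have hd'' : IsDeep Φ n₀ (red (Φ.mapPath^[k] R)) (Φ.mapPath^[k] Z) := by
        obtain ⟨R₁, S₁, S₂, R₂, h1, h2, h3, h4, h5, h6, h7⟩ := hd'
        have := hle k le_rfl
        exact ⟨R₁, S₁, S₂, R₂, h1, h2, h3, h4, h5, by omega, by omega⟩
      have := ih (n - k) (by omega) _ _ hd''
      have e : red (Φ.mapPath^[n - k] (red (Φ.mapPath^[k] R))) = red (Φ.mapPath^[n] R) := by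
        have h9 : Φ.mapPath^[n] R = Φ.mapPath^[n - k] (Φ.mapPath^[k] R) := by
          rw [← Function.iterate_add_apply]; congr 2; omega
        rw [h9]
        exact red_congr (Φ.mk_iterate_congr _ (mk_red _))
      rw [e, ← Function.iterate_add_apply] at this
      have h10 : n - k + k = n := by omega
      rwa [h10] at this

theorem mem_map_fst_iterate (n : ℕ) (c c' : C) (b : Bool) :
    c' ∈ (Φ.mapPath^[n] [(c, b)]).map Prod.fst ↔ c' ∈ (Φ.mapPath^[n] [(c, true)]).map Prod.fst := by
  cases b
  · have : [(c, false)] = invRev [(c, true)] := rfl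
    rw [this, iterate_invRev]
    simp [invRev]
  · rfl

/-- In a path that is composed of few legal pieces, and whose reduced form shares a long segment with
that of the subpath `Qa`, some edge of `Qa` is never lost by reducing the images of the path. -/
theorem exists_edge (h : IsTreeTrainTrack Φ) : ∃ n₀ : ℕ, ∀ (k : ℕ) (x y : N)
    (E Q₀ Qa Qb : List (C × Bool)), E.length ≤ 1 → (E = [] ∨ Q₀ = []) →
    G.IsPath x (E ++ (Q₀ ++ (Qa ++ Qb))) y →
    red (Q₀ ++ (Qa ++ Qb)) = red Q₀ ++ red (Qa ++ Qb) →
    (∀ R₁ R₂, Qb = R₁ ++ R₂ → k * (2 * n₀) + 2 ≤ (red (Qa ++ R₁)).length) →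
    Φ.Pieces k (Q₀ ++ (Qa ++ Qb)) →
    ∃ c, Odd (cnt c Qa) ∧ ∀ n, ∀ c' ∈ (Φ.mapPath^[n] [(c, true)]).map Prod.fst,
      Odd (cnt c' (Φ.mapPath^[n] (Q₀ ++ (Qa ++ Qb)))) ∧ cnt c' (Φ.mapPath^[n] E) = 0 := by
  obtain ⟨n₀, hn₀⟩ := h.persist
  refine ⟨n₀, fun k x y E Q₀ Qa Qb hE hEQ hp hred hlen hpc => ?_⟩
  set Q := Q₀ ++ (Qa ++ Qb) with hQ
  obtain ⟨x', hx1, hx2⟩ := isPath_append.1 hp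
  obtain ⟨x₁, hq0, hq1⟩ := isPath_append.1 hx2
  obtain ⟨x₂, hqa, hqb⟩ := isPath_append.1 hq1
  -- Since the reduced words stay long while `Qb` is appended, `J` is a common prefix of `red (Qa ++
  -- Qb)` and `red Qa`. An edge found in `J` is thus crossed an odd number of times already by `Qa`.
  have htake := take_red_append Qa Qb hlen
  set J := (red (Qa ++ Qb)).take (k * (2 * n₀) + 2) with hJ
  have hJlen : J.length = k * (2 * n₀) + 2 := by
    rw [hJ, List.length_take, min_eq_left (hlen Qb [] (by simp))]
  obtain ⟨a, J', hJ'⟩ : ∃ a J', J = a :: J' :=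
    List.exists_cons_of_ne_nil (List.ne_nil_of_length_pos (by omega))
  have hJ'len : k * (2 * n₀) < J'.length := by
    rw [hJ', List.length_cons] at hJlen; omega
  obtain ⟨rest, hrest⟩ : J <+: red (Qa ++ Qb) := List.take_prefix _ _
  obtain ⟨rest', hrest'⟩ : J <+: red Qa := htake ▸ List.take_prefix _ _
  have hpc' : Φ.Pieces k J' := hpc.red.infix ⟨red Q₀ ++ [a], rest, by rw [hred, ← hrest, hJ']; simp⟩
  -- One of the two spare letters is `a`, set aside at the front. The rest still has more than k *
  -- (2 * n₀) letters, hence contains a legal word with a letter having n₀ letters on each side.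
  obtain ⟨s, ⟨j₁, j₂, hs⟩, hsl, hslen⟩ := hpc'.exists_long hJ'len
  obtain ⟨S₁, S₂, z, hsplit, hS1, hS2⟩ : ∃ S₁ S₂ z, s = S₁ ++ [z] ++ S₂ ∧ n₀ ≤ S₁.length ∧
      n₀ ≤ S₂.length := by
    refine ⟨s.take n₀, s.drop (n₀ + 1), s[n₀]'(by omega), ?_, ?_, ?_⟩
    · rw [List.take_append_getElem, List.take_append_drop]
    · rw [List.length_take]; omega
    · rw [List.length_drop]; omega
  have hJ's : J' = j₁ ++ (S₁ ++ [z] ++ S₂) ++ j₂ := by rw [← hs, hsplit]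
  rw [hsplit] at hsl
  have hdeep : IsDeep Φ n₀ (red Q) [z] :=
    ⟨red Q₀ ++ [a] ++ j₁, S₁, S₂, j₂ ++ rest, by rw [hred, ← hrest, hJ', hJ's]; simp,
      isReduced_red _, ⟨_, _, hx2.red⟩, hsl, by simp, hS1, hS2⟩
  -- If `E` is present then `Q₀` is empty, and cancelling against the single letter of `E` can
  -- remove only `a`, so the margins are untouched.
  have hdeepE : IsDeep Φ n₀ (red (E ++ Q)) [z] := by
    rcases hEQ with rfl | hQ0
    · exact hdeep
    · have hnil : red Q₀ = [] := by rw [hQ0]; exact red_eq_self IsReduced.nil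
      have hR : red Q = a :: (j₁ ++ (S₁ ++ [z] ++ S₂) ++ (j₂ ++ rest)) := by
        rw [hred, hnil, ← hrest, hJ', hJ's]; simp
      obtain ⟨A, T, B, h1, h2, h3⟩ := exists_cancel (isReduced_red E) (isReduced_red Q)
      have hEr : red (E ++ Q) = A ++ B := by
        rw [← red_cancel h1 h2 h3]; apply red_congr
        rw [mk_append E Q, mk_append (red E), mk_red, mk_red]
      have hT : T.length ≤ 1 := by
        have := congrArg List.length h1
        rw [List.length_append] at this
        have := red_length_le E
        omega
      have hpath := hp.red
      have hrr := isReduced_red (E ++ Q)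
      rw [hEr] at hpath hrr ⊢
      rw [hR] at h2
      cases T with
      | nil =>
        simp only [FreeGroup.invRev, List.map_nil, List.reverse_nil, List.nil_append] at h2
        exact ⟨A ++ [a] ++ j₁, S₁, S₂, j₂ ++ rest, by rw [← h2]; simp, hrr, ⟨_, _, hpath⟩, hsl, by simp,
          hS1, hS2⟩
      | cons t T =>
        obtain rfl : T = [] := List.length_eq_zero_iff.1 (by simpa using hT)
        simp only [FreeGroup.invRev, List.map_cons, List.map_nil, List.reverse_singleton,
          List.singleton_append, List.cons.injEq] at h2
        exact ⟨A ++ j₁, S₁, S₂, j₂ ++ rest, by rw [← h2.2]; simp, hrr, ⟨_, _, hpath⟩, hsl, by simp,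
          hS1, hS2⟩
  obtain ⟨c, b⟩ := z
  refine ⟨c, ?_, fun n c' hc' => ?_⟩
  · apply h.forest.odd_cnt hqa
    rw [← hrest', hJ', hJ's]; simp
  · rw [← mem_map_fst_iterate n c c' b] at hc'
    have o1 : Odd (cnt c' (Φ.mapPath^[n] Q)) := by
      apply h.forest.odd_cnt (Φ.isPath_iterate n hx2)
      obtain ⟨s1, s2, hs12⟩ := hn₀ _ _ hdeep n
      have e : red (Φ.mapPath^[n] (red Q)) = red (Φ.mapPath^[n] Q) :=
        red_congr (Φ.mk_iterate_congr _ (mk_red _))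
      rw [← e, ← hs12]
      simp only [List.map_append, List.mem_append]; exact Or.inl (Or.inr hc')
    have o2 : Odd (cnt c' (Φ.mapPath^[n] (E ++ Q))) := by
      apply h.forest.odd_cnt (Φ.isPath_iterate n hp)
      obtain ⟨s1, s2, hs12⟩ := hn₀ _ _ hdeepE n
      have e : red (Φ.mapPath^[n] (red (E ++ Q))) = red (Φ.mapPath^[n] (E ++ Q)) :=
        red_congr (Φ.mk_iterate_congr _ (mk_red _))
      rw [← e, ← hs12]
      simp only [List.map_append, List.mem_append]; exact Or.inl (Or.inr hc')
    refine ⟨o1, ?_⟩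
    rw [iterate_append, cnt_append] at o2
    have hEl : Φ.IsLegal E := by
      cases E with
      | nil => exact IsLegal.nil
      | cons e E =>
        obtain rfl : E = [] := List.length_eq_zero_iff.1 (by simpa using hE)
        exact h.legal e
    -- The image of `E` is immersed in a forest, so it crosses `c'` at most once. The counts with
    -- and without `E` are both odd, hence its own count is even, that is, zero.
    have := h.forest.cnt_le_one (Φ.isPath_iterate n hx1) (hEl n) c'
    rw [Nat.odd_iff] at o1 o2
    omega

end IsTreeTrainTrack

end GraphMap

/-! ### Metric graphs -/

section ChainBasic

variable {ι P : Type*} {arc : ι → ℝ → P} {wt : ι → ℝ} {S : Set P}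

theorem ChainLength.trans {x y z : P} {a b : ℝ} (h : ChainLength arc wt S x y a)
    (h' : ChainLength arc wt S y z b) : ChainLength arc wt S x z (a + b) := by
  induction h with
  | nil x => simpa using h'
  | cons i s t y l hs ht hi _ ih =>
    rw [add_assoc]; exact ChainLength.cons i s t z _ hs ht hi (ih h')

theorem ChainLength.single {i : ι} {s t : ℝ} (hs : s ∈ Icc (0 : ℝ) 1) (ht : t ∈ Icc (0 : ℝ) 1)
    (hi : ∀ u ∈ Icc (0 : ℝ) 1, arc i u ∈ S) :
    ChainLength arc wt S (arc i s) (arc i t) (|s - t| * wt i) := by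
  have := ChainLength.cons (wt := wt) i s t _ _ hs ht hi (ChainLength.nil (arc i t))
  simpa using this

theorem ChainLength.symm {x y : P} {a : ℝ} (h : ChainLength arc wt S x y a) :
    ChainLength arc wt S y x a := by
  induction h with
  | nil x => exact ChainLength.nil x
  | cons i s t y l hs ht hi _ ih =>
    have := ih.trans (ChainLength.single (wt := wt) ht hs hi)
    rwa [abs_sub_comm, add_comm] at this

theorem ChainLength.nonneg (hwt : ∀ i, 0 < wt i) {x y : P} {a : ℝ}
    (h : ChainLength arc wt S x y a) : 0 ≤ a := by
  induction h with
  | nil x => rfl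
  | cons i s t y l hs ht hi _ ih => have := (hwt i).le; positivity

theorem pathDist_comm (x y : P) : pathDist arc wt S x y = pathDist arc wt S y x := by
  unfold pathDist
  congr 1
  ext a; exact ⟨fun h => ChainLength.symm h, fun h => ChainLength.symm h⟩

theorem pathDist_le (hwt : ∀ i, 0 < wt i) {x y : P} {a : ℝ} (h : ChainLength arc wt S x y a) :
    pathDist arc wt S x y ≤ a :=
  csInf_le ⟨0, fun _ hb => ChainLength.nonneg hwt hb⟩ h

theorem pathDist_nonneg (hwt : ∀ i, 0 < wt i) (x y : P) : 0 ≤ pathDist arc wt S x y :=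
  Real.sInf_nonneg fun _ hb => ChainLength.nonneg hwt hb

theorem pathDist_self (hwt : ∀ i, 0 < wt i) (x : P) : pathDist arc wt S x x = 0 :=
  le_antisymm (pathDist_le hwt (ChainLength.nil x)) (pathDist_nonneg hwt x x)

/-- A function that is Lipschitz along each edge is Lipschitz along chains. The given chain matters:
without one, `pathDist` is the infimum of the empty set, which is 0. -/
theorem le_pathDist {f : P → ℝ} (hf : ∀ i, ∀ s ∈ Icc (0 : ℝ) 1, ∀ t ∈ Icc (0 : ℝ) 1,
    |f (arc i s) - f (arc i t)| ≤ |s - t| * wt i) {x y : P} {a : ℝ}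
    (h : ChainLength arc wt S x y a) : |f x - f y| ≤ pathDist arc wt S x y := by
  refine le_csInf ⟨a, h⟩ ?_
  clear h
  intro b hb
  have hb : ChainLength arc wt S x y b := hb
  induction hb with
  | nil x => simp
  | cons i s t y l hs ht hi hc ih =>
    have := abs_sub_le (f (arc i s)) (f (arc i t)) (f y)
    linarith [hf i s hs t ht, ih hc]

/-- A chain can be followed at unit speed. -/
theorem ChainLength.exists_curve (hwt : ∀ i, 0 < wt i) {x y : P} {a : ℝ}
    (h : ChainLength arc wt S x y a) (hx : x ∈ S) : ∃ c : ℝ → P, c 0 = x ∧ c a = y ∧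
    (∀ t ∈ Icc 0 a, c t ∈ S) ∧
    ∀ s t, 0 ≤ s → s ≤ t → t ≤ a → ChainLength arc wt S (c s) (c t) (t - s) := by
  induction h with
  | nil x =>
    refine ⟨fun _ => x, rfl, rfl, fun _ _ => hx, fun s t h1 h2 h3 => ?_⟩
    have : t - s = 0 := by linarith
    rw [this]; exact ChainLength.nil x
  | cons i s t y l hs ht hi hc ih =>
    obtain ⟨c, h0, h1, hS, hcc⟩ := ih (hi t ht)
    have hw := hwt i
    set d := |s - t| * wt i with hd
    have hd0 : 0 ≤ d := by positivity
    have hl : 0 ≤ l := ChainLength.nonneg hwt hc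
    by_cases hst : s = t
    · subst hst
      have hd0 : d = 0 := by simp [hd]
      rw [hd0]
      refine ⟨c, h0, by simpa using h1, by simpa using hS, by simpa using hcc⟩
    have hdpos : 0 < d := by
      have : 0 < |s - t| := abs_pos.2 (sub_ne_zero.2 hst)
      positivity
    set f : ℝ → ℝ := fun u => s + (t - s) * (u / d) with hf
    have hf0 : f 0 = s := by simp [hf]
    have hfd : f d = t := by simp [hf, div_self hdpos.ne']
    have hfI : ∀ u ∈ Icc 0 d, f u ∈ Icc (0 : ℝ) 1 := by
      intro u hu
      have h1 : 0 ≤ u / d := div_nonneg hu.1 hd0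
      have h2 : u / d ≤ 1 := (div_le_one hdpos).2 hu.2
      have e : f u = (1 - u / d) * s + (u / d) * t := by simp only [hf]; ring
      rw [e]
      constructor
      · have := hs.1; have := ht.1
        have : 0 ≤ 1 - u / d := by linarith
        positivity
      · have a1 := mul_le_mul_of_nonneg_left hs.2 (show 0 ≤ 1 - u / d by linarith)
        have a2 := mul_le_mul_of_nonneg_left ht.2 h1
        linarith
    have hfdist : ∀ u v, |f u - f v| * wt i = |u - v| := by
      intro u v
      have : f u - f v = (t - s) * ((u - v) / d) := by simp only [hf]; ring
      rw [this, abs_mul, abs_div, abs_of_pos hdpos, abs_sub_comm t s]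
      have : |s - t| * (|u - v| / d) * wt i = d * (|u - v| / d) := by rw [hd]; ring
      rw [this]; field_simp
    refine ⟨fun u => if u ≤ d then arc i (f u) else c (u - d), ?_, ?_, ?_, ?_⟩
    · simp [hd0, hf0]
    · by_cases hl0 : l = 0
      · have : c 0 = y := by rw [← h1, hl0]
        simp [hl0, hfd, ← this, h0]
      · have : ¬ d + l ≤ d := by
          have := lt_of_le_of_ne hl (Ne.symm hl0); linarith
        simp only [this, if_false]; rw [add_sub_cancel_left, h1]
    · intro u hu
      by_cases h : u ≤ d
      · simp only [h, if_true]; exact hi _ (hfI u ⟨hu.1, h⟩)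
      · simp only [h, if_false]; push Not at h
        exact hS _ ⟨by linarith, by linarith [hu.2]⟩
    · intro u v hu huv hv
      by_cases h : v ≤ d
      · have h' : u ≤ d := huv.trans h
        simp only [h, h', if_true]
        have := ChainLength.single (wt := wt) (hfI u ⟨hu, h'⟩) (hfI v ⟨hu.trans huv, h⟩) hi
        rwa [hfdist, abs_sub_comm, abs_of_nonneg (by linarith)] at this
      · by_cases h' : u ≤ d
        · simp only [h, h', if_true, if_false]
          push Not at h
          have e1 := ChainLength.single (wt := wt) (hfI u ⟨hu, h'⟩) (hfI d ⟨hd0, le_rfl⟩) hi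
          rw [hfdist, abs_sub_comm, abs_of_nonneg (by linarith), hfd] at e1
          have e2 := hcc 0 (v - d) le_rfl (by linarith) (by linarith)
          rw [h0] at e2
          have := e1.trans e2
          have e : d - u + (v - d - 0) = v - u := by ring
          rwa [e] at this
        · simp only [h, h', if_false]
          push Not at h h'
          have := hcc (u - d) (v - d) (by linarith) (by linarith) (by linarith)
          have e : v - d - (u - d) = v - u := by ring
          rwa [e] at this

end ChainBasic

/-! ### Metric graphs: normal forms of chains, existence of geodesics, local structure of the metric
-/

section MetricGraph

variable {N ι P : Type*}

/-- The arcs parametrize the edges of a graph: they meet only at the images of the vertices. -/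
structure IsArcSystem (G : OrientedGraph N ι) (nd : N → P) (arc : ι → ℝ → P) : Prop where
  src : ∀ i, arc i 0 = nd (G.src i)
  tgt : ∀ i, arc i 1 = nd (G.tgt i)
  nd_inj : Function.Injective nd
  inner_ne : ∀ i, ∀ s ∈ Ioo (0 : ℝ) 1, ∀ x, arc i s ≠ nd x
  inner_inj : ∀ i j, ∀ s ∈ Ioo (0 : ℝ) 1, ∀ t ∈ Ioo (0 : ℝ) 1, arc i s = arc j t → i = j ∧ s = t

/-- The arc of an oriented edge. -/
def oarc (arc : ι → ℝ → P) (e : ι × Bool) (s : ℝ) : P := arc e.1 (cond e.2 s (1 - s))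

theorem oarc_rev (arc : ι → ℝ → P) (e : ι × Bool) (s : ℝ) :
    oarc arc (e.1, !e.2) s = oarc arc e (1 - s) := by
  rcases e with ⟨i, _ | _⟩ <;> simp [oarc]

theorem exists_oarc (arc : ι → ℝ → P) (e : ι × Bool) (s : ℝ) : ∃ t, oarc arc e s = arc e.1 t ∧
    (s ∈ Icc (0 : ℝ) 1 → t ∈ Icc (0 : ℝ) 1) ∧ (s ∈ Ioo (0 : ℝ) 1 → t ∈ Ioo (0 : ℝ) 1) := by
  rcases e with ⟨i, _ | _⟩
  · exact ⟨1 - s, rfl, fun h => ⟨by linarith [h.2], by linarith [h.1]⟩,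
      fun h => ⟨by linarith [h.2], by linarith [h.1]⟩⟩
  · exact ⟨s, rfl, fun h => h, fun h => h⟩

/-- The length of an edge path. -/
def pathLen (wt : ι → ℝ) (l : List (ι × Bool)) : ℝ := (l.map fun e => wt e.1).sum

theorem pathLen_nonneg {wt : ι → ℝ} (hwt : ∀ i, 0 < wt i) (l : List (ι × Bool)) :
    0 ≤ pathLen wt l := by
  apply List.sum_nonneg
  simp only [List.mem_map]
  rintro _ ⟨e, -, rfl⟩; exact (hwt _).le

variable {G : OrientedGraph N ι} {nd : N → P} {arc : ι → ℝ → P} {wt : ι → ℝ} {S : Set P}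

variable (G nd arc wt S) in
/-- `p` lies on an edge of `S` that starts at `x`, at distance `a` from `x` along the edge. -/
def Spur (p : P) (x : N) (a : ℝ) : Prop :=
  (p = nd x ∧ a = 0) ∨ ∃ (e : ι × Bool) (s : ℝ), s ∈ Icc (0 : ℝ) 1 ∧
    (∀ u ∈ Icc (0 : ℝ) 1, arc e.1 u ∈ S) ∧ p = oarc arc e s ∧ x = G.init e ∧ a = s * wt e.1

theorem mem_cases {s : ℝ} (hs : s ∈ Icc (0 : ℝ) 1) : s ∈ Ioo (0 : ℝ) 1 ∨ s = 0 ∨ s = 1 := by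
  rcases hs.1.eq_or_lt with h | h
  · exact Or.inr (Or.inl h.symm)
  · rcases hs.2.eq_or_lt with h' | h'
    · exact Or.inr (Or.inr h')
    · exact Or.inl ⟨h, h'⟩

namespace IsArcSystem

variable (hA : IsArcSystem G nd arc)
include hA

theorem oarc_zero (e : ι × Bool) : oarc arc e 0 = nd (G.init e) := by
  rcases e with ⟨i, _ | _⟩
  · simp [oarc, hA.tgt]; rfl
  · simp [oarc, hA.src]; rfl

theorem oarc_one (e : ι × Bool) : oarc arc e 1 = nd (G.term e) := by
  rcases e with ⟨i, _ | _⟩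
  · simp [oarc, hA.src]; rfl
  · simp [oarc, hA.tgt]; rfl

theorem oarc_ne {e : ι × Bool} {s : ℝ} (hs : s ∈ Ioo (0 : ℝ) 1) (x : N) : oarc arc e s ≠ nd x := by
  obtain ⟨t, h1, -, h2⟩ := exists_oarc arc e s
  rw [h1]; exact hA.inner_ne _ t (h2 hs) x

theorem oarc_inj {e : ι × Bool} {s t : ℝ} (hs : s ∈ Ioo (0 : ℝ) 1) (ht : t ∈ Ioo (0 : ℝ) 1)
    (h : oarc arc e s = oarc arc e t) : s = t := by
  rcases e with ⟨i, _ | _⟩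
  · have := (hA.inner_inj i i (1 - s) ⟨by linarith [hs.2], by linarith [hs.1]⟩ (1 - t)
      ⟨by linarith [ht.2], by linarith [ht.1]⟩ h).2
    linarith
  · exact (hA.inner_inj i i s hs t ht h).2

theorem oarc_eq {e e' : ι × Bool} {s t : ℝ} (hs : s ∈ Ioo (0 : ℝ) 1) (ht : t ∈ Ioo (0 : ℝ) 1)
    (h : oarc arc e s = oarc arc e' t) : (e' = e ∧ t = s) ∨ (e' = (e.1, !e.2) ∧ t = 1 - s) := by
  obtain ⟨s', h1, -, h2⟩ := exists_oarc arc e s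
  obtain ⟨t', h3, -, h4⟩ := exists_oarc arc e' t
  have he := (hA.inner_inj _ _ s' (h2 hs) t' (h4 ht) (by rw [← h1, ← h3, h])).1
  by_cases hb : e'.2 = e.2
  · have hee : e' = e := Prod.ext he.symm hb
    subst hee
    exact Or.inl ⟨rfl, (hA.oarc_inj hs ht h).symm⟩
  · have hee : e' = (e.1, !e.2) := by
      ext
      · exact he.symm
      · revert hb; cases e.2 <;> cases e'.2 <;> simp
    subst hee
    rw [oarc_rev] at h
    refine Or.inr ⟨rfl, ?_⟩
    have := hA.oarc_inj hs ⟨by linarith [ht.2], by linarith [ht.1]⟩ h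
    linarith

theorem oarc_eq_nd {e : ι × Bool} {s : ℝ} (hs : s ∈ Icc (0 : ℝ) 1) {x : N}
    (h : oarc arc e s = nd x) : (s = 0 ∧ x = G.init e) ∨ (s = 1 ∧ x = G.term e) := by
  rcases mem_cases hs with h1 | rfl | rfl
  · exact absurd h (hA.oarc_ne h1 x)
  · rw [hA.oarc_zero] at h; exact Or.inl ⟨rfl, (hA.nd_inj h).symm⟩
  · rw [hA.oarc_one] at h; exact Or.inr ⟨rfl, (hA.nd_inj h).symm⟩

/-- If one end of a subsegment of an edge is a vertex, then the other end lies on a spur. -/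
theorem spur_of_node {i : ι} (hi : ∀ u ∈ Icc (0 : ℝ) 1, arc i u ∈ S) {s t : ℝ}
    (hs : s ∈ Icc (0 : ℝ) 1) (ht : t ∈ Icc (0 : ℝ) 1) {y : N} (h : arc i t = nd y) :
    Spur G nd arc wt S (arc i s) y (|s - t| * wt i) := by
  rcases hA.oarc_eq_nd (e := (i, true)) ht h with ⟨rfl, rfl⟩ | ⟨rfl, rfl⟩
  · refine Or.inr ⟨(i, true), s, hs, hi, rfl, rfl, ?_⟩
    rw [sub_zero, abs_of_nonneg hs.1]
  · refine Or.inr ⟨(i, false), 1 - s, ⟨by linarith [hs.2], by linarith [hs.1]⟩, hi, ?_, rfl, ?_⟩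
    · simp [oarc]
    · rw [abs_of_nonpos (by linarith [hs.2]), neg_sub]

theorem Spur.path_of_node {x y : N} {a : ℝ} (h : Spur G nd arc wt S (nd y) x a) :
    ∃ l, G.IsPath y l x ∧ (∀ e ∈ l, ∀ u ∈ Icc (0 : ℝ) 1, arc e.1 u ∈ S) ∧ pathLen wt l = a := by
  rcases h with ⟨h, rfl⟩ | ⟨e, s, hs, hi, h, rfl, rfl⟩
  · exact ⟨[], hA.nd_inj h, by simp, by simp [pathLen]⟩
  · rcases hA.oarc_eq_nd hs h.symm with ⟨rfl, rfl⟩ | ⟨rfl, rfl⟩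
    · exact ⟨[], rfl, by simp, by simp [pathLen]⟩
    · refine ⟨[(e.1, !e.2)], ⟨init_not e, term_not e⟩, ?_, by simp [pathLen]⟩
      intro e' he'
      obtain rfl : e' = (e.1, !e.2) := by simpa using he'
      exact hi

/-- If the old starting point is a vertex, its spur is turned into an edge path and the new segment
becomes the spur. If it is interior to an edge, the spur runs along that same edge, from one end or
the other, and only its length changes. -/
theorem spur_move (hwt : ∀ i, 0 < wt i) {i : ι} (hi : ∀ u ∈ Icc (0 : ℝ) 1, arc i u ∈ S) {s t : ℝ}
    (hs : s ∈ Icc (0 : ℝ) 1) (ht : t ∈ Icc (0 : ℝ) 1) {x : N} {a : ℝ}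
    (h : Spur G nd arc wt S (arc i t) x a) : ∃ x' a' l, Spur G nd arc wt S (arc i s) x' a' ∧
      G.IsPath x' l x ∧ (∀ e ∈ l, ∀ u ∈ Icc (0 : ℝ) 1, arc e.1 u ∈ S) ∧
      a' + pathLen wt l ≤ |s - t| * wt i + a := by
  have hw := hwt i
  by_cases hn : ∃ y, arc i t = nd y
  · obtain ⟨y, hy⟩ := hn
    rw [hy] at h
    obtain ⟨l, h1, h2, h3⟩ := Spur.path_of_node hA h
    exact ⟨y, _, l, hA.spur_of_node hi hs ht hy, h1, h2, by rw [h3]⟩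
  · have ht' : t ∈ Ioo (0 : ℝ) 1 := by
      rcases mem_cases ht with h | rfl | rfl
      · exact h
      · exact absurd ⟨_, hA.src i⟩ hn
      · exact absurd ⟨_, hA.tgt i⟩ hn
    rcases h with ⟨h, -⟩ | ⟨e, r, hr, -, h, rfl, rfl⟩
    · exact absurd ⟨x, h⟩ hn
    · have hr' : r ∈ Ioo (0 : ℝ) 1 := by
        rcases mem_cases hr with h' | rfl | rfl
        · exact h'
        · rw [hA.oarc_zero] at h; exact absurd ⟨_, h⟩ hn
        · rw [hA.oarc_one] at h; exact absurd ⟨_, h⟩ hn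
      rcases hA.oarc_eq (e := (i, true)) ht' hr' h with ⟨rfl, rfl⟩ | ⟨rfl, rfl⟩
      · refine ⟨_, _, [], Or.inr ⟨(i, true), s, hs, hi, rfl, rfl, rfl⟩, rfl, by simp, ?_⟩
        simp only [pathLen, List.map_nil, List.sum_nil, add_zero, ← add_mul]
        apply mul_le_mul_of_nonneg_right _ hw.le
        linarith [le_abs_self (s - r)]
      · refine ⟨_, _, [], Or.inr ⟨(i, false), 1 - s, ⟨by linarith [hs.2], by linarith [hs.1]⟩, hi,
          by simp [oarc], rfl, rfl⟩, rfl, by simp, ?_⟩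
        simp only [pathLen, List.map_nil, List.sum_nil, add_zero, ← add_mul]
        apply mul_le_mul_of_nonneg_right _ hw.le
        linarith [neg_abs_le (s - t)]

/-- Every chain can be replaced by a shorter one that is constant, runs inside an edge, or consists
of an edge path with two spurs. -/
theorem normal_form (hwt : ∀ i, 0 < wt i) {p q : P} {a : ℝ} (h : ChainLength arc wt S p q a) :
    p = q ∨ (∃ i, ∃ s ∈ Ioo (0 : ℝ) 1, ∃ t ∈ Ioo (0 : ℝ) 1, (∀ u ∈ Icc (0 : ℝ) 1, arc i u ∈ S) ∧
      p = arc i s ∧ q = arc i t ∧ |s - t| * wt i ≤ a) ∨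
    ∃ x y b c l, Spur G nd arc wt S p x b ∧ Spur G nd arc wt S q y c ∧ G.IsPath x l y ∧
      (∀ e ∈ l, ∀ u ∈ Icc (0 : ℝ) 1, arc e.1 u ∈ S) ∧ b + pathLen wt l + c ≤ a := by
  have direct : ∀ {i : ι} {s t : ℝ}, s ∈ Icc (0 : ℝ) 1 → t ∈ Icc (0 : ℝ) 1 →
      (∀ u ∈ Icc (0 : ℝ) 1, arc i u ∈ S) → ∀ {a : ℝ}, |s - t| * wt i ≤ a →
      ((∃ j, ∃ s' ∈ Ioo (0 : ℝ) 1, ∃ t' ∈ Ioo (0 : ℝ) 1, (∀ u ∈ Icc (0 : ℝ) 1, arc j u ∈ S) ∧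
        arc i s = arc j s' ∧ arc i t = arc j t' ∧ |s' - t'| * wt j ≤ a) ∨
      ∃ x y b c l, Spur G nd arc wt S (arc i s) x b ∧ Spur G nd arc wt S (arc i t) y c ∧
        G.IsPath x l y ∧ (∀ e ∈ l, ∀ u ∈ Icc (0 : ℝ) 1, arc e.1 u ∈ S) ∧
        b + pathLen wt l + c ≤ a) := by
    intro i s t hs ht hi a ha
    by_cases hn : ∃ y, arc i t = nd y
    · obtain ⟨y, hy⟩ := hn
      exact Or.inr ⟨y, y, _, 0, [], hA.spur_of_node hi hs ht hy, Or.inl ⟨hy, rfl⟩, rfl, by simp,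
        by simpa [pathLen] using ha⟩
    by_cases hn' : ∃ y, arc i s = nd y
    · obtain ⟨y, hy⟩ := hn'
      exact Or.inr ⟨y, y, 0, _, [], Or.inl ⟨hy, rfl⟩, hA.spur_of_node hi ht hs hy, rfl, by simp,
        by simpa [pathLen, abs_sub_comm] using ha⟩
    left
    refine ⟨i, s, ?_, t, ?_, hi, rfl, rfl, ha⟩
    · rcases mem_cases hs with h | rfl | rfl
      · exact h
      · exact absurd ⟨_, hA.src i⟩ hn'
      · exact absurd ⟨_, hA.tgt i⟩ hn'
    · rcases mem_cases ht with h | rfl | rfl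
      · exact h
      · exact absurd ⟨_, hA.src i⟩ hn
      · exact absurd ⟨_, hA.tgt i⟩ hn
  induction h with
  | nil x => exact Or.inl rfl
  | cons i s t y l hs ht hi _ ih =>
    right
    have hw := hwt i
    rcases ih with h | ⟨j, s', hs', t', ht', hj, h1, rfl, h3⟩ | ⟨x, y', b, c, l', h1, h2, h3, h4, h5⟩
    · rw [← h]
      refine direct hs ht hi ?_
      have := ChainLength.nonneg hwt ‹_›
      linarith
    · by_cases ht2 : t ∈ Ioo (0 : ℝ) 1
      · obtain ⟨rfl, rfl⟩ := hA.inner_inj _ _ t ht2 s' hs' h1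
        refine direct hs (Ioo_subset_Icc_self ht') hi ?_
        have := abs_sub_le s t t'
        nlinarith
      · exfalso
        rcases mem_cases ht with h | rfl | rfl
        · exact ht2 h
        · rw [hA.src] at h1; exact hA.inner_ne _ _ hs' _ h1.symm
        · rw [hA.tgt] at h1; exact hA.inner_ne _ _ hs' _ h1.symm
    · right
      obtain ⟨x', b', l'', h6, h7, h8, h9⟩ := hA.spur_move hwt hi hs ht h1
      refine ⟨x', y', b', c, l'' ++ l', h6, h2, OrientedGraph.IsPath.append _ h7 h3, ?_, ?_⟩
      · intro e he
        rcases List.mem_append.1 he with he | he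
        · exact h8 e he
        · exact h4 e he
      · have : pathLen wt (l'' ++ l') = pathLen wt l'' + pathLen wt l' := by simp [pathLen]
        rw [this]; linarith

theorem Spur.chain {p : P} {x : N} {a : ℝ} (h : Spur G nd arc wt S p x a) :
    ChainLength arc wt S p (nd x) a := by
  rcases h with ⟨rfl, rfl⟩ | ⟨e, s, hs, hi, rfl, rfl, rfl⟩
  · exact ChainLength.nil _
  · rw [← hA.oarc_zero]
    rcases e with ⟨i, _ | _⟩
    · have := ChainLength.single (wt := wt) (s := 1 - s) (t := 1) ⟨by linarith [hs.2], by linarith [hs.1]⟩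
        (by simp) hi
      simp only [oarc, cond_false, sub_zero]
      have e : |1 - s - 1| = s := by
        rw [show 1 - s - 1 = -s by ring, abs_neg, abs_of_nonneg hs.1]
      rwa [e] at this
    · have := ChainLength.single (wt := wt) (s := s) (t := 0) hs (by simp) hi
      simp only [oarc, cond_true]
      rwa [sub_zero, abs_of_nonneg hs.1] at this

theorem chain_of_path : ∀ {l : List (ι × Bool)} {x y : N}, G.IsPath x l y →
    (∀ e ∈ l, ∀ u ∈ Icc (0 : ℝ) 1, arc e.1 u ∈ S) →
    ChainLength arc wt S (nd x) (nd y) (pathLen wt l) := by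
  intro l
  induction l with
  | nil => rintro x y rfl _; simpa [pathLen] using ChainLength.nil (nd x)
  | cons e l ih =>
    intro x y h hi
    have h1 := ih h.2 fun e' he' => hi e' (List.mem_cons_of_mem _ he')
    have h2 : Spur G nd arc wt S (nd (G.term e)) (G.init e) (1 * wt e.1) :=
      Or.inr ⟨e, 1, by simp, hi e (by simp), (hA.oarc_one e).symm, rfl, rfl⟩
    have h3 := (Spur.chain hA h2).symm.trans h1
    rw [h.1] at h3
    simpa [pathLen] using h3

end IsArcSystem

theorem exists_min_wt (hwt : ∀ i, 0 < wt i) (hfin : (range wt).Finite) :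
    ∃ c : ℝ, 0 < c ∧ ∀ i, c ≤ wt i := by
  rcases isEmpty_or_nonempty ι with h | h
  · exact ⟨1, one_pos, fun i => h.elim i⟩
  · obtain ⟨_, ⟨i, rfl⟩, h2⟩ := hfin.exists_minimal (range_nonempty wt)
    refine ⟨wt i, hwt i, fun j => ?_⟩
    rcases le_total (wt i) (wt j) with h | h
    · exact h
    · exact h2 ⟨j, rfl⟩ h

/-- Edge lengths take finitely many values and are bounded below, so a bounded total is a sum of
boundedly many terms from a finite set. -/
theorem finite_pathLen (hwt : ∀ i, 0 < wt i) (hfin : (range wt).Finite) (c : ℝ) :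
    {a | ∃ l : List (ι × Bool), a = pathLen wt l ∧ a ≤ c}.Finite := by
  obtain ⟨m, hm, hmw⟩ := exists_min_wt hwt hfin
  obtain ⟨n, hn⟩ := exists_nat_ge (c / m)
  have : Finite (range wt) := hfin
  refine ((List.finite_length_le (range wt) n).image fun l => (l.map Subtype.val).sum).subset ?_
  rintro a ⟨l, rfl, hl⟩
  refine ⟨l.map fun e => ⟨wt e.1, e.1, rfl⟩, ?_, by simp [pathLen, Function.comp_def]⟩
  have h1 : ∀ l : List (ι × Bool), m * l.length ≤ pathLen wt l := by
    intro l
    induction l with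
    | nil => simp [pathLen]
    | cons e l ih =>
      have := hmw e.1
      simp only [pathLen, List.map_cons, List.sum_cons, List.length_cons] at ih ⊢
      push_cast; linarith
  have h2 : (l.length : ℝ) ≤ n := by
    have := h1 l
    rw [div_le_iff₀ hm] at hn
    nlinarith
  simpa using h2

namespace IsArcSystem

variable (hA : IsArcSystem G nd arc)
include hA

theorem finite_spur (hfin : (range wt).Finite) (p : P) :
    {a | ∃ x, Spur G nd arc wt S p x a}.Finite := by
  by_cases hn : ∃ y, p = nd y
  · obtain ⟨y, rfl⟩ := hn
    refine ((Set.finite_singleton 0).union hfin).subset ?_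
    rintro a ⟨x, ⟨h, rfl⟩ | ⟨e, s, hs, hi, h, rfl, rfl⟩⟩
    · exact Or.inl rfl
    · rcases hA.oarc_eq_nd hs h.symm with ⟨rfl, -⟩ | ⟨rfl, -⟩
      · left; simp
      · right; exact ⟨e.1, by simp⟩
  by_cases hn' : ∃ e, ∃ s ∈ Ioo (0 : ℝ) 1, p = oarc arc e s
  · obtain ⟨e, s, hs, rfl⟩ := hn'
    refine (Set.toFinite {s * wt e.1, (1 - s) * wt e.1}).subset ?_
    rintro a ⟨x, ⟨h, rfl⟩ | ⟨e', s', hs', hi, h, rfl, rfl⟩⟩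
    · exact absurd ⟨x, h⟩ hn
    · have hs2 : s' ∈ Ioo (0 : ℝ) 1 := by
        rcases mem_cases hs' with h' | rfl | rfl
        · exact h'
        · rw [hA.oarc_zero] at h; exact absurd ⟨_, h⟩ hn
        · rw [hA.oarc_one] at h; exact absurd ⟨_, h⟩ hn
      rcases hA.oarc_eq hs hs2 h with ⟨rfl, rfl⟩ | ⟨rfl, rfl⟩ <;> simp
  · convert Set.finite_empty
    rw [Set.eq_empty_iff_forall_notMem]
    rintro a ⟨x, ⟨h, rfl⟩ | ⟨e', s', hs', hi, h, rfl, rfl⟩⟩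
    · exact hn ⟨x, h⟩
    · rcases mem_cases hs' with h' | rfl | rfl
      · exact hn' ⟨e', s', h', h⟩
      · rw [hA.oarc_zero] at h; exact absurd ⟨_, h⟩ hn
      · rw [hA.oarc_one] at h; exact absurd ⟨_, h⟩ hn

/-- The infimum that defines the path metric is attained. -/
theorem chain_pathDist (hwt : ∀ i, 0 < wt i) (hfin : (range wt).Finite) {p q : P} {a : ℝ}
    (h : ChainLength arc wt S p q a) : ChainLength arc wt S p q (pathDist arc wt S p q) := by
  -- Lengths of chains in normal form. Below the bound `a` there are only finitely many, and they
  -- dominate all chains, so the infimum is a minimum.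
  set F : Set ℝ := {b | ChainLength arc wt S p q b ∧ b ≤ a ∧ (b = 0 ∨
    (∃ i, ∃ s ∈ Ioo (0 : ℝ) 1, ∃ t ∈ Ioo (0 : ℝ) 1, p = arc i s ∧ q = arc i t ∧ b = |s - t| * wt i) ∨
    ∃ x y b₁ b₂, ∃ l : List (ι × Bool), Spur G nd arc wt S p x b₁ ∧ Spur G nd arc wt S q y b₂ ∧
      b = b₁ + pathLen wt l + b₂)} with hF
  have hFfin : F.Finite := by
    have h1 : {b : ℝ | ∃ i, ∃ s ∈ Ioo (0 : ℝ) 1, ∃ t ∈ Ioo (0 : ℝ) 1, p = arc i s ∧ q = arc i t ∧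
        b = |s - t| * wt i}.Finite := by
      apply Set.Subsingleton.finite
      rintro _ ⟨i, s, hs, t, ht, rfl, rfl, rfl⟩ _ ⟨j, s', hs', t', ht', h1, h2, rfl⟩
      obtain ⟨rfl, rfl⟩ := hA.inner_inj _ _ _ hs _ hs' h1
      obtain ⟨-, rfl⟩ := hA.inner_inj _ _ _ ht _ ht' h2
      rfl
    have h2 := hA.finite_spur (S := S) hfin p
    have h3 := hA.finite_spur (S := S) hfin q
    have h4 := finite_pathLen hwt hfin a
    have h5 := Set.Finite.image2 (fun b c => b + c) (Set.Finite.image2 (fun b c => b + c) h2 h4) h3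
    refine ((Set.finite_singleton 0).union (h1.union h5)).subset ?_
    rintro b ⟨hb, hba, h | h | ⟨x, y, b₁, b₂, l, hx, hy, rfl⟩⟩
    · exact Or.inl h
    · exact Or.inr (Or.inl h)
    · refine Or.inr (Or.inr ⟨b₁ + pathLen wt l, ⟨b₁, ⟨x, hx⟩, pathLen wt l, ⟨l, rfl, ?_⟩, rfl⟩,
        b₂, ⟨y, hy⟩, rfl⟩)
      have := ChainLength.nonneg hwt (Spur.chain hA hx)
      have := ChainLength.nonneg hwt (Spur.chain hA hy)
      linarith
  have hdom : ∀ b, ChainLength arc wt S p q b → b ≤ a → ∃ b' ∈ F, b' ≤ b := by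
    intro b hb hba
    rcases hA.normal_form hwt hb with rfl | ⟨i, s, hs, t, ht, hi, rfl, rfl, h3⟩ |
      ⟨x, y, b₁, b₂, l, h1, h2, h3, h4, h5⟩
    · exact ⟨0, ⟨ChainLength.nil p, (ChainLength.nonneg hwt hb).trans hba, Or.inl rfl⟩,
        ChainLength.nonneg hwt hb⟩
    · exact ⟨_, ⟨ChainLength.single (Ioo_subset_Icc_self hs) (Ioo_subset_Icc_self ht) hi,
        h3.trans hba, Or.inr (Or.inl ⟨i, s, hs, t, ht, rfl, rfl, rfl⟩)⟩, h3⟩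
    · exact ⟨_, ⟨((Spur.chain hA h1).trans (hA.chain_of_path h3 h4)).trans (Spur.chain hA h2).symm,
        h5.trans hba, Or.inr (Or.inr ⟨x, y, b₁, b₂, l, h1, h2, rfl⟩)⟩, h5⟩
  obtain ⟨b₀, hb₀, -⟩ := hdom a h le_rfl
  obtain ⟨m, hm, hmin⟩ := hFfin.exists_minimal ⟨b₀, hb₀⟩
  have hmin' : ∀ b ∈ F, m ≤ b := fun b hb => by
    rcases le_total m b with h | h
    · exact h
    · exact hmin hb h
  have : pathDist arc wt S p q = m := by
    refine le_antisymm (pathDist_le hwt hm.1) (le_csInf ⟨a, h⟩ ?_)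
    intro b hb
    rcases le_total b a with hba | hba
    · obtain ⟨b', h1, h2⟩ := hdom b hb hba
      exact (hmin' b' h1).trans h2
    · exact hm.2.1.trans hba
  rw [this]; exact hm.1

theorem pathDist_triangle (hwt : ∀ i, 0 < wt i) (hfin : (range wt).Finite) {p q r : P} {a b : ℝ}
    (h : ChainLength arc wt S p q a) (h' : ChainLength arc wt S q r b) :
    pathDist arc wt S p r ≤ pathDist arc wt S p q + pathDist arc wt S q r :=
  pathDist_le hwt ((hA.chain_pathDist hwt hfin h).trans (hA.chain_pathDist hwt hfin h'))

theorem exists_geodesic (hwt : ∀ i, 0 < wt i) (hfin : (range wt).Finite) {p q : P} {a : ℝ}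
    (hp : p ∈ S) (h : ChainLength arc wt S p q a) : ∃ A, IsGeodesicSegment arc wt S p q A := by
  have h1 := hA.chain_pathDist hwt hfin h
  obtain ⟨c, h0, hl, hS, hc⟩ := h1.exists_curve hwt hp
  set l := pathDist arc wt S p q with hldef
  have hl0 : 0 ≤ l := pathDist_nonneg hwt p q
  have key : ∀ s t, 0 ≤ s → s ≤ t → t ≤ l → pathDist arc wt S (c s) (c t) = t - s := by
    intro s t hs hst ht
    refine le_antisymm (pathDist_le hwt (hc s t hs hst ht)) ?_
    have e1 := hc 0 s le_rfl hs (hst.trans ht)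
    have e2 := hc t l (hs.trans hst) ht le_rfl
    rw [h0] at e1
    rw [hl] at e2
    have e3 := hA.chain_pathDist hwt hfin (hc s t hs hst ht)
    have := pathDist_le hwt ((e1.trans e3).trans e2)
    linarith
  refine ⟨_, l, c, hl0, ⟨hS, ?_⟩, h0, hl, rfl⟩
  intro s hs t ht
  rcases le_total s t with hst | hst
  · rw [key s t hs.1 hst ht.2, abs_sub_comm, abs_of_nonneg (by linarith)]
  · rw [pathDist_comm, key t s ht.1 hst hs.2, abs_of_nonneg (by linarith)]

/-- A minimal chain of length zero in normal form has no edges and trivial spurs. Points can thus be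
identified by estimating their distance. -/
theorem eq_of_pathDist_eq_zero (hwt : ∀ i, 0 < wt i) (hfin : (range wt).Finite) {p q : P} {a : ℝ}
    (h : ChainLength arc wt S p q a) (h0 : pathDist arc wt S p q = 0) : p = q := by
  have h1 := hA.chain_pathDist hwt hfin h
  rw [h0] at h1
  have hsp : ∀ {p : P} {x : N} {b : ℝ}, Spur G nd arc wt S p x b → b ≤ 0 → p = nd x := by
    rintro p x b (⟨rfl, rfl⟩ | ⟨e, s, hs, hi, rfl, rfl, rfl⟩) hb
    · rfl
    · have : s = 0 := by
        have := hwt e.1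
        have := hs.1
        by_contra hne
        have : 0 < s := lt_of_le_of_ne hs.1 (Ne.symm hne)
        have : 0 < s * wt e.1 := by positivity
        linarith
      rw [this, hA.oarc_zero]
  rcases hA.normal_form hwt h1 with h | ⟨i, s, hs, t, ht, hi, rfl, rfl, h3⟩ |
    ⟨x, y, b₁, b₂, l, h1, h2, h3, h4, h5⟩
  · exact h
  · have : |s - t| = 0 := by
      have := hwt i
      by_contra hne
      have : 0 < |s - t| := lt_of_le_of_ne (abs_nonneg _) (Ne.symm hne)
      have : 0 < |s - t| * wt i := by positivity
      linarith
    rw [sub_eq_zero.1 (abs_eq_zero.1 this)]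
  · have e1 := ChainLength.nonneg hwt (Spur.chain hA h1)
    have e2 := ChainLength.nonneg hwt (Spur.chain hA h2)
    have e3 := pathLen_nonneg hwt l
    rw [hsp h1 (by linarith), hsp h2 (by linarith)]
    cases l with
    | nil => rw [show x = y from h3]
    | cons e l =>
      have := pathLen_nonneg hwt l
      have := hwt e.1
      simp only [pathLen, List.map_cons, List.sum_cons] at *
      linarith

/-- Close to an interior point of an edge, the metric is that of the edge. -/
theorem local_inner (hwt : ∀ i, 0 < wt i) (hfin : (range wt).Finite) {e : ι × Bool} {s : ℝ}
    (hs : s ∈ Ioo (0 : ℝ) 1) (hi : ∀ u ∈ Icc (0 : ℝ) 1, arc e.1 u ∈ S) {q : P} {a : ℝ}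
    (h : ChainLength arc wt S (oarc arc e s) q a)
    (h1 : pathDist arc wt S (oarc arc e s) q < s * wt e.1)
    (h2 : pathDist arc wt S (oarc arc e s) q < (1 - s) * wt e.1) :
    ∃ t ∈ Ioo (0 : ℝ) 1, q = oarc arc e t ∧ pathDist arc wt S (oarc arc e s) q = |s - t| * wt e.1 := by
  have hc := hA.chain_pathDist hwt hfin h
  have hw := hwt e.1
  rcases hA.normal_form hwt hc with hpq | ⟨i, s', hs', t', ht', hi', hp, hq, h3⟩ |
    ⟨x, y, b₁, b₂, l, h1', h2', h3, h4, h5⟩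
  · exact ⟨s, hs, hpq.symm, by rw [← hpq, pathDist_self hwt]; simp⟩
  · have hq' : ∃ t ∈ Ioo (0 : ℝ) 1, q = oarc arc e t ∧ |s - t| = |s' - t'| ∧ i = e.1 := by
      rcases hA.oarc_eq (e' := (i, true)) hs hs' hp with ⟨rfl, rfl⟩ | ⟨he, rfl⟩
      · exact ⟨t', ht', hq, rfl, rfl⟩
      · have hee : e = (i, false) := by
          have h1 := congrArg Prod.fst he
          have h2 := congrArg Prod.snd he
          simp at h1 h2
          exact Prod.ext h1.symm h2
        subst hee
        refine ⟨1 - t', ⟨by linarith [ht'.2], by linarith [ht'.1]⟩, by simp [oarc, hq], ?_, rfl⟩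
        rw [abs_sub_comm]; congr 1; ring
    obtain ⟨t, ht, rfl, h6, rfl⟩ := hq'
    refine ⟨t, ht, rfl, le_antisymm ?_ (by rwa [h6])⟩
    have hch := ChainLength.single (wt := wt) (Ioo_subset_Icc_self hs') (Ioo_subset_Icc_self ht') hi
    rw [← hp, ← hq] at hch
    rw [h6]
    exact pathDist_le hwt hch
  · exfalso
    have e2 := ChainLength.nonneg hwt (Spur.chain hA h2')
    have e3 := pathLen_nonneg hwt l
    rcases h1' with ⟨h, -⟩ | ⟨e', s', hs', -, h, -, rfl⟩
    · exact hA.oarc_ne hs x h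
    · have hs2 : s' ∈ Ioo (0 : ℝ) 1 := by
        rcases mem_cases hs' with h' | rfl | rfl
        · exact h'
        · rw [hA.oarc_zero] at h; exact absurd h (hA.oarc_ne hs _)
        · rw [hA.oarc_one] at h; exact absurd h (hA.oarc_ne hs _)
      rcases hA.oarc_eq hs hs2 h with ⟨rfl, rfl⟩ | ⟨rfl, rfl⟩
      · linarith
      · simp only at h5; linarith

/-- Close to a vertex, the metric is that of the star of the vertex. -/
theorem local_node (hwt : ∀ i, 0 < wt i) (hfin : (range wt).Finite) {m : ℝ} (hm : ∀ i, m ≤ wt i)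
    {x : N} {q : P} {a : ℝ} (h : ChainLength arc wt S (nd x) q a)
    (h1 : pathDist arc wt S (nd x) q < m) (h0 : nd x ≠ q) :
    ∃ e, ∃ s ∈ Icc (0 : ℝ) 1, G.init e = x ∧ q = oarc arc e s ∧ pathDist arc wt S (nd x) q = s * wt e.1 := by
  have hc := hA.chain_pathDist hwt hfin h
  rcases hA.normal_form hwt hc with hpq | ⟨i, s', hs', t', ht', hi', hp, hq, h3⟩ |
    ⟨x', y, b₁, b₂, l, h1', h2', h3, h4, h5⟩
  · exact absurd hpq h0
  · exact absurd hp.symm (hA.inner_ne _ _ hs' _)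
  · have e1 := ChainLength.nonneg hwt (Spur.chain hA h1')
    have e2 := ChainLength.nonneg hwt (Spur.chain hA h2')
    have e3 := pathLen_nonneg hwt l
    obtain ⟨rfl, hb⟩ : x' = x ∧ b₁ = 0 := by
      rcases h1' with ⟨h, hb⟩ | ⟨e', s', hs', -, h, rfl, rfl⟩
      · exact ⟨(hA.nd_inj h).symm, hb⟩
      · rcases hA.oarc_eq_nd hs' h.symm with ⟨rfl, rfl⟩ | ⟨rfl, -⟩
        · simp
        · have := hm e'.1; linarith
    cases l with
    | cons e l =>
      have := pathLen_nonneg hwt l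
      have := hm e.1
      simp only [pathLen, List.map_cons, List.sum_cons] at *
      linarith
    | nil =>
      obtain rfl : x' = y := h3
      have hle := pathDist_le hwt (Spur.chain hA h2').symm
      rcases h2' with ⟨h, -⟩ | ⟨e, s, hs, -, rfl, rfl, rfl⟩
      · exact absurd h.symm h0
      · refine ⟨e, s, hs, rfl, rfl, le_antisymm hle ?_⟩
        simp only [pathLen, List.map_nil, List.sum_nil] at h5
        linarith

end IsArcSystem

end MetricGraph

/-! ### Geodesics run along whole edges -/

section GeodesicStructure

variable {N ι P : Type*} {G : OrientedGraph N ι} {nd : N → P} {arc : ι → ℝ → P} {wt : ι → ℝ}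
  {S : Set P}

namespace IsArcSystem

variable (hA : IsArcSystem G nd arc)
include hA

/-- A geodesic that starts to run along an edge runs to the end of the edge. -/
theorem geodesic_run (hwt : ∀ i, 0 < wt i) (hfin : (range wt).Finite)
    (hS : ∀ i, ∀ u ∈ Icc (0 : ℝ) 1, arc i u ∈ S)
    (hconn : ∀ p ∈ S, ∀ q ∈ S, ∃ a, ChainLength arc wt S p q a) {γ : ℝ → P} {I : Set ℝ}
    (hγ : IsGeodesicOn arc wt S γ I) {t₀ : ℝ} (hI : Ici t₀ ⊆ I) {e : ι × Bool} {s₀ : ℝ}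
    (hs₀ : 0 ≤ s₀) {ε : ℝ} (hε : 0 < ε) (hε1 : ε ≤ (1 - s₀) * wt e.1)
    (hrun : ∀ u ∈ Icc 0 ε, γ (t₀ + u) = oarc arc e (s₀ + u / wt e.1)) :
    ∀ u ∈ Icc 0 ((1 - s₀) * wt e.1), γ (t₀ + u) = oarc arc e (s₀ + u / wt e.1) := by
  have hw := hwt e.1
  set w := wt e.1 with hwdef
  set L := (1 - s₀) * w with hL
  have hmem : ∀ u, 0 ≤ u → t₀ + u ∈ I := fun u hu => hI (by simp [hu])
  have hdist : ∀ u v, 0 ≤ u → 0 ≤ v → pathDist arc wt S (γ (t₀ + u)) (γ (t₀ + v)) = |u - v| := by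
    intro u v hu hv
    rw [hγ.2 _ (hmem u hu) _ (hmem v hv)]; congr 1; ring
  have hch : ∀ u v, 0 ≤ u → 0 ≤ v → ∃ a, ChainLength arc wt S (γ (t₀ + u)) (γ (t₀ + v)) a :=
    fun u v hu hv => hconn _ (hγ.1 _ (hmem u hu)) _ (hγ.1 _ (hmem v hv))
  have hparam : ∀ u ∈ Icc 0 L, s₀ + u / w ∈ Icc (0 : ℝ) 1 := by
    intro u hu
    have h1 : 0 ≤ u / w := div_nonneg hu.1 hw.le
    have h2 : u / w ≤ 1 - s₀ := by rw [div_le_iff₀ hw]; exact hu.2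
    exact ⟨by linarith, by linarith⟩
  -- Continuity argument: the run along the edge contains its supremum and, before the end of the
  -- edge, extends past it.
  set Z := {u | u ∈ Icc 0 L ∧ ∀ v ∈ Icc 0 u, γ (t₀ + v) = oarc arc e (s₀ + v / w)} with hZ
  have hεZ : ε ∈ Z := ⟨⟨hε.le, hε1⟩, hrun⟩
  have hbd : BddAbove Z := ⟨L, fun u hu => hu.1.2⟩
  set c := sSup Z with hc
  have hεc : ε ≤ c := le_csSup hbd hεZ
  have hcL : c ≤ L := csSup_le ⟨ε, hεZ⟩ fun u hu => hu.1.2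
  have hlt : ∀ v, 0 ≤ v → v < c → γ (t₀ + v) = oarc arc e (s₀ + v / w) := by
    intro v hv hvc
    obtain ⟨u, hu, hvu⟩ := exists_lt_of_lt_csSup ⟨ε, hεZ⟩ hvc
    exact hu.2 v ⟨hv, hvu.le⟩
  have hoS : ∀ s ∈ Icc (0 : ℝ) 1, oarc arc e s ∈ S := by
    intro s hs
    obtain ⟨t, h1, h2, -⟩ := exists_oarc arc e s
    rw [h1]; exact hS _ _ (h2 hs)
  have hochain : ∀ s ∈ Icc (0 : ℝ) 1, ∀ t ∈ Icc (0 : ℝ) 1,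
      ChainLength arc wt S (oarc arc e s) (oarc arc e t) (|s - t| * w) := by
    intro s hs t ht
    rcases e with ⟨i, _ | _⟩
    · have := ChainLength.single (wt := wt) (arc := arc) (S := S) (i := i) (s := 1 - s) (t := 1 - t)
        ⟨by linarith [hs.2], by linarith [hs.1]⟩ ⟨by linarith [ht.2], by linarith [ht.1]⟩ (hS i)
      have e : |1 - s - (1 - t)| = |s - t| := by rw [abs_sub_comm]; congr 1; ring
      rw [e] at this; exact this
    · exact ChainLength.single hs ht (hS i)
  have hcc : γ (t₀ + c) = oarc arc e (s₀ + c / w) := by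
    have hc0 : 0 ≤ c := hε.le.trans hεc
    have hcI := hparam c ⟨hc0, hcL⟩
    obtain ⟨a, ha⟩ := hconn _ (hγ.1 _ (hmem c hc0)) _ (hoS _ hcI)
    refine hA.eq_of_pathDist_eq_zero hwt hfin ha (le_antisymm ?_ (pathDist_nonneg hwt _ _))
    refine le_of_forall_pos_le_add fun η hη => ?_
    set v := max 0 (c - η / 2) with hv
    have hv0 : 0 ≤ v := le_max_left _ _
    have hvc : v < c := max_lt (hε.trans_le hεc) (by linarith)
    have h1 := hlt v hv0 hvc
    have hvI := hparam v ⟨hv0, hvc.le.trans hcL⟩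
    have h2 := hochain _ hvI _ hcI
    rw [← h1] at h2
    obtain ⟨b, hb⟩ := hch c v hc0 hv0
    have h3 := hA.pathDist_triangle hwt hfin hb h2
    have h4 := pathDist_le hwt h2
    rw [hdist c v hc0 hv0, abs_of_nonneg (by linarith)] at h3
    have h5 : |s₀ + v / w - (s₀ + c / w)| * w = c - v := by
      have : s₀ + v / w - (s₀ + c / w) = -((c - v) / w) := by ring
      rw [this, abs_neg, abs_of_nonneg (div_nonneg (by linarith) hw.le)]
      field_simp
    have h6 : c - η / 2 ≤ v := le_max_right _ _
    linarith
  have hall : ∀ v ∈ Icc 0 c, γ (t₀ + v) = oarc arc e (s₀ + v / w) := by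
    intro v hv
    rcases hv.2.lt_or_eq with h | rfl
    · exact hlt v hv.1 h
    · exact hcc
  suffices c = L by rwa [this] at hall
  by_contra hne
  have hcL' : c < L := lt_of_le_of_ne hcL hne
  have hc0 : 0 < c := hε.trans_le hεc
  set s := s₀ + c / w with hs
  have hs0 : 0 < s := by have := div_pos hc0 hw; linarith
  have hsw : (1 - s) * w = L - c := by rw [hs, hL]; field_simp; ring
  have hsw' : c ≤ s * w := by
    have : s * w = s₀ * w + c := by rw [hs]; field_simp
    rw [this]; have := mul_nonneg hs₀ hw.le; linarith
  have hs1 : s < 1 := by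
    by_contra h
    push Not at h
    have : (1 - s) * w ≤ 0 := mul_nonpos_of_nonpos_of_nonneg (by linarith) hw.le
    linarith
  set η := min c (L - c) / 2 with hη
  have hmin : 0 < min c (L - c) := lt_min hc0 (by linarith)
  have hη0 : 0 < η := by positivity
  have hηc : η < c := by have := min_le_left c (L - c); linarith
  have hηL : η < L - c := by have := min_le_right c (L - c); linarith
  have : c + η ∈ Z := by
    refine ⟨⟨by linarith, by linarith⟩, fun v hv => ?_⟩
    rcases le_or_gt v c with h | h
    · exact hall v ⟨hv.1, h⟩
    · obtain ⟨a, ha⟩ := hch c v hc0.le hv.1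
      have hd := hdist c v hc0.le hv.1
      rw [abs_of_nonpos (by linarith), neg_sub] at hd
      rw [hcc] at ha hd
      obtain ⟨t, ht, hqt, hdt⟩ := hA.local_inner hwt hfin ⟨hs0, hs1⟩ (hS e.1) ha
        (by rw [hd]; linarith [hv.2]) (by rw [hd, hsw]; linarith [hv.2])
      rw [hqt]
      rw [hd] at hdt
      rcases le_total t s with hts | hts
      · exfalso
        rw [abs_of_nonneg (by linarith)] at hdt
        have ht2 : t = s₀ + (2 * c - v) / w := by
          have : (s - t) = (v - c) / w := by rw [eq_div_iff hw.ne']; exact hdt.symm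
          have h9 : t = s - (v - c) / w := by linarith
          rw [h9, hs]; ring
        -- Turning back at time c would revisit at time v the point passed at time 2c - v, which a
        -- geodesic cannot do.
        have h7 := hall (2 * c - v) ⟨by linarith [hv.2], by linarith⟩
        rw [← ht2, ← hqt] at h7
        have h8 := hdist (2 * c - v) v (by linarith [hv.2]) hv.1
        rw [h7, pathDist_self hwt] at h8
        have := abs_eq_zero.1 h8.symm
        linarith
      · rw [abs_of_nonpos (by linarith)] at hdt
        have : (t - s) = (v - c) / w := by
          rw [eq_div_iff hw.ne']; linarith
        congr 1
        have h9 : t = s + (v - c) / w := by linarith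
        rw [h9, hs]; ring
  have := le_csSup hbd this
  linarith

/-- A geodesic that passes through a vertex continues along an edge. -/
theorem geodesic_next (hwt : ∀ i, 0 < wt i) (hfin : (range wt).Finite)
    (hS : ∀ i, ∀ u ∈ Icc (0 : ℝ) 1, arc i u ∈ S)
    (hconn : ∀ p ∈ S, ∀ q ∈ S, ∃ a, ChainLength arc wt S p q a) {γ : ℝ → P} {I : Set ℝ}
    (hγ : IsGeodesicOn arc wt S γ I) {t₀ : ℝ} (hI : Ici t₀ ⊆ I) {x : N} (hx : γ t₀ = nd x) :
    ∃ e, G.init e = x ∧ ∀ u ∈ Icc 0 (wt e.1), γ (t₀ + u) = oarc arc e (u / wt e.1) := by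
  obtain ⟨m, hm, hmw⟩ := exists_min_wt hwt hfin
  have hmem : ∀ u, 0 ≤ u → t₀ + u ∈ I := fun u hu => hI (by simp [hu])
  have hdist : ∀ u v, 0 ≤ u → 0 ≤ v → pathDist arc wt S (γ (t₀ + u)) (γ (t₀ + v)) = |u - v| := by
    intro u v hu hv
    rw [hγ.2 _ (hmem u hu) _ (hmem v hv)]; congr 1; ring
  have hch : ∀ u v, 0 ≤ u → 0 ≤ v → ∃ a, ChainLength arc wt S (γ (t₀ + u)) (γ (t₀ + v)) a :=
    fun u v hu hv => hconn _ (hγ.1 _ (hmem u hu)) _ (hγ.1 _ (hmem v hv))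
  have near : ∀ u, 0 < u → u < m → ∃ e, G.init e = x ∧ γ (t₀ + u) = oarc arc e (u / wt e.1) := by
    intro u hu hum
    obtain ⟨a, ha⟩ := hch 0 u le_rfl hu.le
    have hd := hdist 0 u le_rfl hu.le
    rw [zero_sub, abs_neg, abs_of_pos hu] at hd
    rw [add_zero, hx] at ha hd
    have hne : nd x ≠ γ (t₀ + u) := by
      intro h
      rw [← h, pathDist_self hwt] at hd
      linarith
    obtain ⟨e, s, hs, h1, h2, h3⟩ := hA.local_node hwt hfin hmw ha (by rw [hd]; exact hum) hne
    refine ⟨e, h1, ?_⟩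
    have hw := hwt e.1
    rw [h2]; congr 1
    rw [eq_div_iff hw.ne', ← h3, hd]
  -- Less than half of the shortest edge, so that 2ε < m below rules out reaching the point from the
  -- other end of a loop.
  set ε := m / 3 with hε
  have hε0 : 0 < ε := by positivity
  obtain ⟨e, h1, h2⟩ := near ε hε0 (by linarith)
  have hw := hwt e.1
  have hmw1 := hmw e.1
  refine ⟨e, h1, ?_⟩
  have hsI : ε / wt e.1 ∈ Ioo (0 : ℝ) 1 := ⟨by positivity, by rw [div_lt_one hw]; linarith⟩
  have hrun : ∀ u ∈ Icc 0 ε, γ (t₀ + u) = oarc arc e (0 + u / wt e.1) := by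
    intro u hu
    rw [zero_add]
    rcases hu.1.eq_or_lt with rfl | hu0
    · rw [zero_div, hA.oarc_zero, h1, add_zero, hx]
    · obtain ⟨e', h1', h2'⟩ := near u hu0 (by linarith [hu.2])
      have hw' := hwt e'.1
      have hmw' := hmw e'.1
      have huI : u / wt e'.1 ∈ Ioo (0 : ℝ) 1 := ⟨by positivity, by rw [div_lt_one hw']; linarith [hu.2]⟩
      obtain ⟨a, ha⟩ := hch ε u hε0.le hu.1
      have hd := hdist ε u hε0.le hu.1
      rw [abs_of_nonneg (by linarith [hu.2])] at hd
      rw [h2] at ha hd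
      have e1 : ε / wt e.1 * wt e.1 = ε := by field_simp
      obtain ⟨t, ht, hqt, hdt⟩ := hA.local_inner hwt hfin hsI (hS e.1) ha
        (by rw [hd, e1]; linarith) (by rw [hd, sub_mul, e1]; linarith)
      rw [hd] at hdt
      rw [hqt]
      congr 1
      rcases le_total t (ε / wt e.1) with h | h
      · rw [abs_of_nonneg (by linarith), sub_mul, e1] at hdt
        rw [eq_div_iff hw.ne']; linarith
      · rw [abs_of_nonpos (by linarith), neg_sub, sub_mul, e1] at hdt
        have ht2 : t * wt e.1 = 2 * ε - u := by linarith
        rw [h2'] at hqt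
        -- Here the point would lie at distance 2ε - u from `x` along `e`. It is also at distance u
        -- from `x` along `e'`; if `e'` is the reverse of `e`, then the edge has length 2ε < m.
        rcases hA.oarc_eq huI ht hqt with ⟨rfl, rfl⟩ | ⟨rfl, h5⟩
        · rfl
        · exfalso
          have : t * wt e'.1 = wt e'.1 - u := by rw [h5, sub_mul]; field_simp
          simp only at ht2 hmw1
          linarith
  have := hA.geodesic_run hwt hfin hS hconn hγ hI le_rfl hε0 (by linarith) hrun
  simpa using this

/-- A geodesic that starts in the interior of an edge runs to one of the ends of the edge. -/
theorem geodesic_start (hwt : ∀ i, 0 < wt i) (hfin : (range wt).Finite)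
    (hS : ∀ i, ∀ u ∈ Icc (0 : ℝ) 1, arc i u ∈ S)
    (hconn : ∀ p ∈ S, ∀ q ∈ S, ∃ a, ChainLength arc wt S p q a) {γ : ℝ → P} {I : Set ℝ}
    (hγ : IsGeodesicOn arc wt S γ I) {t₀ : ℝ} (hI : Ici t₀ ⊆ I) {i : ι} {r : ℝ}
    (hr : r ∈ Ioo (0 : ℝ) 1) (hx : γ t₀ = arc i r) :
    ∃ e, ∃ s₀ ∈ Ioo (0 : ℝ) 1, ∀ u ∈ Icc 0 ((1 - s₀) * wt e.1),
      γ (t₀ + u) = oarc arc e (s₀ + u / wt e.1) := by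
  have hmem : ∀ u, 0 ≤ u → t₀ + u ∈ I := fun u hu => hI (by simp [hu])
  have hdist : ∀ u v, 0 ≤ u → 0 ≤ v → pathDist arc wt S (γ (t₀ + u)) (γ (t₀ + v)) = |u - v| := by
    intro u v hu hv
    rw [hγ.2 _ (hmem u hu) _ (hmem v hv)]; congr 1; ring
  have hch : ∀ u v, 0 ≤ u → 0 ≤ v → ∃ a, ChainLength arc wt S (γ (t₀ + u)) (γ (t₀ + v)) a :=
    fun u v hu hv => hconn _ (hγ.1 _ (hmem u hu)) _ (hγ.1 _ (hmem v hv))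
  have hw := hwt i
  set w := wt i with hwdef
  -- Up to time ε the geodesic stays away from both ends of the edge, so the local description of
  -- the metric applies from both times 0 and ε and fixes the direction.
  set ε := min (r * w) ((1 - r) * w) / 2 with hε
  have hmin : 0 < min (r * w) ((1 - r) * w) :=
    lt_min (mul_pos hr.1 hw) (mul_pos (by linarith [hr.2]) hw)
  have hε0 : 0 < ε := by positivity
  have hε1 : 2 * ε ≤ r * w := by have := min_le_left (r * w) ((1 - r) * w); linarith
  have hε2 : 2 * ε ≤ (1 - r) * w := by have := min_le_right (r * w) ((1 - r) * w); linarith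
  obtain ⟨e, s₀, he, hs₀, hx', hxε, h1, h2⟩ : ∃ (e : ι × Bool) (s₀ : ℝ), e.1 = i ∧ s₀ ∈ Ioo (0 : ℝ) 1 ∧
      γ t₀ = oarc arc e s₀ ∧ γ (t₀ + ε) = oarc arc e (s₀ + ε / w) ∧ 2 * ε ≤ s₀ * w ∧
      2 * ε ≤ (1 - s₀) * w := by
    obtain ⟨a, ha⟩ := hch 0 ε le_rfl hε0.le
    have hd := hdist 0 ε le_rfl hε0.le
    rw [zero_sub, abs_neg, abs_of_pos hε0] at hd
    rw [add_zero, hx] at ha hd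
    obtain ⟨t, ht, hqt, hdt⟩ := hA.local_inner (e := (i, true)) hwt hfin hr (hS i) ha
      (by change pathDist arc wt S (arc i r) _ < _; rw [hd]; linarith)
      (by change pathDist arc wt S (arc i r) _ < _; rw [hd]; linarith)
    change pathDist arc wt S (arc i r) _ = _ at hdt
    rw [hd] at hdt
    rcases le_total t r with h | h
    · rw [abs_of_nonneg (by linarith)] at hdt
      refine ⟨(i, false), 1 - r, rfl, ⟨by linarith [hr.2], by linarith [hr.1]⟩, by simp [oarc, hx], ?_,
        by linarith, by linarith⟩
      rw [hqt]
      simp only [oarc, cond_true, cond_false]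
      congr 1
      have : r - t = ε / w := by rw [eq_div_iff hw.ne']; exact hdt.symm
      linarith
    · rw [abs_of_nonpos (by linarith)] at hdt
      refine ⟨(i, true), r, rfl, hr, hx, ?_, by linarith, by linarith⟩
      rw [hqt]
      congr 1
      have : t - r = ε / w := by rw [eq_div_iff hw.ne']; simp only at hdt; linarith
      linarith
  subst he
  refine ⟨e, s₀, hs₀, ?_⟩
  have hεw : ε / w * w = ε := by field_simp
  refine hA.geodesic_run hwt hfin hS hconn hγ hI hs₀.1.le hε0 (by linarith) ?_
  intro u hu
  rcases hu.1.eq_or_lt with rfl | hu0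
  · simp [hx']
  have hs1 : s₀ + ε / w ∈ Ioo (0 : ℝ) 1 := by
    have : 0 < ε / w := by positivity
    refine ⟨by linarith [hs₀.1], ?_⟩
    have : ε / w < 1 - s₀ := by rw [div_lt_iff₀ hw]; linarith
    linarith
  obtain ⟨a, ha⟩ := hch 0 u le_rfl hu.1
  have hd := hdist 0 u le_rfl hu.1
  rw [zero_sub, abs_neg, abs_of_pos hu0] at hd
  rw [add_zero, hx'] at ha hd
  obtain ⟨t, ht, hqt, hdt⟩ := hA.local_inner hwt hfin hs₀ (hS e.1) ha
    (by rw [hd]; linarith [hu.2]) (by rw [hd]; linarith [hu.2])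
  obtain ⟨b, hb⟩ := hch ε u hε0.le hu.1
  have hd' := hdist ε u hε0.le hu.1
  rw [abs_of_nonneg (by linarith [hu.2])] at hd'
  rw [hxε] at hb hd'
  obtain ⟨t', ht', hqt', hdt'⟩ := hA.local_inner hwt hfin hs1 (hS e.1) hb
    (by rw [hd', add_mul, hεw]; linarith [hu.2])
    (by
      have : (1 - (s₀ + ε / w)) * wt e.1 = (1 - s₀) * w - ε / w * w := by rw [hwdef]; ring
      rw [hd', this, hεw]; linarith [hu.2])
  have htt : t = t' := hA.oarc_inj ht ht' (hqt ▸ hqt')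
  subst htt
  rw [hqt]
  congr 1
  rw [hd] at hdt
  rw [hd'] at hdt'
  have e2 : (s₀ + ε / w - t) * w = s₀ * w + ε - t * w := by rw [sub_mul, add_mul, hεw]
  have goal : t * w = s₀ * w + u := by
    rcases le_total t s₀ with h | h
    · rw [abs_of_nonneg (by linarith)] at hdt
      have h9 : 0 < ε / w := by positivity
      rw [abs_of_nonneg (by linarith), e2] at hdt'
      have : (s₀ - t) * wt e.1 = s₀ * w - t * w := by rw [hwdef]; ring
      linarith
    · rw [abs_of_nonpos (by linarith)] at hdt
      have : -(s₀ - t) * wt e.1 = t * w - s₀ * w := by rw [hwdef]; ring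
      linarith
  have : (t - s₀) = u / wt e.1 := by rw [eq_div_iff hw.ne']; rw [sub_mul]; linarith
  linarith

end IsArcSystem

end GeodesicStructure

namespace GraphMap

variable {V E : Type*} {Γ : OrientedGraph V E} {φ : GraphMap Γ} {v : V}

/-! ### The graph structure of the preimage of `V` in the universal cover -/

/-- An edge path of `V`, as a vertical edge path of `X`. -/
def vert (l : List (E × Bool)) : List ((E ⊕ V) × Bool) := l.map fun b => (Sum.inl b.1, b.2)

theorem step_step_true (e : E) (x : φ.Over v (Γ.src e)) :
    (Over.step (φ := φ) (v := v) (Sum.inl e, false) (Over.step (φ := φ) (v := v) (Sum.inl e, true) x)) = x := by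
  induction x using Quot.ind with
  | mk p =>
    apply Eq.symm
    apply Quot.sound
    have := ElementaryHomotopy.backtrack (φ := φ) p.1 [] (Sum.inl e, true)
    simpa using this

theorem step_step_false (e : E) (x : φ.Over v (Γ.tgt e)) :
    (Over.step (φ := φ) (v := v) (Sum.inl e, true) (Over.step (φ := φ) (v := v) (Sum.inl e, false) x)) = x := by
  induction x using Quot.ind with
  | mk p =>
    apply Eq.symm
    apply Quot.sound
    have := ElementaryHomotopy.backtrack (φ := φ) p.1 [] (Sum.inl e, false)
    simpa using this

theorem step_step_horiz (w : V) (x : φ.Over v (φ.onVert w)) :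
    (Over.step (φ := φ) (v := v) (Sum.inr w, true) (Over.step (φ := φ) (v := v) (Sum.inr w, false) x)) = x := by
  induction x using Quot.ind with
  | mk p =>
    apply Eq.symm
    apply Quot.sound
    have := ElementaryHomotopy.backtrack (φ := φ) p.1 [] (Sum.inr w, false)
    simpa using this

variable (φ v) in
/-- The graph `Ṽ`. -/
def coverGraph : OrientedGraph (φ.Node v) (φ.VEdge v) := ⟨VEdge.tail, VEdge.head⟩

/-- The lift of an oriented edge of `V`. -/
def liftEdge : (a : E × Bool) → φ.Over v (Γ.init a) → φ.VEdge v × Bool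
  | (e, true), x => (⟨e, x⟩, true)
  | (e, false), x => (⟨e, Over.step (φ := φ) (v := v) (Sum.inl e, false) x⟩, false)

theorem init_liftEdge (a : E × Bool) (x : φ.Over v (Γ.init a)) :
    (φ.coverGraph v).init (liftEdge a x) = ⟨Γ.init a, x⟩ := by
  rcases a with ⟨e, _ | _⟩
  · exact congrArg (Sigma.mk (Γ.tgt e)) (step_step_false e x)
  · rfl

theorem term_liftEdge (a : E × Bool) (x : φ.Over v (Γ.init a)) :
    (φ.coverGraph v).term (liftEdge a x) = ⟨Γ.term a, Over.stepV (φ := φ) (v := v) a x⟩ := by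
  rcases a with ⟨e, _ | _⟩ <;> rfl

theorem along_eq (a : E × Bool) (x : φ.Over v (Γ.init a)) (s : ℝ) :
    Over.along (φ := φ) (v := v) a x s = oarc VEdge.point (liftEdge a x) s := by
  rcases a with ⟨e, _ | _⟩ <;> rfl

/-- The lift of a parametrized edge path of `V`. -/
def liftList {w' : V} : {w : V} → (x : φ.Over v w) → (l : List ((E × Bool) × ℝ)) →
    Γ.IsPath w (l.map Prod.fst) w' → List ((φ.VEdge v × Bool) × ℝ)
  | _, _, [], _ => []
  | w, x, a :: l, h =>
      let x' : φ.Over v (Γ.init a.1) := (show w = Γ.init a.1 from h.1.symm) ▸ x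
      (liftEdge a.1 x', a.2) :: liftList (Over.stepV (φ := φ) (v := v) a.1 x') l h.2

/-- The terminal point of the lift of an edge path of `V`. -/
def liftEnd {w' : V} : {w : V} → (x : φ.Over v w) → (l : List ((E × Bool) × ℝ)) →
    Γ.IsPath w (l.map Prod.fst) w' → φ.Over v w'
  | w, x, [], h => (show w = w' from h) ▸ x
  | w, x, a :: l, h =>
      let x' : φ.Over v (Γ.init a.1) := (show w = Γ.init a.1 from h.1.symm) ▸ x
      liftEnd (Over.stepV (φ := φ) (v := v) a.1 x') l h.2

theorem isPath_liftList {w' : V} (l : List ((E × Bool) × ℝ)) : ∀ {w : V} (x : φ.Over v w)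
    (h : Γ.IsPath w (l.map Prod.fst) w'),
    (φ.coverGraph v).IsPath ⟨w, x⟩ ((liftList x l h).map Prod.fst) ⟨w', liftEnd x l h⟩ := by
  induction l with
  | nil => intro w x h; cases h; rfl
  | cons a l ih =>
    intro w x h
    obtain rfl : Γ.init a.1 = w := h.1
    refine ⟨init_liftEdge a.1 x, ?_⟩
    have := ih (Over.stepV (φ := φ) (v := v) a.1 x) h.2
    rw [← term_liftEdge] at this
    exact this

theorem map_snd_liftList {w' : V} (l : List ((E × Bool) × ℝ)) : ∀ {w : V} (x : φ.Over v w)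
    (h : Γ.IsPath w (l.map Prod.fst) w'), (liftList x l h).map Prod.snd = l.map Prod.snd := by
  induction l with
  | nil => intro w x h; rfl
  | cons a l ih =>
    intro w x h
    obtain rfl : Γ.init a.1 = w := h.1
    exact congrArg (a.2 :: ·) (ih (Over.stepV (φ := φ) (v := v) a.1 x) h.2)

/-- The projection from edges of `Ṽ` to edges of `V`. -/
def proj (a : φ.VEdge v × Bool) : E × Bool := (a.1.1, a.2)

theorem proj_liftEdge (a : E × Bool) (x : φ.Over v (Γ.init a)) : proj (liftEdge a x) = a := by
  rcases a with ⟨e, _ | _⟩ <;> rfl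

theorem map_proj_liftList {w' : V} (l : List ((E × Bool) × ℝ)) : ∀ {w : V} (x : φ.Over v w)
    (h : Γ.IsPath w (l.map Prod.fst) w'),
    ((liftList x l h).map Prod.fst).map proj = l.map Prod.fst := by
  induction l with
  | nil => intro w x h; rfl
  | cons a l ih =>
    intro w x h
    obtain rfl : Γ.init a.1 = w := h.1
    have := ih (Over.stepV (φ := φ) (v := v) a.1 x) h.2
    exact congrArg₂ List.cons (proj_liftEdge a.1 x) this

theorem stepV_mk (a : E × Bool) (p : φ.PathsTo v (Γ.init a)) (h) :
    Over.stepV (φ := φ) (v := v) a (Quot.mk _ p) = Quot.mk _ ⟨p.1 ++ vert [a], h⟩ := by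
  rcases a with ⟨e, _ | _⟩ <;> rfl

theorem isPath_vert {l : List (E × Bool)} : ∀ {w w' : V}, Γ.IsPath w l w' →
    φ.torusGraph.IsPath w (vert l) w' := by
  induction l with
  | nil => intro w w' h; exact h
  | cons a l ih =>
    intro w w' h
    rcases a with ⟨e, _ | _⟩ <;> exact ⟨h.1, ih h.2⟩

theorem liftEnd_mk {w' : V} (l : List ((E × Bool) × ℝ)) : ∀ {w : V} (p : φ.PathsTo v w)
    (h : Γ.IsPath w (l.map Prod.fst) w'), liftEnd (φ := φ) (v := v) (Quot.mk _ p) l h =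
      Quot.mk _ ⟨p.1 ++ vert (l.map Prod.fst), OrientedGraph.IsPath.append _ p.2 (isPath_vert h)⟩ := by
  induction l with
  | nil =>
    intro w p h
    obtain rfl : w = w' := h
    refine congrArg (Quot.mk _) (Subtype.ext ?_)
    simp [vert]
  | cons a l ih =>
    intro w p h
    obtain rfl : Γ.init a.1 = w := h.1
    have hp : φ.torusGraph.IsPath v (p.1 ++ vert [a.1]) (Γ.term a.1) :=
      OrientedGraph.IsPath.append _ p.2 (isPath_vert (Γ := Γ) ⟨rfl, rfl⟩)
    have h1 : liftEnd (φ := φ) (v := v) (Quot.mk _ p) (a :: l) h =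
      liftEnd (Over.stepV (φ := φ) (v := v) a.1 (Quot.mk _ p)) l h.2 := rfl
    rw [h1, stepV_mk _ _ hp, ih ⟨_, hp⟩ h.2]
    refine congrArg (Quot.mk _) (Subtype.ext ?_)
    simp [vert]

/-- This is the 2-cell relation: pushing across `R_e` shows that the lift of `φ(e)` starting at the
forward image of the tail ends at the forward image of the head, so that the flow is a graph map. -/
theorem liftEnd_onEdge (c : φ.VEdge v) :
    (⟨φ.onVert (Γ.tgt c.1), liftEnd c.tail.next.2 (φ.onEdge c.1) (φ.isPath c.1)⟩ : φ.Node v) =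
      c.head.next := by
  obtain ⟨e, x⟩ := c
  induction x using Quot.ind with
  | mk p =>
    refine congrArg (Sigma.mk _) ?_
    have hp : φ.torusGraph.IsPath v (p.1 ++ [(Sum.inr (Γ.src e), true)]) (φ.onVert (Γ.src e)) :=
      OrientedGraph.IsPath.append _ p.2 ⟨rfl, rfl⟩
    refine (liftEnd_mk (φ.onEdge e) ⟨_, hp⟩ (φ.isPath e)).trans ?_
    apply Eq.symm
    apply Quot.sound
    have := ElementaryHomotopy.cell (φ := φ) p.1 [] e
    rw [List.append_nil, List.append_nil] at this
    change φ.ElementaryHomotopy ((p.1 ++ [(Sum.inl e, true)]) ++ [(Sum.inr (Γ.tgt e), true)])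
      ((p.1 ++ [(Sum.inr (Γ.src e), true)]) ++ vert (φ.edgePath e))
    rw [List.append_assoc, List.append_assoc]
    exact this

variable (φ v) in
/-- The lift of `φ` to the graph `Ṽ`. -/
def coverMap : GraphMap (φ.coverGraph v) where
  onVert := Node.next
  onEdge c := liftList c.tail.next.2 (φ.onEdge c.1) (φ.isPath c.1)
  isPath c := by
    have := isPath_liftList (φ.onEdge c.1) c.tail.next.2 (φ.isPath c.1)
    rw [liftEnd_onEdge] at this
    exact this
  pos c a ha := by
    have h1 : a.2 ∈ (φ.onEdge c.1).map Prod.snd := by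
      rw [← map_snd_liftList (φ.onEdge c.1) c.tail.next.2 (φ.isPath c.1)]
      exact List.mem_map_of_mem ha
    obtain ⟨b, hb, h⟩ := List.mem_map.1 h1
    rw [← h]; exact φ.pos c.1 b hb
  sum_eq c := (congrArg List.sum (map_snd_liftList (φ.onEdge c.1) c.tail.next.2 (φ.isPath c.1))).trans
    (φ.sum_eq c.1)

theorem map_proj_edgePath (c : φ.VEdge v) :
    ((φ.coverMap v).edgePath c).map proj = φ.edgePath c.1 :=
  map_proj_liftList (φ.onEdge c.1) c.tail.next.2 (φ.isPath c.1)

theorem map_proj_invRev (p : List (φ.VEdge v × Bool)) :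
    (FreeGroup.invRev p).map proj = FreeGroup.invRev (p.map proj) := by
  simp [FreeGroup.invRev, proj, Function.comp_def]

theorem map_proj_mapPath (p : List (φ.VEdge v × Bool)) :
    ((φ.coverMap v).mapPath p).map proj = φ.mapPath (p.map proj) := by
  induction p with
  | nil => rfl
  | cons a p ih =>
    rw [mapPath_cons, List.map_append, ih, List.map_cons, mapPath_cons]
    congr 1
    rcases a with ⟨c, _ | _⟩
    · rw [orientedImage_false, map_proj_invRev, map_proj_edgePath]
      exact (orientedImage_false φ c.1).symm
    · exact map_proj_edgePath c

theorem map_proj_iterate (n : ℕ) : ∀ p : List (φ.VEdge v × Bool),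
    ((φ.coverMap v).mapPath^[n] p).map proj = φ.mapPath^[n] (p.map proj) := by
  induction n with
  | zero => intro p; rfl
  | succ n ih => intro p; simp only [Function.iterate_succ, Function.comp]; rw [ih, map_proj_mapPath]

theorem isPath_map_proj {p : List (φ.VEdge v × Bool)} : ∀ {x y : φ.Node v},
    (φ.coverGraph v).IsPath x p y → Γ.IsPath x.1 (p.map proj) y.1 := by
  induction p with
  | nil => intro x y h; exact congrArg Sigma.fst h
  | cons a p ih =>
    intro x y h
    refine ⟨?_, ?_⟩
    · rw [← h.1]; rcases a with ⟨c, _ | _⟩ <;> rfl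
    · have := ih h.2
      rcases a with ⟨c, _ | _⟩ <;> exact this

/-- The projection is a covering: oriented edges are determined by their initial vertex and image. -/
theorem eq_of_proj {a b : φ.VEdge v × Bool} (h : (φ.coverGraph v).init a = (φ.coverGraph v).init b)
    (hp : proj a = proj b) : a = b := by
  obtain ⟨⟨e, x⟩, s⟩ := a
  obtain ⟨⟨e', x'⟩, s'⟩ := b
  obtain ⟨rfl, rfl⟩ : e = e' ∧ s = s' := by simpa [proj] using hp
  cases s
  · have h1 : Over.step (φ := φ) (v := v) (Sum.inl e, true) x =
        Over.step (φ := φ) (v := v) (Sum.inl e, true) x' := eq_of_heq (Sigma.mk.inj h).2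
    have := congrArg (Over.step (φ := φ) (v := v) (Sum.inl e, false)) h1
    rw [step_step_true, step_step_true] at this
    rw [this]
  · have h1 : x = x' := eq_of_heq (Sigma.mk.inj h).2
    rw [h1]

theorem eq_of_map_proj {p : List (φ.VEdge v × Bool)} : ∀ {q : List (φ.VEdge v × Bool)}
    {x y z : φ.Node v}, (φ.coverGraph v).IsPath x p y → (φ.coverGraph v).IsPath x q z →
    p.map proj = q.map proj → p = q := by
  induction p with
  | nil => intro q x y z _ _ h; simpa using h.symm
  | cons a p ih =>
    intro q x y z hp hq h
    cases q with
    | nil => simp at h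
    | cons b q =>
      simp only [List.map_cons, List.cons.injEq] at h
      obtain rfl := eq_of_proj (hp.1.trans hq.1.symm) h.1
      rw [ih hp.2 hq.2 h.2]

theorem exists_lift {l : List (E × Bool)} : ∀ {w w' : V}, Γ.IsPath w l w' → ∀ x : φ.Over v w,
    ∃ (p : List (φ.VEdge v × Bool)) (y : φ.Over v w'), (φ.coverGraph v).IsPath ⟨w, x⟩ p ⟨w', y⟩ ∧
      p.map proj = l := by
  induction l with
  | nil => rintro w w' rfl x; exact ⟨[], x, rfl, rfl⟩
  | cons a l ih =>
    intro w w' h x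
    obtain rfl : Γ.init a = w := h.1
    obtain ⟨p, y, h1, h2⟩ := ih h.2 (Over.stepV (φ := φ) (v := v) a x)
    refine ⟨liftEdge a x :: p, y, ⟨init_liftEdge a x, by rw [term_liftEdge]; exact h1⟩, ?_⟩
    rw [List.map_cons, proj_liftEdge, h2]

theorem isReduced_of_map_proj {p : List (φ.VEdge v × Bool)}
    (h : FreeGroup.IsReduced (p.map proj)) : FreeGroup.IsReduced p := by
  unfold FreeGroup.IsReduced at *
  rw [List.isChain_map] at h
  exact h.imp fun a b hab hh => hab (congrArg Sigma.fst hh)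

theorem isReduced_map_proj {p : List (φ.VEdge v × Bool)} : ∀ {x y : φ.Node v},
    (φ.coverGraph v).IsPath x p y → FreeGroup.IsReduced p → FreeGroup.IsReduced (p.map proj) := by
  induction p with
  | nil => intro x y _ _; exact FreeGroup.IsReduced.nil
  | cons a p ih =>
    intro x y hp hr
    cases p with
    | nil => exact FreeGroup.IsReduced.singleton
    | cons b p =>
      simp only [List.map_cons]
      rw [FreeGroup.isReduced_cons_cons] at hr ⊢
      refine ⟨fun h => ?_, ih hp.2 hr.2⟩
      by_contra hne
      have h1 : b = (a.1, !a.2) := by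
        apply eq_of_proj
        · rw [init_not]; exact hp.2.1
        · ext
          · exact h.symm
          · have hne' : ¬ a.2 = b.2 := hne
            change b.2 = !a.2
            revert hne'; cases a.2 <;> cases b.2 <;> simp
      rw [h1] at hr
      have := hr.1 rfl
      simp at this

theorem mk_map_proj (p : List (φ.VEdge v × Bool)) :
    FreeGroup.mk (p.map proj) = FreeGroup.map (fun c : φ.VEdge v => c.1) (FreeGroup.mk p) :=
  FreeGroup.map.mk.symm

theorem map_proj_red {p : List (φ.VEdge v × Bool)} {x y : φ.Node v}
    (h : (φ.coverGraph v).IsPath x p y) : (red p).map proj = red (p.map proj) := by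
  symm
  apply red_eq_of (isReduced_map_proj h.red (isReduced_red p))
  rw [mk_map_proj, mk_map_proj, mk_red]

/-! ### Pushing paths forward -/

/-- The height gained along a path of `X`. -/
def gain : List ((E ⊕ V) × Bool) → ℤ
  | [] => 0
  | (Sum.inl _, _) :: p => gain p
  | (Sum.inr _, true) :: p => 1 + gain p
  | (Sum.inr _, false) :: p => -1 + gain p

theorem gain_append (p q : List ((E ⊕ V) × Bool)) : gain (p ++ q) = gain p + gain q := by
  induction p with
  | nil => simp [gain]
  | cons a p ih =>
    rcases a with ⟨_ | _, _ | _⟩ <;> simp [gain, ih, add_assoc]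

theorem gain_vert (l : List (E × Bool)) : gain (vert l : List ((E ⊕ V) × Bool)) = 0 := by
  induction l with
  | nil => rfl
  | cons a l ih => exact ih

theorem gain_homotopy {p q : List ((E ⊕ V) × Bool)} (h : φ.ElementaryHomotopy p q) :
    gain p = gain q := by
  cases h with
  | backtrack p q a =>
    rcases a with ⟨_ | _, _ | _⟩ <;> simp [gain, gain_append]
  | cell p q e =>
    have := gain_vert (V := V) (φ.edgePath e)
    unfold vert at this
    simp [gain, gain_append, this]

variable (φ) in
/-- Push the vertical edges of a path of `X` that starts at height `k` forward to height `n`. -/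
def push (n : ℤ) : ℤ → List ((E ⊕ V) × Bool) → FreeGroup E
  | _, [] => 1
  | k, (Sum.inl e, b) :: p => φ.hom^[(n - k).toNat] (FreeGroup.mk [(e, b)]) * push n k p
  | k, (Sum.inr _, true) :: p => push n (k + 1) p
  | k, (Sum.inr _, false) :: p => push n (k + -1) p

theorem push_append (n : ℤ) (p q : List ((E ⊕ V) × Bool)) : ∀ k,
    φ.push n k (p ++ q) = φ.push n k p * φ.push n (k + gain p) q := by
  induction p with
  | nil => intro k; simp [push, gain]
  | cons a p ih =>
    intro k
    rcases a with ⟨_ | _, _ | _⟩ <;> simp [push, gain, ih, mul_assoc, add_assoc]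

theorem push_vert (n k : ℤ) (l : List (E × Bool)) :
    φ.push n k (vert l) = φ.hom^[(n - k).toNat] (FreeGroup.mk l) := by
  induction l with
  | nil => exact (iterate_map_one φ.hom _).symm
  | cons a l ih =>
    have h1 : FreeGroup.mk (a :: l) = FreeGroup.mk [a] * FreeGroup.mk l := mk_append [a] l
    have h2 : φ.push n k (vert (a :: l)) =
      φ.hom^[(n - k).toNat] (FreeGroup.mk [a]) * φ.push n k (vert l) := rfl
    rw [h1, iterate_map_mul, h2, ih]

/-- Across a 2-cell at height h, one side contributes the (n - h)-th image of `e` and the other the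
(n - h - 1)-th image of `φ(e)`. They agree once n ≥ h + 1; for smaller n the truncated exponents
would spoil this, whence the threshold. -/
theorem push_homotopy {p q : List ((E ⊕ V) × Bool)} (h : φ.ElementaryHomotopy p q) :
    ∃ n₀ : ℤ, ∀ n ≥ n₀, φ.push n 0 p = φ.push n 0 q := by
  cases h with
  | backtrack p q a =>
    refine ⟨0, fun n _ => ?_⟩
    simp only [push_append, gain_append]
    rcases a with ⟨e | w, _ | _⟩
    · simp only [push, gain, mul_one, Bool.not_false, add_zero, ← iterate_map_mul]
      have : FreeGroup.mk [(e, false)] * FreeGroup.mk [(e, true)] = 1 := by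
        rw [← inv_mul_cancel (FreeGroup.mk [(e, true)]), ← mk_invRev]; rfl
      rw [this, iterate_map_one, mul_one]
    · simp only [push, gain, mul_one, Bool.not_true, add_zero, ← iterate_map_mul]
      have : FreeGroup.mk [(e, true)] * FreeGroup.mk [(e, false)] = 1 := by
        rw [← mul_inv_cancel (FreeGroup.mk [(e, true)]), ← mk_invRev]; rfl
      rw [this, iterate_map_one, mul_one]
    · simp [push, gain]
    · simp [push, gain]
  | cell p q e =>
    refine ⟨gain p + 1, fun n hn => ?_⟩
    have h1 : ((Sum.inr (Γ.src e), true) ::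
        (φ.edgePath e).map fun b => ((Sum.inl b.1 : E ⊕ V), b.2)) =
        [(Sum.inr (Γ.src e), true)] ++ vert (φ.edgePath e) := rfl
    rw [h1]
    simp only [push_append, gain_append, push_vert, gain_vert]
    simp only [push, gain, mul_one, one_mul, add_zero, zero_add]
    congr 2
    obtain ⟨m, hm⟩ : ∃ m : ℕ, n - (gain p + 1) = m := ⟨(n - (gain p + 1)).toNat, by omega⟩
    have e1 : (n - (gain p + 1)).toNat = m := by omega
    have e2 : (n - gain p).toNat = m + 1 := by omega
    rw [e1, e2, Function.iterate_succ_apply]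
    congr 1
    rw [hom_mk, mapPath_singleton, orientedImage_true]

theorem push_eq {w : V} {p q : φ.PathsTo v w} (h : (Quot.mk _ p : φ.Over v w) = Quot.mk _ q) :
    ∃ n₀ : ℤ, ∀ n ≥ n₀, φ.push n 0 p.1 = φ.push n 0 q.1 := by
  have h' := Quot.eqvGen_exact h
  clear h
  induction h' with
  | rel p q h => exact push_homotopy h
  | refl p => exact ⟨0, fun _ _ => rfl⟩
  | symm p q _ ih =>
    obtain ⟨n₀, hn⟩ := ih
    exact ⟨n₀, fun n h => (hn n h).symm⟩
  | trans p q r _ _ ih1 ih2 =>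
    obtain ⟨n₁, h1⟩ := ih1
    obtain ⟨n₂, h2⟩ := ih2
    exact ⟨max n₁ n₂, fun n h => (h1 n (le_of_max_le_left h)).trans (h2 n (le_of_max_le_right h))⟩

/-- Conjugating by a path from the base vertex reduces to loops at `v`. Their images are again loops
at `v`, so injectivity can be applied m times. -/
theorem hom_iterate_eq_one (hinj : φ.PiOneInjective v) (hconn : Γ.Connected) (m : ℕ) {w : V}
    {q : List (E × Bool)} (hq : Γ.IsPath w q w) (h : φ.hom^[m] (FreeGroup.mk q) = 1) :
    FreeGroup.mk q = 1 := by
  have base : ∀ m, ∀ q : List (E × Bool), Γ.IsPath v q v → φ.hom^[m] (FreeGroup.mk q) = 1 →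
      FreeGroup.mk q = 1 := by
    intro m
    induction m with
    | zero => intro q _ h; exact h
    | succ m ih =>
      intro q hq h
      rw [Function.iterate_succ_apply, hom_mk] at h
      have h1 := φ.isPath_mapPath hq
      rw [hinj.1] at h1
      exact hinj.2 q hq (ih _ h1 h)
  obtain ⟨c, hc⟩ := hconn v w
  have h1 := base m (c ++ (q ++ FreeGroup.invRev c))
    (OrientedGraph.IsPath.append _ hc (OrientedGraph.IsPath.append _ hq hc.invRev)) (by
      rw [mk_append, mk_append, iterate_map_mul, iterate_map_mul, h, one_mul, ← iterate_map_mul,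
        mk_invRev, mul_inv_cancel, iterate_map_one])
  rw [mk_append, mk_append, mk_invRev] at h1
  have h2 : FreeGroup.mk q = (FreeGroup.mk c)⁻¹ * (FreeGroup.mk c * (FreeGroup.mk q * (FreeGroup.mk c)⁻¹)) *
    FreeGroup.mk c := by group
  rw [h2, h1]; group

theorem end_mk {l : List (φ.VEdge v × Bool)} : ∀ {w w' : V} (p : φ.PathsTo v w) {y : φ.Over v w'},
    (φ.coverGraph v).IsPath ⟨w, Quot.mk _ p⟩ l ⟨w', y⟩ →
    ∃ q : φ.PathsTo v w', q.1 = p.1 ++ vert (l.map proj) ∧ y = Quot.mk _ q := by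
  induction l with
  | nil =>
    intro w w' p y h
    obtain ⟨rfl, h⟩ := Sigma.mk.inj (show (⟨w, Quot.mk _ p⟩ : φ.Node v) = ⟨w', y⟩ from h)
    exact ⟨p, by simp [vert], (eq_of_heq h).symm⟩
  | cons a l ih =>
    intro w w' p y h
    have hw : Γ.init (proj a) = w := (isPath_map_proj h).1
    subst hw
    have ha : a = liftEdge (proj a) (Quot.mk _ p) :=
      eq_of_proj (h.1.trans (init_liftEdge (proj a) (Quot.mk _ p)).symm) (proj_liftEdge _ _).symm
    have hp : φ.torusGraph.IsPath v (p.1 ++ vert [proj a]) (Γ.term (proj a)) :=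
      OrientedGraph.IsPath.append _ p.2 (isPath_vert (Γ := Γ) ⟨rfl, rfl⟩)
    have ht : (φ.coverGraph v).term a = ⟨Γ.term (proj a), Quot.mk _ ⟨_, hp⟩⟩ :=
      (congrArg _ ha).trans ((term_liftEdge (proj a) (Quot.mk _ p)).trans
        (congrArg (Sigma.mk _) (stepV_mk _ _ hp)))
    obtain ⟨q, hq, hy⟩ := ih _ (ht ▸ h.2)
    refine ⟨q, ?_, hy⟩
    rw [hq]; simp [vert]

/-- The components of `Ṽ` are trees. -/
theorem isForest_coverGraph (hinj : φ.PiOneInjective v) (hconn : Γ.Connected) :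
    IsForest (φ.coverGraph v) := by
  rintro ⟨w, x⟩ l hl hr
  induction x using Quot.ind with
  | mk p =>
    obtain ⟨q, hq, hy⟩ := end_mk p hl
    obtain ⟨n₀, hn₀⟩ := push_eq hy
    have h := hn₀ n₀ le_rfl
    -- Since `l` is closed, `p` followed by `l` is homotopic to `p`. Cancelling the contribution of
    -- `p` leaves an iterated image of `l` equal to 1.
    rw [hq, push_append, push_vert, left_eq_mul] at h
    have h1 := hom_iterate_eq_one hinj hconn _ (isPath_map_proj hl) h
    have h2 := isReduced_map_proj hl hr
    have h3 := eq_of_mk_eq (q := []) h2 FreeGroup.IsReduced.nil h1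
    simpa using h3

/-! ### The lift of a train track map -/

theorem edgePath_ne_nil (e : E) : φ.edgePath e ≠ [] := by
  intro h
  have h1 := φ.sum_eq e
  have h2 : φ.onEdge e = [] := by simpa [edgePath] using h
  rw [h2] at h1
  simp at h1

theorem orientedImage_ne_nil (a : E × Bool) : φ.orientedImage a ≠ [] := by
  rcases a with ⟨e, _ | _⟩
  · rw [orientedImage_false]
    intro h
    have := congrArg List.length h
    rw [FreeGroup.invRev_length] at this
    exact edgePath_ne_nil e (List.length_eq_zero_iff.1 this)
  · exact edgePath_ne_nil e

/-- Two reduced paths with the same ends and the same reduced image differ by a loop killed by `φ`,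
hence coincide. There are finitely many choices of ends and of short image words, so finitely many
such paths. Bounded cancellation rests on this. -/
theorem proper_base [Finite V] [Finite E] (hinj : φ.PiOneInjective v) (hconn : Γ.Connected) (n : ℕ) :
    ∃ K : ℕ, ∀ (w w' : V) (q : List (E × Bool)), Γ.IsPath w q w' → FreeGroup.IsReduced q →
      (red (φ.mapPath q)).length ≤ n → q.length ≤ K := by
  set T : Set (List (E × Bool)) := ⋃ (w : V), ⋃ (w' : V), ⋃ r ∈ {r : List (E × Bool) | r.length ≤ n},
    {q | Γ.IsPath w q w' ∧ FreeGroup.IsReduced q ∧ red (φ.mapPath q) = r} with hT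
  have hfin : T.Finite := by
    refine Set.finite_iUnion fun w => Set.finite_iUnion fun w' =>
      (List.finite_length_le _ n).biUnion fun r _ => Set.Subsingleton.finite ?_
    rintro q ⟨h1, h2, h3⟩ q' ⟨h1', h2', h3'⟩
    apply eq_of_mk_eq h2 h2'
    have := hom_iterate_eq_one hinj hconn 1 (OrientedGraph.IsPath.append _ h1 h1'.invRev) (by
      rw [Function.iterate_one, mk_append, mk_invRev, _root_.map_mul, _root_.map_inv, hom_mk, hom_mk,
        ← mk_red, h3, ← mk_red (φ.mapPath q'), h3', mul_inv_cancel])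
    rw [mk_append, mk_invRev] at this
    exact mul_inv_eq_one.1 this
  obtain ⟨K, hK⟩ := (hfin.image List.length).bddAbove
  refine ⟨K, fun w w' q h1 h2 h3 => hK ⟨q, ?_, rfl⟩⟩
  simp only [hT, mem_iUnion, mem_ofPred_eq]
  exact ⟨w, w', _, h3, h1, h2, rfl⟩

theorem transitionMatrix_pos {e e' : E} :
    0 < φ.transitionMatrix e e' ↔ e' ∈ (φ.edgePath e).map Prod.fst := by
  simp only [transitionMatrix, Nat.cast_pos, List.count_pos_iff]

theorem length_le_iterate_base (n : ℕ) : ∀ p : List (E × Bool),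
    p.length ≤ (φ.mapPath^[n] p).length := by
  have h1 : ∀ p : List (E × Bool), p.length ≤ (φ.mapPath p).length := by
    intro p
    induction p with
    | nil => simp
    | cons a p ih =>
      rw [mapPath_cons, List.length_append, List.length_cons]
      have := List.length_pos_of_ne_nil (orientedImage_ne_nil (φ := φ) a)
      omega
  induction n with
  | zero => intro p; rfl
  | succ n ih => intro p; exact (h1 p).trans (ih _)

/-- If all iterates of `e` were single edges, walks from `e` in the transition graph would be forced
to follow these iterates. Irreducibility provides a closed walk of positive length at `e`, so some
iterate would be `e` up to direction, against expansion. -/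
theorem exists_expand [Finite E] (hexp : ∀ e, φ.IsExpanding e)
    (hirr : φ.transitionMatrix.IsIrreducible) :
    ∃ k, ∀ a : E × Bool, 2 ≤ (φ.mapPath^[k] [a]).length := by
  have h1 : ∀ e : E, ∃ k, 2 ≤ (φ.mapPath^[k] [(e, true)]).length := by
    intro e
    by_contra hcon
    push Not at hcon
    let _ := φ.transitionMatrix.toQuiver
    have key : ∀ f : E, ∀ p : Quiver.Path e f, ∃ b, φ.mapPath^[p.length] [(e, true)] = [(f, b)] := by
      intro f p
      induction p with
      | nil => exact ⟨true, rfl⟩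
      | @cons f g p hfg ih =>
        obtain ⟨b, hb⟩ := ih
        have hpos : g ∈ (φ.edgePath f).map Prod.fst := transitionMatrix_pos.1 hfg.down
        have h2 : φ.mapPath^[p.length + 1] [(e, true)] = φ.orientedImage (f, b) := by
          rw [Function.iterate_succ_apply', hb, mapPath_singleton]
        have h3 := hcon (p.length + 1)
        rw [h2] at h3
        have hmem : ∃ b', (g, b') ∈ φ.orientedImage (f, b) := by
          obtain ⟨⟨g', b'⟩, h, rfl⟩ := List.mem_map.1 hpos
          cases b
          · refine ⟨!b', ?_⟩
            rw [orientedImage_false]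
            simp only [FreeGroup.invRev, List.mem_reverse, List.mem_map]
            exact ⟨_, h, rfl⟩
          · exact ⟨b', h⟩
        obtain ⟨b', hb'⟩ := hmem
        refine ⟨b', ?_⟩
        rw [Quiver.Path.length_cons, h2]
        generalize φ.orientedImage (f, b) = l at *
        match l, h3, hb' with
        | [x], _, h => simp at h; rw [h]
    obtain ⟨p, hp⟩ := hirr.connected e e
    obtain ⟨b, hb⟩ := key e p
    exact hexp e p.length hp b hb
  choose k hk using h1
  obtain ⟨K, hK⟩ := (Set.finite_range k).bddAbove
  have hmono : ∀ e, 2 ≤ (φ.mapPath^[K] [(e, true)]).length := by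
    intro e
    have h2 : k e ≤ K := hK ⟨e, rfl⟩
    obtain ⟨d, rfl⟩ := Nat.exists_eq_add_of_le h2
    rw [add_comm, Function.iterate_add_apply]
    exact (hk e).trans (length_le_iterate_base d _)
  refine ⟨K, ?_⟩
  rintro ⟨e, _ | _⟩
  · have : [(e, false)] = FreeGroup.invRev [(e, true)] := rfl
    rw [this, iterate_invRev, FreeGroup.invRev_length]; exact hmono e
  · exact hmono e

theorem exists_mem_edgePath (hirr : φ.transitionMatrix.IsIrreducible) (f : E) :
    ∃ e, f ∈ (φ.edgePath e).map Prod.fst := by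
  let _ := φ.transitionMatrix.toQuiver
  obtain ⟨p, hp⟩ := hirr.connected f f
  cases p with
  | nil => simp at hp
  | cons p h => exact ⟨_, transitionMatrix_pos.1 h.down⟩

theorem isLegal_singleton (htt : φ.IsTrainTrack) (a : φ.VEdge v × Bool) :
    (φ.coverMap v).IsLegal [a] := by
  intro n
  apply isReduced_of_map_proj
  rw [map_proj_iterate]
  rcases a with ⟨c, _ | _⟩
  · have : [proj (c, false)] = FreeGroup.invRev [(c.1, true)] := rfl
    rw [List.map_singleton, this, iterate_invRev]
    exact isReduced_invRev (htt c.1 n)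
  · exact htt c.1 n

theorem isTreeTrainTrack_coverMap [Finite V] [Finite E] (hconn : Γ.Connected)
    (hinj : φ.PiOneInjective v) (htt : φ.IsTrainTrack) (hexp : ∀ e, φ.IsExpanding e)
    (hirr : φ.transitionMatrix.IsIrreducible) : IsTreeTrainTrack (φ.coverMap v) where
  forest := isForest_coverGraph hinj hconn
  proper n := by
    obtain ⟨K, hK⟩ := proper_base hinj hconn n
    refine ⟨K, fun x y p hp hr hl => ?_⟩
    have := hK _ _ _ (isPath_map_proj hp) (isReduced_map_proj hp hr) (by
      rw [← map_proj_mapPath, ← map_proj_red ((φ.coverMap v).isPath_mapPath hp), List.length_map]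
      exact hl)
    simpa using this
  bounded := by
    obtain ⟨L, hL⟩ := (Set.finite_range fun a : E × Bool => (φ.orientedImage a).length).bddAbove
    refine ⟨L, fun a => ?_⟩
    have h1 := hL ⟨proj a, rfl⟩
    have h2 := congrArg List.length (map_proj_mapPath [a])
    rw [List.length_map, mapPath_singleton, List.map_singleton, mapPath_singleton] at h2
    rwa [h2]
  legal := isLegal_singleton htt
  expand := by
    obtain ⟨k, hk⟩ := exists_expand hexp hirr
    refine ⟨k, fun a => ?_⟩
    have h2 := congrArg List.length (map_proj_iterate k [a])
    rw [List.length_map, List.map_singleton] at h2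
    rw [h2]; exact hk _
  nonempty a := by
    have h2 := congrArg List.length (map_proj_mapPath [a])
    rw [List.length_map, mapPath_singleton, List.map_singleton, mapPath_singleton] at h2
    intro h
    rw [h] at h2
    exact orientedImage_ne_nil (φ := φ) (proj a) (List.length_eq_zero_iff.1 h2.symm)

/-- Every edge of `Ṽ` lies in the image of an edge. -/
theorem exists_mem_coverMap (hirr : φ.transitionMatrix.IsIrreducible) (c : φ.VEdge v) :
    ∃ c₀, c ∈ ((φ.coverMap v).edgePath c₀).map Prod.fst := by
  obtain ⟨e, he⟩ := exists_mem_edgePath hirr c.1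
  obtain ⟨⟨f, b⟩, hfb, hf⟩ := List.mem_map.1 he
  simp only at hf
  subst hf
  obtain ⟨l₁, l₂, hl⟩ := List.append_of_mem hfb
  have hpath : Γ.IsPath (φ.onVert (Γ.src e)) (φ.edgePath e) (φ.onVert (Γ.tgt e)) := φ.isPath e
  rw [hl] at hpath
  obtain ⟨w, h1, h2, -⟩ := isPath_append.1 hpath
  set Y := (φ.coverGraph v).init (c, b) with hY
  have hYw : Y.1 = w := by rw [← h2]; cases b <;> rfl
  -- Lift backwards, from the initial node of `(c, b)`, the part of `φ(e)` preceding the chosen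
  -- letter; then undo the horizontal edge at its end to find the start of the edge wanted.
  obtain ⟨p, x₀, hp, hpl⟩ := exists_lift (φ := φ) (v := v) (h1.invRev) (hYw ▸ Y.2)
  have hYeq : (⟨w, hYw ▸ Y.2⟩ : φ.Node v) = Y := by subst hYw; rfl
  rw [hYeq] at hp
  set c₀ : φ.VEdge v := ⟨e, Over.step (φ := φ) (v := v) (Sum.inr (Γ.src e), false) x₀⟩ with hc₀
  have hnext : c₀.tail.next = ⟨φ.onVert (Γ.src e), x₀⟩ :=
    congrArg (Sigma.mk _) (step_step_horiz (Γ.src e) x₀)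
  have hq : (φ.coverGraph v).IsPath c₀.tail.next ((φ.coverMap v).edgePath c₀) c₀.head.next :=
    (φ.coverMap v).isPath c₀
  have hproj := map_proj_edgePath c₀
  rw [hl] at hproj
  obtain ⟨q₁, q₂, hq12, hq1, hq2⟩ := List.map_eq_append_iff.1 hproj
  obtain ⟨a, q₃, rfl, ha, hq3⟩ := List.map_eq_cons_iff.1 hq2
  rw [hq12, hnext] at hq
  obtain ⟨z, hz1, hz2, -⟩ := isPath_append.1 hq
  -- Lifts with the same start and the same projection coincide, so the lifted image path passes
  -- through the prescribed node and then through `c`.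
  have hpq : FreeGroup.invRev p = q₁ :=
    eq_of_map_proj hp.invRev hz1 (by rw [map_proj_invRev, hpl, FreeGroup.invRev_invRev, hq1])
  have hzY : z = Y := by
    rw [← hpq] at hz1
    exact hz1.unique hp.invRev
  have hac : a = (c, b) := eq_of_proj (by rw [hz2, hzY]) ha
  exact ⟨c₀, by rw [hq12, hac]; simp⟩

end GraphMap

/-! ### Parametrized edge paths and the counting of crossings -/

section Traversal

variable {N ι P : Type*}

/-- `f` traverses the edge path `l` from `x` to `y` during the time interval `[a, b]`: each edge is
crossed at constant speed, and `f` may rest at nodes if `R` holds. -/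
inductive Traverses (G : OrientedGraph N ι) (nd : N → P) (arc : ι → ℝ → P) (R : Prop) (f : ℝ → P) :
    ℝ → ℝ → N → List (ι × Bool) → N → Prop
  | rest (a b : ℝ) (x : N) : a ≤ b → (a < b → R) → (∀ u ∈ Icc a b, f u = nd x) →
      Traverses G nd arc R f a b x [] x
  | edge (a b : ℝ) (e : ι × Bool) : a < b →
      (∀ u ∈ Icc a b, f u = oarc arc e ((u - a) / (b - a))) →
      Traverses G nd arc R f a b (G.init e) [e] (G.term e)
  | trans (a b c : ℝ) (x y z : N) (p q : List (ι × Bool)) : Traverses G nd arc R f a b x p y →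
      Traverses G nd arc R f b c y q z → Traverses G nd arc R f a c x (p ++ q) z

variable {G : OrientedGraph N ι} {nd : N → P} {arc : ι → ℝ → P} {R : Prop} {f : ℝ → P}
  {a b : ℝ} {x y : N} {l : List (ι × Bool)}

namespace Traverses

theorem le (h : Traverses G nd arc R f a b x l y) : a ≤ b := by
  induction h with
  | rest a b x h => exact h
  | edge a b e h => exact h.le
  | trans a b c x y z p q _ _ h1 h2 => exact h1.trans h2

theorem isPath (h : Traverses G nd arc R f a b x l y) : G.IsPath x l y := by
  induction h with
  | rest a b x h => rfl
  | edge a b e h => exact ⟨rfl, rfl⟩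
  | trans a b c x y z p q _ _ h1 h2 => exact OrientedGraph.IsPath.append _ h1 h2

theorem congr (h : Traverses G nd arc R f a b x l y) {g : ℝ → P} (hg : ∀ u ∈ Icc a b, g u = f u) :
    Traverses G nd arc R g a b x l y := by
  induction h with
  | rest a b x h hR hf => exact .rest a b x h hR fun u hu => (hg u hu).trans (hf u hu)
  | edge a b e h hf => exact .edge a b e h fun u hu => (hg u hu).trans (hf u hu)
  | trans a b c x y z p q h1 h2 ih1 ih2 =>
    exact .trans a b c x y z p q (ih1 fun u hu => hg u ⟨hu.1, hu.2.trans h2.le⟩)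
      (ih2 fun u hu => hg u ⟨h1.le.trans hu.1, hu.2⟩)

theorem allow_rest (h : Traverses G nd arc R f a b x l y) {R' : Prop} (hR : R → R') :
    Traverses G nd arc R' f a b x l y := by
  induction h with
  | rest a b x h hr hf => exact .rest a b x h (fun h => hR (hr h)) hf
  | edge a b e h hf => exact .edge a b e h hf
  | trans a b c x y z p q h1 h2 ih1 ih2 => exact .trans a b c x y z p q ih1 ih2

theorem comp_affine (h : Traverses G nd arc R f a b x l y) {k m : ℝ} (hk : 0 < k) {a' b' : ℝ}
    (ha : k * a' + m = a) (hb : k * b' + m = b) :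
    Traverses G nd arc R (fun u => f (k * u + m)) a' b' x l y := by
  induction h generalizing a' b' with
  | rest a b x h hr hf =>
    refine .rest a' b' x (by by_contra hc; nlinarith) (fun h' => hr (by nlinarith)) fun u hu => hf _ ?_
    constructor <;> nlinarith [hu.1, hu.2]
  | edge a b e h hf =>
    subst ha hb
    refine .edge a' b' e (by by_contra hc; nlinarith) fun u hu => (hf _ ?_).trans ?_
    · constructor <;> nlinarith [hu.1, hu.2]
    · congr 1
      rw [show k * u + m - (k * a' + m) = k * (u - a') by ring,
        show k * b' + m - (k * a' + m) = k * (b' - a') by ring, mul_div_mul_left _ _ hk.ne']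
  | trans a b c x y z p q h1 h2 ih1 ih2 =>
    have hm : k * ((b - m) / k) + m = b := by field_simp; ring
    exact .trans a' ((b - m) / k) b' x y z p q (ih1 ha hm) (ih2 hm hb)

theorem comp_neg (h : Traverses G nd arc R f a b x l y) (m : ℝ) {a' b' : ℝ}
    (ha : m - a' = a) (hb : m - b' = b) :
    Traverses G nd arc R (fun u => f (m - u)) b' a' y (FreeGroup.invRev l) x := by
  induction h generalizing a' b' with
  | rest a b x h hr hf =>
    refine .rest b' a' x (by linarith) (fun h' => hr (by linarith)) fun u hu => hf _ ?_
    constructor <;> linarith [hu.1, hu.2]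
  | edge a b e h hf =>
    subst ha hb
    have h1 : G.init (e.1, !e.2) = G.term e := init_not e
    have h2 : G.term (e.1, !e.2) = G.init e := term_not e
    rw [← h1, ← h2]
    refine .edge b' a' (e.1, !e.2) (by linarith) fun u hu => (hf _ ?_).trans ?_
    · constructor <;> linarith [hu.1, hu.2]
    · rw [oarc_rev]
      congr 1
      have : a' - b' ≠ 0 := by linarith
      have h3 : m - b' - (m - a') = a' - b' := by ring
      rw [h3]
      field_simp; ring
  | trans a b c x y z p q h1 h2 ih1 ih2 =>
    have hm : m - (m - b) = b := by ring
    have := Traverses.trans b' (m - b) a' z y x _ _ (ih2 hm hb) (ih1 ha hm)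
    rwa [← FreeGroup.invRev_append] at this

theorem point (h : nd x = f a) : Traverses G nd arc R f a a x [] x :=
  .rest a a x le_rfl (fun h => absurd h (lt_irrefl _)) fun u hu => by rw [le_antisymm hu.2 hu.1, h]

/-- Without rests, time is a piecewise affine reparametrization of the edges crossed. Rests would
allow whole intervals of bad times. -/
theorem finite_of_edges (h : Traverses G nd arc False f a b x l y) {Q : P → Prop}
    (hQ : ∀ c, {u ∈ Icc (0 : ℝ) 1 | Q (arc c u)}.Finite) : {u ∈ Icc a b | Q (f u)}.Finite := by
  induction h with
  | rest a b x h hr hf =>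
    refine Set.Subsingleton.finite fun u hu w hw => ?_
    have : ¬ a < b := hr
    linarith [hu.1.1, hu.1.2, hw.1.1, hw.1.2]
  | edge a b e h hf =>
    have hba : 0 < b - a := by linarith
    refine ((hQ e.1).image fun t => a + (b - a) * cond e.2 t (1 - t)).subset ?_
    rintro u ⟨hu, h'⟩
    rw [hf u hu] at h'
    have hI : (u - a) / (b - a) ∈ Icc (0 : ℝ) 1 :=
      ⟨div_nonneg (by linarith [hu.1]) hba.le, (div_le_one hba).2 (by linarith [hu.2])⟩
    refine ⟨cond e.2 ((u - a) / (b - a)) (1 - (u - a) / (b - a)), ⟨?_, h'⟩, ?_⟩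
    · cases e.2
      · exact ⟨by simp only [cond_false]; linarith [hI.2], by simp only [cond_false]; linarith [hI.1]⟩
      · exact hI
    · cases e.2 <;> simp <;> field_simp <;> ring
  | trans a b d x y z p q h1 h2 ih1 ih2 =>
    refine (ih1.union ih2).subset ?_
    rintro u ⟨hu, h'⟩
    rcases le_total u b with h | h
    · exact Or.inl ⟨⟨hu.1, h⟩, h'⟩
    · exact Or.inr ⟨⟨h, hu.2⟩, h'⟩

end Traverses

namespace IsArcSystem

variable (hA : IsArcSystem G nd arc)
include hA

theorem traverses_left (h : Traverses G nd arc R f a b x l y) : f a = nd x := by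
  induction h with
  | rest a b x h hr hf => exact hf a ⟨le_rfl, h⟩
  | edge a b e h hf => rw [hf a ⟨le_rfl, h.le⟩, sub_self, zero_div, hA.oarc_zero]
  | trans a b c x y z p q h1 h2 ih1 ih2 => exact ih1

theorem traverses_right (h : Traverses G nd arc R f a b x l y) : f b = nd y := by
  induction h with
  | rest a b x h hr hf => exact hf b ⟨h, le_rfl⟩
  | edge a b e h hf => rw [hf b ⟨h.le, le_rfl⟩, div_self (by linarith), hA.oarc_one]
  | trans a b c x y z p q h1 h2 ih1 ih2 => exact ih2

theorem traverses_split (h : Traverses G nd arc R f a b x l y) : ∀ p q, l = p ++ q → ∃ s z,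
    Traverses G nd arc R f a s x p z ∧ Traverses G nd arc R f s b z q y := by
  induction h with
  | rest a b x h hr hf =>
    intro p q hpq
    obtain ⟨rfl, rfl⟩ := List.append_eq_nil_iff.1 hpq.symm
    exact ⟨b, x, .rest a b x h hr hf, Traverses.point (hf b ⟨h, le_rfl⟩).symm⟩
  | edge a b e h hf =>
    intro p q hpq
    have h1 : Traverses G nd arc R f a b (G.init e) [e] (G.term e) := .edge a b e h hf
    cases p with
    | nil =>
      obtain rfl : [e] = q := hpq
      exact ⟨a, G.init e, Traverses.point (hA.traverses_left h1).symm, h1⟩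
    | cons e' p =>
      obtain ⟨rfl, h2⟩ := List.cons_eq_cons.1 hpq
      obtain ⟨rfl, rfl⟩ := List.append_eq_nil_iff.1 h2.symm
      exact ⟨b, G.term e, h1, Traverses.point (hA.traverses_right h1).symm⟩
  | trans a b c x y z p' q' h1 h2 ih1 ih2 =>
    intro p q hpq
    rcases List.append_eq_append_iff.1 hpq with ⟨r, rfl, hr⟩ | ⟨r, hr, rfl⟩
    · obtain ⟨s, w, h3, h4⟩ := ih2 r q hr
      exact ⟨s, w, .trans _ _ _ _ _ _ _ _ h1 h3, h4⟩
    · obtain ⟨s, w, h3, h4⟩ := ih1 p r hr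
      exact ⟨s, w, h3, .trans _ _ _ _ _ _ _ _ h4 h2⟩

/-- Every time lies in an interval during which at most one edge is traversed; if the position at
that time is a node, then this interval can be taken trivial. -/
theorem traverses_locate (h : Traverses G nd arc R f a b x l y) : ∀ s ∈ Icc a b,
    ∃ s₁ s₂ p e q z₁ z₂, s₁ ≤ s ∧ s ≤ s₂ ∧ l = p ++ (e ++ q) ∧ e.length ≤ 1 ∧
      ((∃ w, f s = nd w) → s₁ = s ∧ s₂ = s ∧ e = []) ∧ (e = [] → s₁ = s ∧ s₂ = s) ∧
      Traverses G nd arc R f a s₁ x p z₁ ∧ Traverses G nd arc R f s₁ s₂ z₁ e z₂ ∧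
      Traverses G nd arc R f s₂ b z₂ q y := by
  induction h with
  | rest a b x h hr hf =>
    intro s hs
    refine ⟨s, s, [], [], [], x, x, le_rfl, le_rfl, rfl, by simp, fun _ => ⟨rfl, rfl, rfl⟩,
      fun _ => ⟨rfl, rfl⟩, .rest _ _ _ hs.1 (fun h' => hr (h'.trans_le hs.2)) fun u hu => hf u ⟨hu.1, hu.2.trans hs.2⟩,
      Traverses.point (hf s hs).symm,
      .rest _ _ _ hs.2 (fun h' => hr (hs.1.trans_lt h')) fun u hu => hf u ⟨hs.1.trans hu.1, hu.2⟩⟩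
  | edge a b e h hf =>
    intro s hs
    have h1 : Traverses G nd arc R f a b (G.init e) [e] (G.term e) := .edge a b e h hf
    have ha := hA.traverses_left h1
    have hb := hA.traverses_right h1
    by_cases hw : ∃ w, f s = nd w
    · obtain ⟨w, hw⟩ := hw
      have hs' := hf s hs
      have hba : 0 < b - a := by linarith
      have hI : (s - a) / (b - a) ∈ Icc (0 : ℝ) 1 :=
        ⟨div_nonneg (by linarith [hs.1]) hba.le, (div_le_one hba).2 (by linarith [hs.2])⟩
      rcases hA.oarc_eq_nd hI (hs'.symm.trans hw) with ⟨h0, -⟩ | ⟨h0, -⟩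
      · have : s = a := by
          rw [div_eq_zero_iff] at h0
          rcases h0 with h0 | h0 <;> linarith
        subst this
        exact ⟨s, s, [], [], [e], G.init e, G.init e, le_rfl, le_rfl, rfl, by simp,
          fun _ => ⟨rfl, rfl, rfl⟩, fun _ => ⟨rfl, rfl⟩, Traverses.point ha.symm,
          Traverses.point ha.symm, h1⟩
      · have : s = b := by
          rw [div_eq_one_iff_eq hba.ne'] at h0
          linarith
        subst this
        exact ⟨s, s, [e], [], [], G.term e, G.term e, le_rfl, le_rfl, rfl, by simp,
          fun _ => ⟨rfl, rfl, rfl⟩, fun _ => ⟨rfl, rfl⟩, h1, Traverses.point hb.symm,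
          Traverses.point hb.symm⟩
    · exact ⟨a, b, [], [e], [], G.init e, G.term e, hs.1, hs.2, rfl, by simp, fun h => absurd h hw,
        fun h => by simp at h, Traverses.point ha.symm, h1, Traverses.point hb.symm⟩
  | trans a b c x y z p q h1 h2 ih1 ih2 =>
    intro s hs
    rcases le_total s b with hsb | hsb
    · obtain ⟨s₁, s₂, p', e, q', z₁, z₂, i1, i2, rfl, i4, i5, i6, i7, i8, i9⟩ := ih1 s ⟨hs.1, hsb⟩
      exact ⟨s₁, s₂, p', e, q' ++ q, z₁, z₂, i1, i2, by simp, i4, i5, i6, i7, i8,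
        .trans _ _ _ _ _ _ _ _ i9 h2⟩
    · obtain ⟨s₁, s₂, p', e, q', z₁, z₂, i1, i2, rfl, i4, i5, i6, i7, i8, i9⟩ := ih2 s ⟨hsb, hs.2⟩
      exact ⟨s₁, s₂, p ++ p', e, q', z₁, z₂, i1, i2, by simp, i4, i5, i6,
        .trans _ _ _ _ _ _ _ _ h1 i7, i8, i9⟩

theorem traverses_cut (h : Traverses G nd arc R f a b x l y) {s : ℝ} (hs : s ∈ Icc a b) {z : N}
    (hz : f s = nd z) : ∃ p q, l = p ++ q ∧ Traverses G nd arc R f a s x p z ∧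
      Traverses G nd arc R f s b z q y := by
  obtain ⟨s₁, s₂, p, e, q, z₁, z₂, -, -, h1, -, h2, -, h3, -, h4⟩ := hA.traverses_locate h s hs
  obtain ⟨rfl, rfl, rfl⟩ := h2 ⟨z, hz⟩
  obtain rfl := hA.nd_inj (hz.symm.trans (hA.traverses_right h3))
  obtain rfl := hA.nd_inj (hz.symm.trans (hA.traverses_left h4))
  exact ⟨p, q, by simpa using h1, h3, h4⟩

/-- Each crossing of `c` meets an interior point once, while rests and junctions sit at nodes. This
converts combinatorial counts into cardinalities of sets of times. -/
theorem traverses_count (h : Traverses G nd arc R f a b x l y) (c : ι) {ξ : ℝ}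
    (hξ : ξ ∈ Ioo (0 : ℝ) 1) : {u ∈ Icc a b | f u = arc c ξ}.Finite ∧
      {u ∈ Icc a b | f u = arc c ξ}.ncard = cnt c l := by
  induction h with
  | rest a b x h hr hf =>
    have : {u ∈ Icc a b | f u = arc c ξ} = ∅ := by
      ext u
      simp only [mem_ofPred_eq, mem_empty_iff_false, iff_false, not_and]
      intro hu h'
      exact hA.inner_ne c ξ hξ x (h'.symm.trans (hf u hu))
    rw [this]
    simp [cnt]
  | edge a b e h hf =>
    have hba : 0 < b - a := by linarith
    have key : ∀ u ∈ Icc a b, (f u = arc c ξ ↔ e.1 = c ∧ u = a + (b - a) * cond e.2 ξ (1 - ξ)) := by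
      intro u hu
      have hI : (u - a) / (b - a) ∈ Icc (0 : ℝ) 1 :=
        ⟨div_nonneg (by linarith [hu.1]) hba.le, (div_le_one hba).2 (by linarith [hu.2])⟩
      rw [hf u hu]
      constructor
      · intro h'
        rcases mem_cases hI with h2 | h2 | h2
        · have h3 : oarc arc e ((u - a) / (b - a)) = arc e.1 (cond e.2 ((u - a) / (b - a)) (1 - ((u - a) / (b - a)))) := rfl
          rw [h3] at h'
          have hmem : cond e.2 ((u - a) / (b - a)) (1 - ((u - a) / (b - a))) ∈ Ioo (0 : ℝ) 1 := by
            cases e.2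
            · exact ⟨by simp only [cond_false]; linarith [h2.2], by simp only [cond_false]; linarith [h2.1]⟩
            · exact h2
          obtain ⟨h4, h5⟩ := hA.inner_inj _ _ _ hmem _ hξ h'
          refine ⟨h4, ?_⟩
          rw [← h5]
          cases e.2 <;> simp <;> field_simp <;> ring
        · rw [h2, hA.oarc_zero] at h'; exact absurd h'.symm (hA.inner_ne c ξ hξ _)
        · rw [h2, hA.oarc_one] at h'; exact absurd h'.symm (hA.inner_ne c ξ hξ _)
      · rintro ⟨rfl, rfl⟩
        rw [add_sub_cancel_left, mul_div_cancel_left₀ _ hba.ne']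
        unfold oarc
        congr 1
        cases e.2 <;> simp
    by_cases hc : e.1 = c
    · have : {u ∈ Icc a b | f u = arc c ξ} = {a + (b - a) * cond e.2 ξ (1 - ξ)} := by
        ext u
        simp only [mem_ofPred_eq, mem_singleton_iff]
        constructor
        · rintro ⟨h1, h2⟩; exact ((key u h1).1 h2).2
        · intro h1
          have h2 : u ∈ Icc a b := by
            rw [h1]
            have h3 : cond e.2 ξ (1 - ξ) ∈ Icc (0 : ℝ) 1 := by
              cases e.2
              · exact ⟨by simp only [cond_false]; linarith [hξ.2], by simp only [cond_false]; linarith [hξ.1]⟩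
              · exact ⟨hξ.1.le, hξ.2.le⟩
            constructor <;> nlinarith [h3.1, h3.2]
          exact ⟨h2, (key u h2).2 ⟨hc, h1⟩⟩
      rw [this]
      exact ⟨finite_singleton _, by simp [cnt, hc]⟩
    · have : {u ∈ Icc a b | f u = arc c ξ} = ∅ := by
        ext u
        simp only [mem_ofPred_eq, mem_empty_iff_false, iff_false, not_and]
        intro hu h'
        exact hc ((key u hu).1 h').1
      rw [this]
      simp [cnt, hc]
  | trans a b d x y z p q h1 h2 ih1 ih2 =>
    have hU : {u ∈ Icc a d | f u = arc c ξ} =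
        {u ∈ Icc a b | f u = arc c ξ} ∪ {u ∈ Icc b d | f u = arc c ξ} := by
      ext u
      simp only [mem_ofPred_eq, mem_union, mem_Icc]
      have := h1.le
      have := h2.le
      constructor
      · rintro ⟨⟨h3, h4⟩, h5⟩
        rcases le_total u b with h | h
        · exact Or.inl ⟨⟨h3, h⟩, h5⟩
        · exact Or.inr ⟨⟨h, h4⟩, h5⟩
      · rintro (⟨⟨h3, h4⟩, h5⟩ | ⟨⟨h3, h4⟩, h5⟩)
        · exact ⟨⟨h3, by linarith⟩, h5⟩
        · exact ⟨⟨by linarith, h4⟩, h5⟩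
    rw [hU]
    refine ⟨ih1.1.union ih2.1, ?_⟩
    rw [ncard_union_eq _ ih1.1 ih2.1, ih1.2, ih2.2, cnt_append]
    rw [Set.disjoint_left]
    rintro u ⟨h3, h4⟩ ⟨h5, -⟩
    obtain rfl : u = b := le_antisymm h3.2 h5.1
    exact hA.inner_ne c ξ hξ y (h4.symm.trans (hA.traverses_right h1))

end IsArcSystem

end Traversal

namespace GraphMap

variable {V E : Type*} {Γ : OrientedGraph V E} {φ : GraphMap Γ} {v : V}

/-! ### The flow traverses image paths -/

theorem isArcSystem_point :
    IsArcSystem (φ.coverGraph v) VPoint.node (VEdge.point (φ := φ) (v := v)) where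
  src c := by simp [VEdge.point, coverGraph]
  tgt c := by simp [VEdge.point, coverGraph]
  nd_inj x y h := VPoint.node.inj h
  inner_ne c s hs x := by simp [VEdge.point, hs]
  inner_inj c d s hs t ht h := by simpa [VEdge.point, hs, ht] using h

theorem point_zero (c : φ.VEdge v) : c.point 0 = .node c.tail := isArcSystem_point.src c

theorem point_one (c : φ.VEdge v) : c.point 1 = .node c.head := isArcSystem_point.tgt c

theorem point_inner (c : φ.VEdge v) {s : ℝ} (hs : s ∈ Ioo (0 : ℝ) 1) : c.point s = .inner c ⟨s, hs⟩ := by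
  simp [VEdge.point, hs]

/-- `f` traverses an edge path of `Ṽ`. -/
abbrev Trav (R : Prop) (f : ℝ → φ.VPoint v) (a b : ℝ) (x : φ.Node v) (l : List (φ.VEdge v × Bool))
    (y : φ.Node v) : Prop :=
  Traverses (φ.coverGraph v) VPoint.node VEdge.point R f a b x l y

theorem trav_walk {w' : V} (l : List ((E × Bool) × ℝ)) : ∀ {w : V} (x : φ.Over v w)
    (h : Γ.IsPath w (l.map Prod.fst) w'), (∀ a ∈ l, 0 < a.2) →
    Trav False (Over.walk (φ := φ) (v := v) x l h) 0 (l.map Prod.snd).sum ⟨w, x⟩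
      ((liftList x l h).map Prod.fst) ⟨w', liftEnd x l h⟩ := by
  induction l with
  | nil =>
    intro w x h _
    obtain rfl : w = w' := h
    exact Traverses.point rfl
  | cons a l ih =>
    intro w x h hpos
    obtain rfl : Γ.init a.1 = w := h.1
    have ha : 0 < a.2 := hpos a (by simp)
    have ht := ih (Over.stepV (φ := φ) (v := v) a.1 x) h.2 fun b hb => hpos b (by simp [hb])
    have hw : ∀ s, Over.walk (φ := φ) (v := v) x (a :: l) h s =
      if s ≤ a.2 then Over.along (φ := φ) (v := v) a.1 x (s / a.2) else
        Over.walk (φ := φ) (v := v) (Over.stepV (φ := φ) (v := v) a.1 x) l h.2 (s - a.2) := fun s => rfl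
    have h1 : Trav False (Over.walk (φ := φ) (v := v) x (a :: l) h) 0 a.2
        ((φ.coverGraph v).init (liftEdge a.1 x)) [liftEdge a.1 x]
        ((φ.coverGraph v).term (liftEdge a.1 x)) := by
      refine .edge 0 a.2 _ ha fun u hu => ?_
      rw [hw, if_pos hu.2, along_eq, sub_zero, sub_zero]
    have h2 := ht.comp_affine (k := 1) (m := -a.2) (a' := a.2) (b' := a.2 + (l.map Prod.snd).sum)
      one_pos (by ring) (by ring)
    have h3 : Trav False (Over.walk (φ := φ) (v := v) x (a :: l) h) a.2 (a.2 + (l.map Prod.snd).sum)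
        ((φ.coverGraph v).term (liftEdge a.1 x))
        ((liftList (Over.stepV (φ := φ) (v := v) a.1 x) l h.2).map Prod.fst)
        ⟨w', liftEnd (Over.stepV (φ := φ) (v := v) a.1 x) l h.2⟩ := by
      rw [term_liftEdge]
      refine h2.congr fun u hu => ?_
      rw [one_mul, ← sub_eq_add_neg]
      rcases hu.1.eq_or_lt with rfl | hlt
      · rw [isArcSystem_point.traverses_right h1, sub_self, isArcSystem_point.traverses_left ht,
          term_liftEdge]
      · rw [hw, if_neg (not_le.2 hlt)]
    have h4 := Traverses.trans _ _ _ _ _ _ _ _ h1 h3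
    rw [init_liftEdge] at h4
    rw [List.map_cons, List.sum_cons]
    exact h4

theorem trav_flow_edge (c : φ.VEdge v) :
    Trav False (fun u => flow (c.point u)) 0 1 c.tail.next ((φ.coverMap v).edgePath c) c.head.next := by
  have h := trav_walk (φ.onEdge c.1) c.tail.next.2 (φ.isPath c.1) (φ.pos c.1)
  rw [φ.sum_eq] at h
  have hend := liftEnd_onEdge c
  have h' : Trav False (Over.walk (φ := φ) (v := v) c.tail.next.2 (φ.onEdge c.1) (φ.isPath c.1)) 0 1
      c.tail.next ((φ.coverMap v).edgePath c) c.head.next := hend ▸ h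
  refine h'.congr fun u hu => ?_
  rcases mem_cases hu with hu | rfl | rfl
  · rw [point_inner c hu]; rfl
  · rw [point_zero, isArcSystem_point.traverses_left h']; rfl
  · rw [point_one, isArcSystem_point.traverses_right h']; rfl

/-- Each edge is replaced, during the same time interval, by its image path, and rests remain rests.
The times are unchanged, so crossings of all iterates can be compared on one parameter interval. -/
theorem Trav.flow {R : Prop} {f : ℝ → φ.VPoint v} {a b : ℝ} {x y : φ.Node v}
    {l : List (φ.VEdge v × Bool)} (h : Trav R f a b x l y) :
    Trav R (fun u => GraphMap.flow (f u)) a b x.next ((φ.coverMap v).mapPath l) y.next := by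
  induction h with
  | rest a b x h hr hf => exact .rest a b _ h hr fun u hu => by rw [hf u hu]; rfl
  | edge a b e h hf =>
    have hba : 0 < b - a := by linarith
    have h1 := (trav_flow_edge e.1).allow_rest (R' := R) False.elim
    rw [mapPath_singleton]
    obtain ⟨c, _ | _⟩ := e
    · rw [orientedImage_false]
      have h2 := (h1.comp_neg 1 (a' := 1) (b' := 0) (by norm_num) (by norm_num)).comp_affine
        (k := (b - a)⁻¹) (m := -a / (b - a)) (a' := a) (b' := b) (inv_pos.2 hba)
        (by field_simp; ring) (by field_simp; ring)
      refine h2.congr fun u hu => ?_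
      rw [hf u hu]
      simp only [oarc, cond_false]
      congr 3; field_simp; ring
    · have h2 := h1.comp_affine (k := (b - a)⁻¹) (m := -a / (b - a)) (a' := a) (b' := b) (inv_pos.2 hba)
        (by field_simp; ring) (by field_simp; ring)
      refine h2.congr fun u hu => ?_
      rw [hf u hu]
      simp only [oarc, cond_true]
      congr 2; field_simp; ring
  | trans a b c x y z p q h1 h2 ih1 ih2 =>
    rw [mapPath_append]
    exact .trans _ _ _ _ _ _ _ _ ih1 ih2

theorem Trav.iterate {R : Prop} (n : ℕ) : ∀ {f : ℝ → φ.VPoint v} {a b : ℝ} {x y : φ.Node v}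
    {l : List (φ.VEdge v × Bool)}, Trav R f a b x l y →
    Trav R (fun u => GraphMap.flow^[n] (f u)) a b (Node.next^[n] x) ((φ.coverMap v).mapPath^[n] l)
      (Node.next^[n] y) := by
  induction n with
  | zero => intro f a b x y l h; exact h
  | succ n ih => intro f a b x y l h; exact ih h.flow

theorem trav_edge (c : φ.VEdge v) : Trav False c.point 0 1 c.tail [(c, true)] c.head :=
  .edge 0 1 (c, true) one_pos fun u _ => by simp [oarc]

theorem flow_iterate_node (n : ℕ) (x : φ.Node v) :
    flow^[n] (.node x : φ.VPoint v) = .node (Node.next^[n] x) := by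
  induction n generalizing x with
  | zero => rfl
  | succ n ih => exact ih x.next

/-- The parameters of the points of an edge that flow to a node. -/
theorem finite_flow_node (n : ℕ) (c : φ.VEdge v) :
    {u ∈ Icc (0 : ℝ) 1 | ∃ x, flow^[n] (c.point u) = .node x}.Finite := by
  have h1 : ∀ d : φ.VEdge v, {u ∈ Icc (0 : ℝ) 1 | ∃ x, d.point u = .node x}.Finite := by
    intro d
    refine (Set.toFinite {0, 1}).subset ?_
    rintro u ⟨hu, x, hx⟩
    rcases mem_cases hu with hu | rfl | rfl
    · exact absurd hx (isArcSystem_point.inner_ne d u hu x)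
    · simp
    · simp
  exact ((trav_edge c).iterate n).finite_of_edges (Q := fun p => ∃ x, p = .node x) h1

/-- A parameter for which no point of the given edge ever flows to a node. -/
theorem exists_generic (c : φ.VEdge v) :
    ∃ ξ ∈ Ioo (0 : ℝ) 1, ∀ n x, flow^[n] (c.point ξ) ≠ .node x := by
  have hc : (⋃ n, {u ∈ Icc (0 : ℝ) 1 | ∃ x, flow^[n] (c.point u) = .node x}).Countable :=
    countable_iUnion fun n => (finite_flow_node n c).countable
  have hI : ¬ (Ioo (0 : ℝ) 1).Countable := by
    rw [← Cardinal.le_aleph0_iff_set_countable, Cardinal.mk_Ioo_real one_pos, not_le]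
    exact Cardinal.aleph0_lt_continuum
  obtain ⟨ξ, h1, h2⟩ : ∃ ξ ∈ Ioo (0 : ℝ) 1,
      ξ ∉ ⋃ n, {u ∈ Icc (0 : ℝ) 1 | ∃ x, flow^[n] (c.point u) = .node x} := by
    by_contra hcon
    push Not at hcon
    exact hI (hc.mono hcon)
  refine ⟨ξ, h1, fun n x hx => h2 (mem_iUnion.2 ⟨n, ⟨h1.1.le, h1.2.le⟩, x, hx⟩)⟩

theorem VPoint.cases_point (p : φ.VPoint v) :
    (∃ x, p = .node x) ∨ ∃ c, ∃ ξ ∈ Ioo (0 : ℝ) 1, p = VEdge.point c ξ := by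
  cases p with
  | node x => exact Or.inl ⟨x, rfl⟩
  | inner c s => exact Or.inr ⟨c, s.1, s.2, (point_inner c s.2).symm⟩

/-- By the count of crossings, a point of `c` that lands inside an edge lands on an edge of the n-th
image path of `c`. -/
theorem flow_generic {c : φ.VEdge v} {ξ : ℝ} (hξ : ξ ∈ Ioo (0 : ℝ) 1) {n : ℕ}
    (h : ∀ x, flow^[n] (c.point ξ) ≠ .node x) :
    ∃ c' ∈ ((φ.coverMap v).mapPath^[n] [(c, true)]).map Prod.fst, ∃ ξ' ∈ Ioo (0 : ℝ) 1,
      flow^[n] (c.point ξ) = VEdge.point c' ξ' := by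
  rcases VPoint.cases_point (flow^[n] (c.point ξ)) with ⟨x, hx⟩ | ⟨c', ξ', hξ', h'⟩
  · exact absurd hx (h x)
  · refine ⟨c', ?_, ξ', hξ', h'⟩
    obtain ⟨h1, h2⟩ := isArcSystem_point.traverses_count ((trav_edge c).iterate n) c' hξ'
    rw [← cnt_pos, ← h2, ncard_pos h1]
    exact ⟨ξ, ⟨hξ.1.le, hξ.2.le⟩, h'⟩

/-- The flow maps onto the interiors of the edges. -/
theorem exists_flow_eq (hirr : φ.transitionMatrix.IsIrreducible) (c : φ.VEdge v) {ξ : ℝ}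
    (hξ : ξ ∈ Ioo (0 : ℝ) 1) : ∃ p, flow p = VEdge.point c ξ := by
  obtain ⟨d, hd⟩ := exists_mem_coverMap hirr c
  obtain ⟨h1, h2⟩ := isArcSystem_point.traverses_count (trav_flow_edge d) c hξ
  rw [← cnt_pos, ← h2, ncard_pos h1] at hd
  obtain ⟨u, -, hu⟩ := hd
  exact ⟨_, hu⟩

/-- Irreducibility makes the flow onto the interiors of edges. A preimage of such a point cannot be
a node, because nodes flow to nodes, so the choice can be repeated. -/
theorem exists_iterate_eq (hirr : φ.transitionMatrix.IsIrreducible) (n : ℕ) :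
    ∀ {p : φ.VPoint v}, (∀ x, p ≠ .node x) → ∃ q, flow^[n] q = p := by
  induction n with
  | zero => intro p _; exact ⟨p, rfl⟩
  | succ n ih =>
    intro p hp
    rcases VPoint.cases_point p with ⟨x, hx⟩ | ⟨c, ξ, hξ, rfl⟩
    · exact absurd hx (hp x)
    · obtain ⟨r, hr⟩ := exists_flow_eq hirr c hξ
      obtain ⟨q, hq⟩ := ih (p := r) fun x hx => hp x.next (by rw [← hr, hx]; rfl)
      exact ⟨q, by rw [Function.iterate_succ_apply', hq, hr]⟩

/-! ### Height -/

/-- The height of a 0-cell. -/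
def Node.height (x : φ.Node v) : ℤ :=
  Quot.lift (fun p : φ.PathsTo v x.1 => gain p.1) (fun _ _ h => gain_homotopy h) x.2

theorem height_next (x : φ.Node v) : x.next.height = x.height + 1 := by
  obtain ⟨w, x⟩ := x
  induction x using Quot.ind with
  | mk p =>
    change gain (p.1 ++ [(Sum.inr w, true)]) = gain p.1 + 1
    simp [gain_append, gain]

theorem height_head (c : φ.VEdge v) : c.head.height = c.tail.height := by
  obtain ⟨e, x⟩ := c
  induction x using Quot.ind with
  | mk p =>
    change gain (p.1 ++ [(Sum.inl e, true)]) = gain p.1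
    simp [gain_append, gain]

/-- The height of a point of `Ṽ`. -/
def VPoint.height : φ.VPoint v → ℤ
  | .node x => x.height
  | .inner c _ => c.tail.height

theorem height_point (c : φ.VEdge v) (s : ℝ) : (c.point s).height = c.tail.height := by
  unfold VEdge.point
  split_ifs
  · rfl
  · rfl
  · exact height_head c

theorem height_oarc (e : φ.VEdge v × Bool) (s : ℝ) :
    (oarc VEdge.point e s : φ.VPoint v).height = ((φ.coverGraph v).init e).height := by
  refine (height_point _ _).trans ?_
  obtain ⟨c, _ | _⟩ := e
  · exact (height_head c).symm
  · rfl

theorem height_term (e : φ.VEdge v × Bool) :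
    ((φ.coverGraph v).term e).height = ((φ.coverGraph v).init e).height := by
  obtain ⟨c, _ | _⟩ := e
  · exact (height_head c).symm
  · exact height_head c

theorem IsPath.height_eq {l : List (φ.VEdge v × Bool)} : ∀ {x y : φ.Node v},
    (φ.coverGraph v).IsPath x l y → x.height = y.height := by
  induction l with
  | nil => rintro x y rfl; rfl
  | cons e l ih =>
    rintro x y ⟨rfl, h⟩
    rw [← ih h, height_term]

theorem Trav.height {R : Prop} {f : ℝ → φ.VPoint v} {a b : ℝ} {x y : φ.Node v}
    {l : List (φ.VEdge v × Bool)} (h : Trav R f a b x l y) : ∀ u ∈ Icc a b,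
    (f u).height = x.height := by
  induction h with
  | rest a b x h hr hf => intro u hu; rw [hf u hu]; rfl
  | edge a b e h hf => intro u hu; rw [hf u hu]; exact height_oarc e _
  | trans a b c x y z p q h1 h2 ih1 ih2 =>
    intro u hu
    rcases le_total u b with h | h
    · exact ih1 u ⟨hu.1, h⟩
    · rw [ih2 u ⟨h, hu.2⟩, IsPath.height_eq h1.isPath]

theorem height_flow (p : φ.VPoint v) : (flow p).height = p.height + 1 := by
  rcases VPoint.cases_point p with ⟨x, rfl⟩ | ⟨c, ξ, hξ, rfl⟩
  · exact height_next x
  · rw [(trav_flow_edge c).height ξ ⟨hξ.1.le, hξ.2.le⟩, height_point, height_next]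

theorem height_iterate (n : ℕ) (p : φ.VPoint v) : (flow^[n] p).height = p.height + n := by
  induction n with
  | zero => simp
  | succ n ih => rw [Function.iterate_succ_apply', height_flow, ih]; push_cast; ring

end GraphMap

namespace GraphMap

variable {V E : Type*} {Γ : OrientedGraph V E} {φ : GraphMap Γ} {v : V}

/-! ### The 1-skeleton of the universal cover -/

theorem fwd_zero (x : φ.VPoint v) : fwd x 0 = (x, ⟨0, le_rfl, one_pos⟩) := by
  simp only [fwd, Nat.floor_zero, Function.iterate_zero, id_eq, Int.fract_zero]

theorem fwd_natCast (x : φ.VPoint v) (n : ℕ) : fwd x n = fwd (flow^[n] x) 0 := by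
  simp [fwd]

theorem fwd_add_nat (x : φ.VPoint v) (n : ℕ) {r : ℝ} (hr : 0 ≤ r) :
    fwd x (n + r) = fwd (flow^[n] x) r := by
  unfold fwd
  rw [add_comm, Nat.floor_add_natCast hr, Function.iterate_add_apply]
  simp

theorem fwd_one (x : φ.VPoint v) : fwd x 1 = fwd (flow x) 0 := by
  have := fwd_natCast x 1
  simpa using this

theorem fwd_of_lt (x : φ.VPoint v) {r : ℝ} (hr : r ∈ Ico (0 : ℝ) 1) : fwd x r = (x, ⟨r, hr⟩) := by
  have h1 : ⌊r⌋₊ = 0 := Nat.floor_eq_zero.2 hr.2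
  have h2 : Int.fract r = r := Int.fract_eq_self.2 hr
  simp [fwd, h1, h2]

/-- The point of the 1-skeleton at a 0-cell. -/
def nodePt (x : φ.Node v) : φ.Cover v := fwd (.node x) 0

variable (φ v) in
/-- The 1-skeleton of `X̃`, as a graph. -/
abbrev skelGraph : OrientedGraph (φ.Node v) (φ.VEdge v ⊕ φ.Node v) := (φ.coverMap v).torusGraph

theorem isArcSystem_edgeArc :
    IsArcSystem (φ.skelGraph v) nodePt (edgeArc (φ := φ) (v := v)) where
  src i := by
    rcases i with c | x
    · exact congrArg (fun p => fwd p 0) (point_zero c)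
    · rfl
  tgt i := by
    rcases i with c | x
    · exact congrArg (fun p => fwd p 0) (point_one c)
    · exact fwd_one _
  nd_inj x y h := by simpa [nodePt, fwd_zero] using h
  inner_ne i s hs x := by
    rcases i with c | y
    · simp only [edgeArc, nodePt, fwd_zero, ne_eq, Prod.mk.injEq, and_true]
      exact isArcSystem_point.inner_ne c s hs x
    · simp only [edgeArc, nodePt]
      rw [fwd_zero, fwd_of_lt _ ⟨hs.1.le, hs.2⟩]
      intro h
      have := congrArg (fun p => p.2.1) h
      exact hs.1.ne' this
  inner_inj i j s hs t ht h := by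
    rcases i with c | x <;> rcases j with d | y
    · simp only [edgeArc, fwd_zero, Prod.mk.injEq, and_true] at h
      obtain ⟨rfl, h2⟩ := isArcSystem_point.inner_inj c d s hs t ht h
      exact ⟨rfl, h2⟩
    · simp only [edgeArc] at h
      rw [fwd_zero, fwd_of_lt _ ⟨ht.1.le, ht.2⟩] at h
      have := congrArg (fun p => p.2.1) h
      exact absurd this ht.1.ne
    · simp only [edgeArc] at h
      rw [fwd_zero, fwd_of_lt _ ⟨hs.1.le, hs.2⟩] at h
      have := congrArg (fun p => p.2.1) h
      exact absurd this hs.1.ne'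
    · simp only [edgeArc] at h
      rw [fwd_of_lt _ ⟨hs.1.le, hs.2⟩, fwd_of_lt _ ⟨ht.1.le, ht.2⟩] at h
      simp only [Prod.mk.injEq, VPoint.node.injEq] at h
      exact ⟨by rw [h.1], congrArg Subtype.val h.2⟩

theorem edgeLength_pos {wt : E → ℝ} (hwt : ∀ e, 0 < wt e) (i : φ.VEdge v ⊕ φ.Node v) :
    0 < edgeLength wt i := by
  rcases i with c | x
  · exact hwt c.1
  · exact one_pos

theorem finite_edgeLength [Finite E] (wt : E → ℝ) :
    (range (edgeLength wt : φ.VEdge v ⊕ φ.Node v → ℝ)).Finite := by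
  refine ((Set.finite_range wt).union (finite_singleton 1)).subset ?_
  rintro _ ⟨c | x, rfl⟩
  · exact Or.inl ⟨c.1, rfl⟩
  · exact Or.inr rfl

theorem edgeArc_mem (i : φ.VEdge v ⊕ φ.Node v) {u : ℝ} (hu : u ∈ Icc (0 : ℝ) 1) :
    edgeArc i u ∈ φ.oneSkeleton v := by
  rcases i with c | x
  · exact Or.inl (mem_iUnion.2 ⟨c, u, hu, rfl⟩)
  · exact Or.inr (mem_iUnion.2 ⟨x, u, hu, rfl⟩)

theorem exists_edgeArc {p : φ.Cover v} (hp : p ∈ φ.oneSkeleton v) :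
    ∃ i, ∃ u ∈ Icc (0 : ℝ) 1, p = edgeArc i u := by
  rcases hp with hp | hp
  · obtain ⟨c, u, hu, rfl⟩ := mem_iUnion.1 hp
    exact ⟨.inl c, u, hu, rfl⟩
  · obtain ⟨c, u, hu, rfl⟩ := mem_iUnion.1 hp
    exact ⟨.inr c, u, hu, rfl⟩

theorem skel_init (a : φ.VEdge v × Bool) :
    (φ.skelGraph v).init (Sum.inl a.1, a.2) = (φ.coverGraph v).init a := by
  rcases a with ⟨c, _ | _⟩ <;> rfl

theorem skel_term (a : φ.VEdge v × Bool) :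
    (φ.skelGraph v).term (Sum.inl a.1, a.2) = (φ.coverGraph v).term a := by
  rcases a with ⟨c, _ | _⟩ <;> rfl

/-- The lift of an edge of the 1-skeleton of `X` that starts at a given 0-cell. -/
theorem exists_skel_step (a : (E ⊕ V) × Bool) (x : φ.Over v (φ.torusGraph.init a)) :
    ∃ b, (φ.skelGraph v).init b = ⟨_, x⟩ ∧ (φ.skelGraph v).term b = ⟨_, Over.step a x⟩ := by
  rcases a with ⟨e | w, _ | _⟩
  · exact ⟨(.inl ⟨e, Over.step (φ := φ) (v := v) (Sum.inl e, false) x⟩, false),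
      congrArg (Sigma.mk _) (step_step_false e x), rfl⟩
  · exact ⟨(.inl ⟨e, x⟩, true), rfl, rfl⟩
  · exact ⟨(.inr ⟨w, Over.step (φ := φ) (v := v) (Sum.inr w, false) x⟩, false),
      congrArg (Sigma.mk _) (step_step_horiz w x), rfl⟩
  · exact ⟨(.inr ⟨w, x⟩, true), rfl, rfl⟩

theorem exists_skel_path (y : φ.Node v) : ∃ l,
    (φ.skelGraph v).IsPath ⟨v, Quot.mk _ ⟨[], rfl⟩⟩ l y := by
  obtain ⟨w, y⟩ := y
  induction y using Quot.ind with
  | mk p =>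
    obtain ⟨p, hp⟩ := p
    induction p using List.reverseRecOn generalizing w with
    | nil => obtain rfl : v = w := hp; exact ⟨[], rfl⟩
    | append_singleton p a ih =>
      obtain ⟨z, h1, rfl, rfl⟩ := isPath_append.1 hp
      obtain ⟨l, hl⟩ := ih _ h1
      obtain ⟨b, hb1, hb2⟩ := exists_skel_step a (Quot.mk _ ⟨p, h1⟩)
      exact ⟨l ++ [b], OrientedGraph.IsPath.append _ hl ⟨hb1, hb2⟩⟩

variable {wt : E → ℝ}

/-- Connectedness of the 1-skeleton, by lifting paths from the base point. It guarantees that its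
path metric is an infimum over a nonempty set. -/
theorem skel_chain : ∀ p ∈ φ.oneSkeleton v, ∀ q ∈ φ.oneSkeleton v,
    ∃ a, ChainLength edgeArc (edgeLength wt) (φ.oneSkeleton v) p q a := by
  have key : ∀ p ∈ φ.oneSkeleton v, ∃ a, ChainLength edgeArc (edgeLength wt) (φ.oneSkeleton v)
      (nodePt ⟨v, Quot.mk _ ⟨[], rfl⟩⟩) p a := by
    intro p hp
    obtain ⟨i, u, hu, rfl⟩ := exists_edgeArc hp
    obtain ⟨l, hl⟩ := exists_skel_path ((φ.skelGraph v).src i)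
    have h1 := isArcSystem_edgeArc.chain_of_path (wt := edgeLength wt) (S := φ.oneSkeleton v) hl
      fun e _ u hu => edgeArc_mem e.1 hu
    have h2 := ChainLength.single (arc := edgeArc) (wt := edgeLength wt) (S := φ.oneSkeleton v) (i := i)
      (s := 0) (t := u) ⟨le_rfl, zero_le_one⟩ hu fun u hu => edgeArc_mem i hu
    rw [isArcSystem_edgeArc.src] at h2
    exact ⟨_, h1.trans h2⟩
  intro p hp q hq
  obtain ⟨a, ha⟩ := key p hp
  obtain ⟨b, hb⟩ := key q hq
  exact ⟨_, ha.symm.trans hb⟩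

variable (φ v) in
/-- The 1-skeleton of `X̃` as a type; `wt` determines its metric. -/
structure Skel (wt : E → ℝ) where
  pt : φ.Cover v
  mem : pt ∈ φ.oneSkeleton v

/-- The metric of the 1-skeleton. -/
abbrev skelMetric [Finite E] (hwt : ∀ e, 0 < wt e) : PseudoMetricSpace (φ.Skel v wt) where
  dist p q := pathDist edgeArc (edgeLength wt) (φ.oneSkeleton v) p.pt q.pt
  dist_self p := pathDist_self (edgeLength_pos hwt) _
  dist_comm p q := pathDist_comm _ _
  dist_triangle p q r := by
    obtain ⟨a, ha⟩ := skel_chain p.1 p.2 q.1 q.2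
    obtain ⟨b, hb⟩ := skel_chain q.1 q.2 r.1 r.2
    exact isArcSystem_edgeArc.pathDist_triangle (edgeLength_pos hwt) (finite_edgeLength wt) ha hb

/-- Height, as a real function. -/
def coverHeight (p : φ.Cover v) : ℝ := p.1.height + p.2.1

theorem coverHeight_fwd (x : φ.VPoint v) {s : ℝ} (hs : 0 ≤ s) :
    coverHeight (fwd x s) = x.height + s := by
  simp only [coverHeight, fwd, height_iterate]
  push_cast
  have h1 := Int.floor_add_fract s
  rw [← natCast_floor_eq_intCast_floor hs] at h1
  linarith

theorem abs_coverHeight_edgeArc (hwt : ∀ e, 0 < wt e) (i : φ.VEdge v ⊕ φ.Node v) :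
    ∀ s ∈ Icc (0 : ℝ) 1, ∀ t ∈ Icc (0 : ℝ) 1,
    |coverHeight (edgeArc i s) - coverHeight (edgeArc i t)| ≤ |s - t| * edgeLength wt i := by
  intro s hs t ht
  rcases i with c | x
  · simp only [edgeArc, coverHeight_fwd _ le_rfl, height_point, sub_self, abs_zero]
    exact mul_nonneg (abs_nonneg _) (edgeLength_pos hwt _).le
  · simp only [edgeArc, coverHeight_fwd _ hs.1, coverHeight_fwd _ ht.1, edgeLength, mul_one]
    simp

theorem abs_coverHeight_le (hwt : ∀ e, 0 < wt e) {p q : φ.Cover v} (hp : p ∈ φ.oneSkeleton v)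
    (hq : q ∈ φ.oneSkeleton v) : |coverHeight p - coverHeight q| ≤
      pathDist edgeArc (edgeLength wt) (φ.oneSkeleton v) p q := by
  obtain ⟨a, ha⟩ := skel_chain p hp q hq
  exact le_pathDist (abs_coverHeight_edgeArc hwt) ha

theorem Skel.pt_injective : Function.Injective (Skel.pt : φ.Skel v wt → φ.Cover v) := by
  rintro ⟨p, hp⟩ ⟨q, hq⟩ h
  obtain rfl : p = q := h
  rfl

theorem IsGeodesicSegment.subset {x y : φ.Cover v} {A : Set (φ.Cover v)} {S : Set (φ.Cover v)}
    (h : IsGeodesicSegment edgeArc (edgeLength wt) S x y A) : A ⊆ S := by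
  obtain ⟨l, c, hl, ⟨hc, -⟩, -, -, rfl⟩ := h
  rintro _ ⟨t, ht, rfl⟩
  exact hc t ht

theorem geodSeg_image [Finite E] (hwt : ∀ e, 0 < wt e) {x y : φ.Skel v wt} {A : Set (φ.Skel v wt)}
    (h : @GeodSeg _ (skelMetric hwt) x y A) :
    IsGeodesicSegment edgeArc (edgeLength wt) (φ.oneSkeleton v) x.pt y.pt (Skel.pt '' A) := by
  obtain ⟨l, c, hl, hc, rfl, rfl, rfl⟩ := h
  exact ⟨l, fun t => (c t).pt, hl, ⟨fun t _ => (c t).mem, hc⟩, rfl, rfl, image_image _ _ _⟩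

theorem geodSeg_preimage [Finite E] (hwt : ∀ e, 0 < wt e) {x y : φ.Skel v wt} {A : Set (φ.Cover v)}
    (h : IsGeodesicSegment edgeArc (edgeLength wt) (φ.oneSkeleton v) x.pt y.pt A) :
    @GeodSeg _ (skelMetric hwt) x y (Skel.pt ⁻¹' A) := by
  obtain ⟨l, c, hl, ⟨hc, hd⟩, h0, h1, rfl⟩ := h
  have hc' : ∀ t ∈ Icc 0 l, (if h : t ∈ Icc 0 l then (⟨c t, hc t h⟩ : φ.Skel v wt) else x).pt = c t :=
    fun t ht => by rw [dif_pos ht]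
  refine ⟨l, fun t => if h : t ∈ Icc 0 l then ⟨c t, hc t h⟩ else x, hl, fun s hs t ht => ?_, ?_, ?_, ?_⟩
  · refine Eq.trans ?_ (hd s hs t ht)
    exact congrArg₂ (pathDist edgeArc (edgeLength wt) (φ.oneSkeleton v)) (hc' s hs) (hc' t ht)
  · exact Skel.pt_injective ((hc' 0 ⟨le_rfl, hl⟩).trans h0)
  · exact Skel.pt_injective ((hc' l ⟨hl, le_rfl⟩).trans h1)
  · ext p
    constructor
    · rintro ⟨t, ht, htp⟩
      exact ⟨t, ht, Skel.pt_injective ((hc' t ht).trans htp)⟩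
    · rintro ⟨t, ht, rfl⟩
      exact ⟨t, ht, (hc' t ht).symm⟩

theorem isHyp_skel [Finite E] (hwt : ∀ e, 0 < wt e) {δ : ℝ} (h : φ.CoverHyperbolic v wt δ) :
    @IsHyp (φ.Skel v wt) (skelMetric hwt) δ := by
  let _ := skelMetric (φ := φ) (v := v) hwt
  refine ⟨fun x y => ?_, fun x y z A B C hA hB hC a ha => ?_⟩
  · obtain ⟨r, hr⟩ := skel_chain (wt := wt) x.pt x.mem y.pt y.mem
    obtain ⟨A, hA⟩ := isArcSystem_edgeArc.exists_geodesic (edgeLength_pos hwt) (finite_edgeLength wt)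
      x.mem hr
    exact ⟨_, geodSeg_preimage hwt hA⟩
  · obtain ⟨_, hb, hd⟩ := h x.pt y.pt z.pt _ _ _ (geodSeg_image hwt hA) (geodSeg_image hwt hB)
      (geodSeg_image hwt hC) a.pt (mem_image_of_mem _ ha)
    rw [← image_union] at hb
    obtain ⟨b, hb, rfl⟩ := hb
    exact ⟨b, hb, hd⟩

end GraphMap

namespace GraphMap

variable {V E : Type*} {Γ : OrientedGraph V E} {φ : GraphMap Γ} {v : V} {wt : E → ℝ}

/-! ### Ladders -/

/-- The cell whose interior contains the interior of the midsegment that starts at a given point. -/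
def stripCell : φ.VPoint v → φ.Cell v
  | .node x => .horiz x
  | .inner c _ => .two c

theorem stripCell_point (c : φ.VEdge v) {ξ : ℝ} (hξ : ξ ∈ Ioo (0 : ℝ) 1) :
    stripCell (c.point ξ) = .two c := by
  rw [point_inner c hξ]; rfl

theorem fwd_mem_stripCell (p : φ.VPoint v) {r : ℝ} (hr : r ∈ Icc (0 : ℝ) 1) :
    fwd p r ∈ (stripCell p).closed := by
  rcases VPoint.cases_point p with ⟨x, rfl⟩ | ⟨c, ξ, hξ, rfl⟩
  · exact ⟨r, hr, rfl⟩
  · rw [stripCell_point c hξ]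
    exact ⟨ξ, ⟨hξ.1.le, hξ.2.le⟩, r, hr, rfl⟩

theorem horiz_subset_two {c : φ.VEdge v} {s : ℝ} (hs : s ∈ Icc (0 : ℝ) 1) {x : φ.Node v}
    (h : c.point s = .node x) : (Cell.horiz x).closed ⊆ (Cell.two c).closed := by
  rintro _ ⟨r, hr, rfl⟩
  exact ⟨s, hs, r, hr, by rw [h]⟩

theorem fwd_eq_half {p q : φ.VPoint v} {r : ℝ} (hr : r ∈ Icc (0 : ℝ) 1)
    (h : fwd p (1 / 2) = fwd q r) : q = p := by
  rw [fwd_of_lt p (r := 1 / 2) (by norm_num)] at h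
  rcases hr.2.eq_or_lt with rfl | hr1
  · rw [fwd_one, fwd_zero] at h
    have := congrArg (fun p => p.2.1) h
    norm_num at this
  · rw [fwd_of_lt q ⟨hr.1, hr1⟩] at h
    exact (congrArg Prod.fst h).symm

/-- The midpoint of a midsegment lies in no closed cell other than its own strip cell, except for a
horizontal edge, which also lies on the sides of 2-cells containing it. -/
theorem stripCell_subset {p : φ.VPoint v} {A : Set (φ.Cover v)} (hA : IsSubcomplex A)
    (h : fwd p (1 / 2) ∈ A) : (stripCell p).closed ⊆ A := by
  obtain ⟨C, rfl⟩ := hA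
  obtain ⟨k, hk, hp⟩ := mem_iUnion₂.1 h
  refine Subset.trans ?_ (subset_biUnion_of_mem (u := fun k => Cell.closed k) hk)
  cases k with
  | zero x =>
    have h1 : fwd p (1 / 2) = fwd (.node x) 0 := hp
    rw [fwd_zero, fwd_of_lt p (r := 1 / 2) (by norm_num)] at h1
    have := congrArg (fun p => p.2.1) h1
    norm_num at this
  | vert c =>
    obtain ⟨s, -, h1⟩ := hp
    rw [fwd_zero, fwd_of_lt p (r := 1 / 2) (by norm_num)] at h1
    have := congrArg (fun p => p.2.1) h1
    norm_num at this
  | horiz x =>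
    obtain ⟨r, hr, h1⟩ := hp
    obtain rfl := fwd_eq_half hr h1
    exact Subset.rfl
  | two c =>
    obtain ⟨s, hs, r, hr, h1⟩ := hp
    obtain rfl := fwd_eq_half hr h1
    rcases mem_cases hs with hs' | rfl | rfl
    · rw [stripCell_point c hs']
    · rw [point_zero]; exact horiz_subset_two hs (point_zero c)
    · rw [point_one]; exact horiz_subset_two hs (point_one c)

theorem stripCell_subset_hull {M i : ℕ} (hi : i < M) (x : φ.VPoint v) :
    (stripCell (flow^[i] x)).closed ⊆ hull (forwardPath M x) := by
  refine subset_sInter fun A hA => stripCell_subset hA.1 (hA.2 ⟨i + 1 / 2, ⟨by positivity, ?_⟩, ?_⟩)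
  · have : (i : ℝ) + 1 ≤ M := by exact_mod_cast hi
    linarith
  · exact fwd_add_nat x i (by norm_num)

theorem hull_subset (M : ℕ) (x : φ.VPoint v) :
    hull (forwardPath M x) ⊆ ⋃ i ∈ {i | i ≤ M}, (stripCell (flow^[i] x)).closed := by
  -- The index i = M is included because the end of the forward path starts the next strip. The
  -- superfluous strip does no harm in distance estimates.
  refine sInter_subset_of_mem ⟨⟨(fun i => stripCell (flow^[i] x)) '' {i | i ≤ M}, ?_⟩, ?_⟩
  · rw [biUnion_image]
  · rintro _ ⟨s, hs, rfl⟩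
    refine mem_iUnion₂.2 ⟨⌊s⌋₊, Nat.floor_le_of_le hs.2, ?_⟩
    have h1 := fwd_add_nat x ⌊s⌋₊ (r := s - ⌊s⌋₊) (by linarith [Nat.floor_le hs.1])
    rw [add_sub_cancel] at h1
    rw [h1]
    exact fwd_mem_stripCell _ ⟨by linarith [Nat.floor_le hs.1], by linarith [Nat.lt_floor_add_one s]⟩

theorem orbit_mem (p : φ.VPoint v) : fwd p 0 ∈ φ.oneSkeleton v := by
  rcases VPoint.cases_point p with ⟨x, rfl⟩ | ⟨c, ξ, hξ, rfl⟩
  · exact edgeArc_mem (.inr x) (u := 0) ⟨le_rfl, zero_le_one⟩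
  · exact edgeArc_mem (.inl c) ⟨hξ.1.le, hξ.2.le⟩

theorem mem_oneSkeleton {p : φ.VPoint v} {r : ℝ} (hr : r ∈ Ico (0 : ℝ) 1)
    (h : fwd p r ∈ φ.oneSkeleton v) : r = 0 ∨ ∃ x, p = .node x := by
  obtain ⟨i, u, hu, hi⟩ := exists_edgeArc h
  rw [fwd_of_lt p hr] at hi
  rcases i with c | x
  · left
    simp only [edgeArc, fwd_zero] at hi
    exact congrArg (fun p => p.2.1) hi
  · rcases hu.2.eq_or_lt with rfl | hu1
    · left
      simp only [edgeArc, fwd_one, fwd_zero] at hi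
      exact congrArg (fun p => p.2.1) hi
    · right
      simp only [edgeArc] at hi
      rw [fwd_of_lt _ ⟨hu.1, hu1⟩] at hi
      exact ⟨x, congrArg Prod.fst hi⟩

theorem Trav.exists_time {R : Prop} {f : ℝ → φ.VPoint v} {a b : ℝ} {x y : φ.Node v}
    {l : List (φ.VEdge v × Bool)} (h : Trav R f a b x l y) {e : φ.VEdge v × Bool} (he : e ∈ l) {t : ℝ}
    (ht : t ∈ Icc (0 : ℝ) 1) : ∃ u ∈ Icc a b, f u = oarc VEdge.point e t := by
  induction h with
  | rest a b x h hr hf => simp at he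
  | edge a b e' h hf =>
    obtain rfl : e = e' := by simpa using he
    have hba : 0 < b - a := by linarith
    have hu : a + (b - a) * t ∈ Icc a b := by constructor <;> nlinarith [ht.1, ht.2]
    refine ⟨a + (b - a) * t, hu, (hf _ hu).trans ?_⟩
    rw [add_sub_cancel_left, mul_div_cancel_left₀ _ hba.ne']
  | trans a b c x y z p q h1 h2 ih1 ih2 =>
    rcases List.mem_append.1 he with he | he
    · obtain ⟨u, hu, h⟩ := ih1 he
      exact ⟨u, ⟨hu.1, hu.2.trans h2.le⟩, h⟩
    · obtain ⟨u, hu, h⟩ := ih2 he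
      exact ⟨u, ⟨h1.le.trans hu.1, hu.2⟩, h⟩

/-- The length of an edge path of `Ṽ`. -/
def vertLen (wt : E → ℝ) (l : List (φ.VEdge v × Bool)) : ℝ := (l.map fun e => wt e.1.1).sum

theorem vertLen_nonneg (hwt : ∀ e, 0 < wt e) (l : List (φ.VEdge v × Bool)) : 0 ≤ vertLen wt l :=
  pathLen_nonneg (wt := fun c : φ.VEdge v => wt c.1) (fun c => hwt c.1) l

theorem Trav.chain (hwt : ∀ e, 0 < wt e) {R : Prop} {f : ℝ → φ.VPoint v} {a b : ℝ} {x y : φ.Node v}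
    {l : List (φ.VEdge v × Bool)} (h : Trav R f a b x l y) {N : Set (φ.Cover v)}
    (hN : ∀ e ∈ l, ∀ u ∈ Icc (0 : ℝ) 1, fwd (e.1.point u) 0 ∈ N) : ∀ u ∈ Icc a b,
    ∃ r ≤ vertLen wt l, ChainLength edgeArc (edgeLength wt) N (nodePt x) (fwd (f u) 0) r := by
  induction h with
  | rest a b x h hr hf => intro u hu; exact ⟨0, by simp [vertLen], by rw [hf u hu]; exact .nil _⟩
  | edge a b e h hf =>
    intro u hu
    have hba : 0 < b - a := by linarith
    have hI : (u - a) / (b - a) ∈ Icc (0 : ℝ) 1 :=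
      ⟨div_nonneg (by linarith [hu.1]) hba.le, (div_le_one hba).2 (by linarith [hu.2])⟩
    have hx : nodePt ((φ.coverGraph v).init e) = edgeArc (.inl e.1) (cond e.2 0 1) := by
      have := isArcSystem_point.oarc_zero e
      unfold oarc at this
      rw [nodePt, ← this]
      cases e.2 <;> simp [edgeArc]
    rw [hf u hu, hx]
    have hsgn : ∀ t ∈ Icc (0 : ℝ) 1, cond e.2 t (1 - t) ∈ Icc (0 : ℝ) 1 := by
      intro t ht
      cases e.2
      · exact ⟨by simp only [cond_false]; linarith [ht.2], by simp only [cond_false]; linarith [ht.1]⟩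
      · exact ht
    refine ⟨_, ?_, ChainLength.single (i := Sum.inl e.1) (s := cond e.2 0 1)
      (t := cond e.2 ((u - a) / (b - a)) (1 - (u - a) / (b - a))) ?_ (hsgn _ hI)
      fun w hw => hN e (by simp) w hw⟩
    · have h1 : |cond e.2 0 1 - cond e.2 ((u - a) / (b - a)) (1 - (u - a) / (b - a))| ≤ 1 := by
        rw [abs_le]
        cases e.2
        · simp only [cond_false]; constructor <;> linarith [hI.1, hI.2]
        · simp only [cond_true]; constructor <;> linarith [hI.1, hI.2]
      have h2 : edgeLength wt (Sum.inl e.1 : φ.VEdge v ⊕ φ.Node v) = vertLen wt [e] := by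
        simp [edgeLength, vertLen]
      rw [h2]
      exact mul_le_of_le_one_left (vertLen_nonneg hwt _) h1
    · cases e.2 <;> simp
  | trans a b c x y z p q h1 h2 ih1 ih2 =>
    intro u hu
    have hpq : vertLen wt (p ++ q) = vertLen wt p + vertLen wt q := by simp [vertLen]
    rw [hpq]
    rcases le_total u b with h | h
    · obtain ⟨r, hr, h3⟩ := ih1 (fun e he => hN e (List.mem_append_left _ he)) u ⟨hu.1, h⟩
      exact ⟨r, by linarith [vertLen_nonneg hwt q], h3⟩
    · obtain ⟨r, hr, h3⟩ := ih1 (fun e he => hN e (List.mem_append_left _ he)) b ⟨h1.le, le_rfl⟩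
      obtain ⟨r', hr', h4⟩ := ih2 (fun e he => hN e (List.mem_append_right _ he)) u ⟨h, hu.2⟩
      rw [isArcSystem_point.traverses_right h1] at h3
      exact ⟨r + r', by linarith, h3.trans h4⟩

theorem exists_bound [Finite E] (φ : GraphMap Γ) (v : V) (wt : E → ℝ) : ∃ C : ℝ, 0 ≤ C ∧ (∀ e, wt e ≤ C) ∧
    ∀ c : φ.VEdge v, vertLen wt ((φ.coverMap v).edgePath c) ≤ C := by
  obtain ⟨C₁, h1⟩ := (Set.finite_range wt).bddAbove
  obtain ⟨C₂, h2⟩ := (Set.finite_range fun e => ((φ.edgePath e).map fun a => wt a.1).sum).bddAbove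
  refine ⟨max 0 (max C₁ C₂), le_max_left _ _, fun e => ?_, fun c => ?_⟩
  · exact (h1 ⟨e, rfl⟩).trans ((le_max_left _ _).trans (le_max_right _ _))
  · have h3 : vertLen wt ((φ.coverMap v).edgePath c) = ((φ.edgePath c.1).map fun a => wt a.1).sum := by
      rw [← map_proj_edgePath c, List.map_map]; rfl
    rw [h3]
    exact (h2 ⟨c.1, rfl⟩).trans ((le_max_right _ _).trans (le_max_right _ _))

/-- Go back along the edge to its tail, cross the horizontal edge, and follow the image path to the
forward image. All of this lies on the boundary of one 2-cell, so the chain stays inside any ladder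
containing that cell. -/
theorem step_chain [Finite E] (φ : GraphMap Γ) (v : V) (hwt : ∀ e, 0 < wt e) : ∃ C : ℝ, 0 ≤ C ∧
    ∀ (p : φ.VPoint v) (N : Set (φ.Cover v)), (stripCell p).closed ∩ φ.oneSkeleton v ⊆ N →
      ∃ r ≤ C, ChainLength edgeArc (edgeLength wt) N (fwd p 0) (fwd (flow p) 0) r := by
  obtain ⟨C, hC, hC1, hC2⟩ := exists_bound φ v wt
  refine ⟨C + 1 + C, by linarith, fun p N hN => ?_⟩
  rcases VPoint.cases_point p with ⟨x, rfl⟩ | ⟨c, ξ, hξ, rfl⟩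
  · have h1 := ChainLength.single (arc := edgeArc) (wt := edgeLength wt) (S := N) (i := .inr x)
      (s := 0) (t := 1) (by simp) (by simp) fun u hu => hN ⟨⟨u, hu, rfl⟩, edgeArc_mem _ hu⟩
    simp only [edgeArc, fwd_one] at h1
    exact ⟨_, by simp [edgeLength]; linarith, h1⟩
  · rw [stripCell_point c hξ] at hN
    have hξ' : ξ ∈ Icc (0 : ℝ) 1 := ⟨hξ.1.le, hξ.2.le⟩
    have h1 := ChainLength.single (arc := edgeArc) (wt := edgeLength wt) (S := N) (i := .inl c)
      (s := ξ) (t := 0) hξ' (by simp) fun u hu =>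
        hN ⟨⟨u, hu, 0, by simp, rfl⟩, edgeArc_mem _ hu⟩
    have h2 := ChainLength.single (arc := edgeArc) (wt := edgeLength wt) (S := N) (i := .inr c.tail)
      (s := 0) (t := 1) (by simp) (by simp) fun u hu =>
        hN ⟨⟨0, by simp, u, hu, by rw [point_zero]; rfl⟩, edgeArc_mem _ hu⟩
    obtain ⟨r, hr, h3⟩ := (trav_flow_edge c).chain hwt (N := N) (fun e he u hu => by
      have hcond : cond e.2 u (1 - u) ∈ Icc (0 : ℝ) 1 := by
        cases e.2
        · exact ⟨by simp only [cond_false]; linarith [hu.2], by simp only [cond_false]; linarith [hu.1]⟩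
        · exact hu
      obtain ⟨s, hs, hse⟩ := (trav_flow_edge c).exists_time he hcond
      have he' : oarc VEdge.point e (cond e.2 u (1 - u)) = e.1.point u := by
        unfold oarc
        cases e.2 <;> simp
      rw [he'] at hse
      refine hN ⟨⟨s, hs, 1, by simp, ?_⟩, edgeArc_mem (.inl e.1) hu⟩
      rw [fwd_one, hse]) ξ hξ'
    have e1 : edgeArc (.inl c) 0 = edgeArc (.inr c.tail) 0 := by
      simp only [edgeArc, point_zero]
    have e2 : edgeArc (.inr c.tail) 1 = nodePt c.tail.next := fwd_one _
    rw [← e1, e2] at h2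
    refine ⟨_, ?_, (h1.trans h2).trans h3⟩
    have e3 : |ξ - 0| * edgeLength wt (Sum.inl c : φ.VEdge v ⊕ φ.Node v) ≤ C := by
      rw [sub_zero, abs_of_nonneg hξ'.1]
      exact (mul_le_of_le_one_left (hwt _).le hξ'.2).trans (hC1 _)
    have e4 : |(0 : ℝ) - 1| * edgeLength wt (Sum.inr c.tail : φ.VEdge v ⊕ φ.Node v) = 1 := by
      simp [edgeLength]
    linarith [hC2 c]

/-- A point of the 1-skeleton in a closed 2-cell descends along its own midsegment to the bottom
edge, at bounded cost, and then moves along that edge. Thus orbits have bounded steps and ladders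
stay uniformly close to orbits. -/
theorem strip_chain [Finite E] (φ : GraphMap Γ) (v : V) (hwt : ∀ e, 0 < wt e) : ∃ C : ℝ, 0 ≤ C ∧
    (∀ p : φ.VPoint v, pathDist edgeArc (edgeLength wt) (φ.oneSkeleton v) (fwd p 0)
      (fwd (flow p) 0) ≤ C) ∧
    ∀ (p : φ.VPoint v), ∀ z ∈ (stripCell p).closed ∩ φ.oneSkeleton v,
      pathDist edgeArc (edgeLength wt) (φ.oneSkeleton v) z (fwd p 0) ≤ C := by
  obtain ⟨C₀, hC₀, hC1, hC2⟩ := exists_bound φ v wt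
  obtain ⟨C, hC, h⟩ := step_chain φ v hwt
  have hw := edgeLength_pos (φ := φ) (v := v) hwt
  have hstep : ∀ p : φ.VPoint v, ∃ r ≤ C, ChainLength edgeArc (edgeLength wt) (φ.oneSkeleton v)
      (fwd p 0) (fwd (flow p) 0) r := fun p => h p _ inter_subset_right
  have hrung : ∀ (p : φ.VPoint v), ∀ r ∈ Icc (0 : ℝ) 1, fwd p r ∈ φ.oneSkeleton v → ∃ a ≤ C + 1,
      ChainLength edgeArc (edgeLength wt) (φ.oneSkeleton v) (fwd p r) (fwd p 0) a := by
    intro p r hr hp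
    rcases hr.2.eq_or_lt with rfl | hr1
    · obtain ⟨a, ha, h1⟩ := hstep p
      rw [fwd_one]
      exact ⟨a, by linarith, h1.symm⟩
    · rcases mem_oneSkeleton ⟨hr.1, hr1⟩ hp with rfl | ⟨x, rfl⟩
      · exact ⟨0, by linarith, .nil _⟩
      · refine ⟨_, ?_, ChainLength.single (i := .inr x) hr (by simp) fun u hu => edgeArc_mem _ hu⟩
        rw [sub_zero, abs_of_nonneg hr.1]
        simp only [edgeLength]; linarith
  refine ⟨C + 1 + C₀, by linarith, fun p => ?_, ?_⟩
  · obtain ⟨a, ha, h1⟩ := hstep p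
    exact (pathDist_le hw h1).trans (by linarith)
  · rintro p z ⟨hz, hz'⟩
    rcases VPoint.cases_point p with ⟨x, rfl⟩ | ⟨c, ξ, hξ, rfl⟩
    · obtain ⟨r, hr, rfl⟩ := hz
      obtain ⟨a, ha, h1⟩ := hrung _ r hr hz'
      exact (pathDist_le hw h1).trans (by linarith)
    · rw [stripCell_point c hξ] at hz
      obtain ⟨s, hs, r, hr, rfl⟩ := hz
      obtain ⟨a, ha, h1⟩ := hrung _ r hr hz'
      have hξ' : ξ ∈ Icc (0 : ℝ) 1 := ⟨hξ.1.le, hξ.2.le⟩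
      have h2 := ChainLength.single (arc := edgeArc) (wt := edgeLength wt) (S := φ.oneSkeleton v)
        (i := .inl c) hs hξ' fun u hu => edgeArc_mem _ hu
      have h3 : |s - ξ| * edgeLength wt (Sum.inl c : φ.VEdge v ⊕ φ.Node v) ≤ C₀ := by
        refine (mul_le_of_le_one_left (hwt _).le ?_).trans (hC1 c.1)
        rw [abs_le]; constructor <;> linarith [hs.1, hs.2, hξ.1, hξ.2]
      exact (pathDist_le hw (h1.trans h2)).trans (by linarith)

end GraphMap

namespace GraphMap

variable {V E : Type*} {Γ : OrientedGraph V E} {φ : GraphMap Γ} {v : V} {wt : E → ℝ} {δ : ℝ}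

/-! ### Forward paths are quasigeodesics -/

/-- The forward orbit of a point, in the 1-skeleton. -/
def orbit (wt : E → ℝ) (x : φ.VPoint v) (i : ℕ) : φ.Skel v wt := ⟨fwd (flow^[i] x) 0, orbit_mem _⟩

theorem pt_orbit (x : φ.VPoint v) (i : ℕ) : (orbit wt x i).pt = fwd x i := (fwd_natCast x i).symm

/-- This makes forward orbits accessible to the Morse lemma: height serves as a Busemann-like
function that no shortcut can outrun. -/
theorem isAscending_orbit [Finite E] (hwt : ∀ e, 0 < wt e) {C : ℝ}
    (hC : ∀ p : φ.VPoint v, pathDist edgeArc (edgeLength wt) (φ.oneSkeleton v) (fwd p 0)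
      (fwd (flow p) 0) ≤ C) (x : φ.VPoint v) :
    @IsAscending _ (skelMetric hwt) (fun p => coverHeight p.pt) C (orbit wt x) :=
  let _ := skelMetric (φ := φ) (v := v) hwt
  { lip := fun p q => abs_coverHeight_le hwt p.mem q.mem
    step := fun i => by
      have := hC (flow^[i] x)
      rw [← Function.iterate_succ_apply' flow] at this
      exact this
    up := fun i => by
      simp only [orbit, coverHeight_fwd _ le_rfl, height_iterate]
      push_cast; ring }

theorem orbit_mem_ladder {M i : ℕ} (hi : i ≤ M) (x : φ.VPoint v) :
    (orbit wt x i).pt ∈ ladder M x := by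
  refine ⟨?_, (orbit wt x i).mem⟩
  rw [pt_orbit]
  exact mem_sInter.2 fun A hA => hA.2 ⟨i, ⟨by positivity, by exact_mod_cast hi⟩, rfl⟩

theorem exists_near_orbit {C : ℝ}
    (hC : ∀ (p : φ.VPoint v), ∀ z ∈ (stripCell p).closed ∩ φ.oneSkeleton v,
      pathDist edgeArc (edgeLength wt) (φ.oneSkeleton v) z (fwd p 0) ≤ C) {M : ℕ} {x : φ.VPoint v}
    {z : φ.Cover v} (hz : z ∈ ladder M x) : ∃ i ≤ M,
      pathDist edgeArc (edgeLength wt) (φ.oneSkeleton v) z (orbit wt x i).pt ≤ C := by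
  obtain ⟨i, hi, h⟩ := mem_iUnion₂.1 (hull_subset M x hz.1)
  exact ⟨i, hi, hC _ z ⟨h, hz.2⟩⟩

/-- Points of a ladder are close to its orbit, so a geodesic between two of them joins
neighbourhoods of two orbit points. Stability keeps it near the orbit, which lies in the ladder. -/
theorem exists_laddersQuasiconvex [Finite E] (hwt : ∀ e, 0 < wt e) (hδ : 0 ≤ δ)
    (hhyp : φ.CoverHyperbolic v wt δ) : ∃ R : ℝ, 0 ≤ R ∧ φ.LaddersQuasiconvex v wt R := by
  obtain ⟨C, hC, hstep, hstrip⟩ := strip_chain φ v hwt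
  let _ := skelMetric (φ := φ) (v := v) hwt
  obtain ⟨R, hR, h⟩ := (isHyp_skel hwt hhyp).morse hδ C C hC
  refine ⟨R, hC.trans hR, fun M x p hp q hq A hA a ha => ?_⟩
  obtain ⟨i, hi, hpi⟩ := exists_near_orbit hstrip hp
  obtain ⟨j, hj, hqj⟩ := exists_near_orbit hstrip hq
  have haS := IsGeodesicSegment.subset hA ha
  have key : ∀ (p q : φ.Skel v wt) (A : Set (φ.Skel v wt)) (i j : ℕ), i ≤ j → j ≤ M →
      GeodSeg p q A → dist p (orbit wt x i) ≤ C → dist q (orbit wt x j) ≤ C →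
      ∀ a ∈ A, ∃ k ≤ M, dist a (orbit wt x k) ≤ R := by
    intro p q A i j hij hjM hA hp hq a ha
    obtain ⟨n, rfl⟩ := Nat.exists_eq_add_of_le hij
    obtain ⟨k, hk, hd⟩ := (h _ _ ((isAscending_orbit hwt hstep x).shift i) n p q A hA hp hq).1 a ha
    exact ⟨i + k, by omega, hd⟩
  have hA' := geodSeg_preimage hwt (x := ⟨p, hp.2⟩) (y := ⟨q, hq.2⟩) hA
  obtain ⟨k, hk, hd⟩ : ∃ k ≤ M, dist (⟨a, haS⟩ : φ.Skel v wt) (orbit wt x k) ≤ R := by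
    rcases le_total i j with hij | hij
    · exact key _ _ _ i j hij hj hA' hpi hqj _ ha
    · exact key _ _ _ j i hij hi hA'.symm hqj hpi _ ha
  exact ⟨_, orbit_mem_ladder hk x, hd⟩

theorem ladder_chain [Finite E] (hwt : ∀ e, 0 < wt e) (M : ℕ) (x : φ.VPoint v) :
    ∃ r, ChainLength edgeArc (edgeLength wt) (ladder M x) (fwd x 0) (fwd x M) r := by
  obtain ⟨C, -, h⟩ := step_chain φ v hwt
  have key : ∀ i ≤ M, ∃ r, ChainLength edgeArc (edgeLength wt) (ladder M x) (fwd x 0) (fwd x i) r := by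
    intro i
    induction i with
    | zero => intro _; exact ⟨0, by rw [Nat.cast_zero]; exact .nil _⟩
    | succ i ih =>
      intro hi
      obtain ⟨r, hr⟩ := ih (by omega)
      obtain ⟨s, -, hs⟩ := h (flow^[i] x) (ladder M x)
        (inter_subset_inter_left _ (stripCell_subset_hull (by omega) x))
      rw [← fwd_natCast, ← Function.iterate_succ_apply' flow, ← fwd_natCast] at hs
      exact ⟨_, hr.trans hs⟩
  exact key M le_rfl

/-- A geodesic of the ladder need not be a geodesic of the 1-skeleton, so stability does not apply
to it. It does stay near the orbit, and its height is still 1-Lipschitz, so it passes all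
intermediate heights and hence near every orbit point. -/
theorem exists_ladder_geodesic [Finite E] (hwt : ∀ e, 0 < wt e) : ∃ R : ℝ, 0 ≤ R ∧
    ∀ (M : ℕ) (x : φ.VPoint v), ∃ A, IsGeodesicSegment edgeArc (edgeLength wt) (ladder M x)
      (fwd x 0) (fwd x M) A ∧
      (∀ a ∈ A, ∃ j ≤ M, pathDist edgeArc (edgeLength wt) (φ.oneSkeleton v) a (orbit wt x j).pt ≤ R) ∧
      ∀ j ≤ M, ∃ a ∈ A, pathDist edgeArc (edgeLength wt) (φ.oneSkeleton v) (orbit wt x j).pt a ≤ R := by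
  obtain ⟨C, hC, hstep, hstrip⟩ := strip_chain φ v hwt
  let _ := skelMetric (φ := φ) (v := v) hwt
  refine ⟨C + C * C, by positivity, fun M x => ?_⟩
  obtain ⟨r, hr⟩ := ladder_chain hwt M x
  have h0 : fwd x 0 ∈ ladder M x := orbit_mem_ladder (wt := wt) (Nat.zero_le M) x
  obtain ⟨A, hA⟩ := isArcSystem_edgeArc.exists_geodesic (edgeLength_pos hwt) (finite_edgeLength wt)
    h0 hr
  refine ⟨A, hA, fun a ha => ?_, fun j hj => ?_⟩
  · obtain ⟨j, hj, h⟩ := exists_near_orbit hstrip (IsGeodesicSegment.subset hA ha)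
    exact ⟨j, hj, h.trans (by nlinarith)⟩
  · obtain ⟨l, c, hl, ⟨hc, hd⟩, hc0, hcl, rfl⟩ := hA
    have hc' : ∀ t ∈ Icc 0 l, (if h : t ∈ Icc 0 l then (⟨c t, (hc t h).2⟩ : φ.Skel v wt)
        else orbit wt x 0).pt = c t := fun t ht => by rw [dif_pos ht]
    set c' : ℝ → φ.Skel v wt := fun t => if h : t ∈ Icc 0 l then ⟨c t, (hc t h).2⟩ else orbit wt x 0
      with hcdef
    have hlip : ∀ s ∈ Icc 0 l, ∀ t ∈ Icc 0 l, |coverHeight (c s) - coverHeight (c t)| ≤ |s - t| := by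
      intro s hs t ht
      rcases eq_or_ne s t with rfl | hst
      · simp
      · have h1 := hd s hs t ht
        -- A positive distance cannot come from the default value 0 of an infimum over the empty
        -- set, so a chain in the ladder exists.
        have h2 : {r | ChainLength edgeArc (edgeLength wt) (ladder M x) (c s) (c t) r}.Nonempty := by
          by_contra hne
          rw [not_nonempty_iff_eq_empty] at hne
          rw [pathDist, hne, Real.sInf_empty] at h1
          exact hst (sub_eq_zero.1 (abs_eq_zero.1 h1.symm))
        obtain ⟨r, hr⟩ := h2
        rw [← h1]
        exact le_pathDist (abs_coverHeight_edgeArc hwt) hr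
    have hcont : ContinuousOn (fun t => coverHeight (c' t).pt) (Icc 0 l) := by
      have : LipschitzOnWith 1 (fun t => coverHeight (c' t).pt) (Icc 0 l) := by
        refine LipschitzOnWith.of_dist_le_mul fun s hs t ht => ?_
        rw [Real.dist_eq, Real.dist_eq, NNReal.coe_one, one_mul]
        have := hlip s hs t ht
        rwa [← hc' s hs, ← hc' t ht] at this
      exact this.continuousOn
    obtain ⟨t, ht, h⟩ := (isAscending_orbit hwt hstep x).near_of_curve hl hcont (n := M) (R := C)
      (by
        have : c' 0 = orbit wt x 0 := Skel.pt_injective ((hc' 0 ⟨le_rfl, hl⟩).trans hc0)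
        rw [this, dist_self]; exact hC)
      (by
        have : c' l = orbit wt x M := Skel.pt_injective ((hc' l ⟨hl, le_rfl⟩).trans (hcl.trans (pt_orbit x M).symm))
        rw [this, dist_self]; exact hC)
      (fun t ht => by
        obtain ⟨j, hj, h⟩ := exists_near_orbit hstrip (hc t ht)
        rw [← hc' t ht] at h
        exact ⟨j, hj, h⟩) hj
    refine ⟨c t, mem_image_of_mem _ ht, ?_⟩
    rw [← hc' t ht]
    exact h

/-! ### Deviating geodesics -/

theorem exists_near_orbit_zero [Finite E] (hwt : ∀ e, 0 < wt e) : ∃ C : ℝ, 0 ≤ C ∧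
    ∀ p ∈ φ.oneSkeleton v, pathDist edgeArc (edgeLength wt) (φ.oneSkeleton v) p
      (orbit wt p.1 0).pt ≤ C := by
  obtain ⟨C, hC, -, hstrip⟩ := strip_chain φ v hwt
  refine ⟨C, hC, fun p hp => hstrip p.1 p ⟨?_, hp⟩⟩
  have h1 := fwd_mem_stripCell p.1 (r := p.2.1) ⟨p.2.2.1, p.2.2.2.le⟩
  rwa [fwd_of_lt _ p.2.2] at h1

/-- For a deviating geodesic, the forward orbits of two of its points that are far apart along the
geodesic neither merge nor stay at bounded distance from each other. -/
theorem exists_deviation [Finite E] (hwt : ∀ e, 0 < wt e) (hδ : 0 ≤ δ)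
    (hhyp : φ.CoverHyperbolic v wt δ) : ∃ R : ℝ, 0 ≤ R ∧ ∀ lam ≥ R, ∀ M : ℕ, ∃ B : ℝ, 0 < B ∧
    ∀ (γ : ℝ → φ.Cover v) (I : Set ℝ) (ξ : ℝ), I.OrdConnected → 0 ≤ ξ →
      IsGeodesicOn edgeArc (edgeLength wt) (φ.oneSkeleton v) γ I →
      ¬ IsLadderlike wt (2 * δ + lam + ξ) M γ I →
      (∀ s ∈ I, ∀ t ∈ I, s + B ≤ t → ∀ i j, flow^[i] (γ s).1 ≠ flow^[j] (γ t).1) ∧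
      ∀ s₀ ∈ I, ∀ t₀ ∈ I, ∀ D : ℝ, ∃ h₀ : ℝ, ∀ s t, s₀ ≤ s → s + B ≤ t → t ≤ t₀ → ∀ i j : ℕ,
        h₀ ≤ coverHeight (orbit wt (γ s).1 i).pt → h₀ ≤ coverHeight (orbit wt (γ t).1 j).pt →
        D < pathDist edgeArc (edgeLength wt) (φ.oneSkeleton v) (orbit wt (γ s).1 i).pt
          (orbit wt (γ t).1 j).pt := by
  obtain ⟨C₁, hC₁, hstep, -⟩ := strip_chain φ v hwt
  obtain ⟨C₂, hC₂, hzero⟩ := exists_near_orbit_zero (φ := φ) (v := v) hwt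
  obtain ⟨R₃, hR₃, hlad⟩ := exists_ladder_geodesic (φ := φ) (v := v) hwt
  let _ := skelMetric (φ := φ) (v := v) hwt
  have hX := isHyp_skel hwt hhyp
  have hasc := isAscending_orbit hwt hstep
  obtain ⟨R₁, hR₁, hmorse⟩ := hX.morse hδ C₁ C₂ hC₂
  obtain ⟨R₂, hR₂, hft⟩ := hX.fellow_travel hδ C₁ (R₁ + 2 * δ) hC₁ (by linarith)
  -- `R₂` compares the geodesic with an orbit and `R₃` compares the orbit with a ladder geodesic;
  -- their sum must fit into 2δ + lam + ξ.
  refine ⟨R₂ + R₃, by linarith, fun lam hlam M => ?_⟩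
  obtain ⟨B, hB, hft⟩ := hft M
  refine ⟨B, hB, fun γ I ξ hI hξ hγ hlike => ?_⟩
  -- Outside `I` the path need not lie in the 1-skeleton, so an arbitrary default point is used
  -- there.
  let g : ℝ → φ.Skel v wt := fun u => if h : u ∈ I then ⟨γ u, hγ.1 u h⟩ else orbit wt (γ u).1 0
  have hg : ∀ u ∈ I, (g u).pt = γ u := fun u hu => by simp only [g, dif_pos hu]
  have hgd : ∀ u ∈ I, ∀ w ∈ I, dist (g u) (g w) = |u - w| := fun u hu w hw => by
    refine Eq.trans ?_ (hγ.2 u hu w hw)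
    exact congrArg₂ (pathDist edgeArc (edgeLength wt) (φ.oneSkeleton v)) (hg u hu) (hg w hw)
  have hg0 : ∀ u ∈ I, dist (g u) (orbit wt (γ u).1 0) ≤ C₂ := fun u hu => by
    have h1 := hzero (γ u) (hγ.1 u hu)
    rw [← hg u hu] at h1
    rw [← hg u hu]
    exact h1
  -- A long subpath that hugs the two orbits follows one of them for time M, and would make the
  -- geodesic ladderlike. Both assertions below contradict this.
  have far : ∀ s ∈ I, ∀ t ∈ I, s + B ≤ t → ¬ ∀ u ∈ Icc s t,
      (∃ i, dist (g u) (orbit wt (γ s).1 i) ≤ R₁ + 2 * δ) ∨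
      (∃ i, dist (g u) (orbit wt (γ t).1 i) ≤ R₁ + 2 * δ) := by
    intro s hs t ht hst hnear
    have hsub := hI.out hs ht
    obtain ⟨p, hp, a, b, hsa, hab, hbt, h1, h2⟩ := hft _ _ _ (hasc (γ s).1) (hasc (γ t).1) g s t hst
      (fun u hu w hw => hgd u (hsub hu) w (hsub hw)) ((hg0 s hs).trans (by linarith))
      ((hg0 t ht).trans (by linarith)) hnear
    obtain ⟨x, rfl⟩ : ∃ x, p = orbit wt x := by
      rcases hp with rfl | rfl
      · exact ⟨_, rfl⟩
      · exact ⟨_, rfl⟩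
    obtain ⟨A, hA, hA1, hA2⟩ := hlad M x
    have hIcc : ∀ u ∈ Icc a b, u ∈ I := fun u hu => hsub ⟨hsa.trans hu.1, hu.2.trans hbt⟩
    have hAS : ∀ z ∈ A, z ∈ φ.oneSkeleton v := fun z hz => (IsGeodesicSegment.subset hA hz).2
    refine hlike ⟨x, A, a, b, hA, hIcc a ⟨le_rfl, hab⟩, hIcc b ⟨hab, le_rfl⟩, hab, ?_, ?_⟩
    · intro z hz
      obtain ⟨j, hj, hzj⟩ := hA1 z hz
      obtain ⟨u, hu, huj⟩ := h2 j hj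
      refine ⟨γ u, mem_image_of_mem _ hu, ?_⟩
      rw [← hg u (hIcc u hu)]
      have h3 := dist_triangle (⟨z, hAS z hz⟩ : φ.Skel v wt) (orbit wt x j) (g u)
      have h4 : dist (⟨z, hAS z hz⟩ : φ.Skel v wt) (orbit wt x j) ≤ R₃ := hzj
      exact h3.trans (by linarith)
    · rintro _ ⟨u, hu, rfl⟩
      obtain ⟨j, hj, huj⟩ := h1 u hu
      obtain ⟨z, hz, hzj⟩ := hA2 j hj
      refine ⟨z, hz, ?_⟩
      rw [← hg u (hIcc u hu)]
      have h3 := dist_triangle (g u) (orbit wt x j) (⟨z, hAS z hz⟩ : φ.Skel v wt)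
      have h4 : dist (orbit wt x j) (⟨z, hAS z hz⟩ : φ.Skel v wt) ≤ R₃ := hzj
      exact h3.trans (by linarith)
  have side : ∀ t ∈ I, ∀ j (A : Set (φ.Skel v wt)), GeodSeg (g t) (orbit wt (γ t).1 j) A →
      ∀ b ∈ A, ∃ k, dist b (orbit wt (γ t).1 k) ≤ R₁ := by
    intro t ht j A hA b hb
    obtain ⟨k, -, hk⟩ := (hmorse _ _ (hasc (γ t).1) j _ _ A hA (hg0 t ht)
      (by rw [dist_self]; exact hC₂)).1 b hb
    exact ⟨k, hk⟩
  refine ⟨fun s hs t ht hst i j hij => far s hs t ht hst fun u hu => ?_,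
    -- Between `s₀` and `t₀` the height is at most that of `γ s₀` plus t₀ - s₀. A geodesic of length
    -- at most D between two points of height at least `h₀` stays more than 2δ above this.
    fun s₀ hs₀ t₀ ht₀ D => ⟨coverHeight (γ s₀) + (t₀ - s₀) + D + 2 * δ + 1,
      fun s t hs hst ht i j hi hj => ?_⟩⟩
  · have hsub := hI.out hs ht
    have hm : orbit wt (γ s).1 i = orbit wt (γ t).1 j := by
      apply Skel.pt_injective
      simp only [orbit, hij]
    have hA := geodSeg_image_Icc (g := g) (s := s) (t := t) (by linarith)
      fun u hu w hw => hgd u (hsub hu) w (hsub hw)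
    obtain ⟨A₁, hA₁⟩ := hX.geod (g t) (orbit wt (γ t).1 j)
    obtain ⟨A₂, hA₂⟩ := hX.geod (g s) (orbit wt (γ s).1 i)
    obtain ⟨b, hb, hub⟩ := hX.thin _ _ _ _ _ _ hA hA₁ (hm ▸ hA₂) (g u) (mem_image_of_mem _ hu)
    rcases hb with hb | hb
    · obtain ⟨k, hk⟩ := side t ht j A₁ hA₁ b hb
      exact Or.inr ⟨k, (dist_triangle _ _ _).trans (by linarith)⟩
    · obtain ⟨k, hk⟩ := side s hs i A₂ hA₂ b hb
      exact Or.inl ⟨k, (dist_triangle _ _ _).trans (by linarith)⟩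
  · by_contra hcon
    have hD : dist (orbit wt (γ s).1 i) (orbit wt (γ t).1 j) ≤ D := not_lt.1 hcon
    have hsub₀ := hI.out hs₀ ht₀
    have hsI : s ∈ I := hsub₀ ⟨hs, by linarith⟩
    have htI : t ∈ I := hsub₀ ⟨by linarith, ht⟩
    have hsub := hI.out hsI htI
    refine far s hsI t htI hst fun u hu => ?_
    have hA := geodSeg_image_Icc (g := g) (s := s) (t := t) (by linarith)
      fun u hu w hw => hgd u (hsub hu) w (hsub hw)
    obtain ⟨A₁, hA₁⟩ := hX.geod (g t) (orbit wt (γ t).1 j)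
    obtain ⟨A₂, hA₂⟩ := hX.geod (g s) (orbit wt (γ s).1 i)
    obtain ⟨A₃, hA₃⟩ := hX.geod (orbit wt (γ s).1 i) (orbit wt (γ t).1 j)
    rcases hX.quad hA hA₂ hA₃ hA₁.symm (mem_image_of_mem _ hu) with ⟨b, hb, hub⟩ | ⟨b, hb, hub⟩ | ⟨b, hb, hub⟩
    · obtain ⟨k, hk⟩ := side s hsI i A₂ hA₂ b hb
      exact Or.inl ⟨k, (dist_triangle _ _ _).trans (by linarith)⟩
    -- The top side of the quadrilateral is too high to be within 2δ of the geodesic.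
    · exfalso
      have hlip := (hasc (γ s).1).lip
      have h1 := hlip (g u) b
      have h2 := hlip b (orbit wt (γ s).1 i)
      have h3 := hA₃.dist_left hb
      have h4 := hlip (g u) (g s₀)
      have h5 := hgd u (hsub hu) s₀ hs₀
      have h6 : |u - s₀| ≤ t₀ - s₀ := by
        rw [abs_le]; constructor <;> linarith [hu.1, hu.2]
      rw [hg s₀ hs₀] at h4
      rw [abs_le] at h1 h2 h4
      linarith [h1.1, h2.1, h4.2]
    · obtain ⟨k, hk⟩ := side t htI j A₁ hA₁ b hb
      exact Or.inr ⟨k, (dist_triangle _ _ _).trans (by linarith)⟩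

end GraphMap

namespace GraphMap

variable {V E : Type*} {Γ : OrientedGraph V E} {φ : GraphMap Γ} {v : V} {wt : E → ℝ} {δ : ℝ}

/-! ### Flowing paths of the 1-skeleton to a common height -/

/-- The point of height `H` on the forward orbit of `p`. -/
def flowTo (H : ℤ) (p : φ.VPoint v) : φ.VPoint v := flow^[(H - p.height).toNat] p

theorem iterate_eq_flowTo {H : ℤ} {p : φ.VPoint v} {i : ℕ} (h : p.height + i = H) :
    flow^[i] p = flowTo H p := by
  unfold flowTo
  congr 1
  omega

theorem iterate_flowTo {H : ℤ} {p : φ.VPoint v} (h : p.height ≤ H) (j : ℕ) :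
    flow^[j] (flowTo H p) = flowTo (H + j) p := by
  unfold flowTo
  rw [← Function.iterate_add_apply]
  congr 1
  omega

theorem height_flowTo {H : ℤ} {p : φ.VPoint v} (h : p.height ≤ H) : (flowTo H p).height = H := by
  unfold flowTo
  rw [height_iterate]
  omega

/-- A path of the 1-skeleton of `X̃`. -/
abbrev SkelTrav (f : ℝ → φ.Cover v) (a b : ℝ) (x : φ.Node v)
    (l : List ((φ.VEdge v ⊕ φ.Node v) × Bool)) (y : φ.Node v) : Prop :=
  Traverses (φ.skelGraph v) nodePt edgeArc False f a b x l y

theorem oarc_edgeArc_inl (c : φ.VEdge v) (b : Bool) (s : ℝ) :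
    oarc edgeArc (.inl c, b) s = fwd (oarc VEdge.point (c, b) s) 0 := rfl

theorem oarc_edgeArc_inr (x : φ.Node v) (b : Bool) {s : ℝ} (hs : s ∈ Icc (0 : ℝ) 1) :
    (oarc edgeArc (.inr x, b) s).1 = .node x ∨ (oarc edgeArc (.inr x, b) s).1 = .node x.next := by
  have hs' : cond b s (1 - s) ∈ Icc (0 : ℝ) 1 := by
    cases b
    · exact ⟨by simp only [cond_false]; linarith [hs.2], by simp only [cond_false]; linarith [hs.1]⟩
    · exact hs
  change (fwd (.node x) (cond b s (1 - s))).1 = _ ∨ (fwd (.node x) (cond b s (1 - s))).1 = _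
  rcases hs'.2.eq_or_lt with h | h
  · right; rw [h, fwd_one, fwd_zero]; rfl
  · left; rw [fwd_of_lt _ ⟨hs'.1, h⟩]

theorem div_mem_Icc {a b u : ℝ} (h : a < b) (hu : u ∈ Icc a b) :
    (u - a) / (b - a) ∈ Icc (0 : ℝ) 1 := by
  have hba : 0 < b - a := by linarith
  exact ⟨div_nonneg (by linarith [hu.1]) hba.le, (div_le_one hba).2 (by linarith [hu.2])⟩

theorem SkelTrav.bounded {f : ℝ → φ.Cover v} {a b : ℝ} {x y : φ.Node v}
    {l : List ((φ.VEdge v ⊕ φ.Node v) × Bool)} (h : SkelTrav f a b x l y) :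
    ∃ K : ℤ, ∀ u ∈ Icc a b, |(f u).1.height| ≤ K := by
  induction h with
  | rest a b x h hr hf =>
    exact ⟨|x.height|, fun u hu => by rw [hf u hu, nodePt, fwd_zero]; exact le_rfl⟩
  | edge a b e h hf =>
    obtain ⟨c | x, s⟩ := e
    · refine ⟨|((φ.coverGraph v).init (c, s)).height|, fun u hu => ?_⟩
      rw [hf u hu, oarc_edgeArc_inl, fwd_zero, height_oarc]
    · refine ⟨|x.height| + 1, fun u hu => ?_⟩
      rw [hf u hu]
      rcases oarc_edgeArc_inr x s (div_mem_Icc h hu) with h1 | h1 <;> rw [h1]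
      · exact (le_add_of_nonneg_right zero_le_one)
      · change |x.next.height| ≤ _
        rw [height_next]
        exact (abs_add_le _ _).trans (by simp)
  | trans a b c x y z p q h1 h2 ih1 ih2 =>
    obtain ⟨K₁, hK₁⟩ := ih1
    obtain ⟨K₂, hK₂⟩ := ih2
    refine ⟨max K₁ K₂, fun u hu => ?_⟩
    rcases le_total u b with h | h
    · exact (hK₁ u ⟨hu.1, h⟩).trans (le_max_left _ _)
    · exact (hK₂ u ⟨h, hu.2⟩).trans (le_max_right _ _)

/-- A vertical edge becomes an iterated image of an edge, which is legal, and a horizontal edge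
collapses to a rest. The number of legal pieces is therefore bounded by the number of edges of the
original path, independently of `H`, so `H` may be chosen after that number. -/
theorem SkelTrav.flowTo (hT : IsTreeTrainTrack (φ.coverMap v)) {H : ℤ} {f : ℝ → φ.Cover v}
    {a b : ℝ} {x y : φ.Node v} {l : List ((φ.VEdge v ⊕ φ.Node v) × Bool)} (h : SkelTrav f a b x l y)
    (hH : ∀ u ∈ Icc a b, (f u).1.height ≤ H) : ∃ x' y' l',
      Trav True (fun u => GraphMap.flowTo H (f u).1) a b x' l' y' ∧
        (φ.coverMap v).Pieces l.length l' := by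
  induction h with
  | rest a b x h hr hf =>
    refine ⟨Node.next^[(H - x.height).toNat] x, _, [], .rest a b _ h (fun _ => trivial) fun u hu => ?_,
      .nil⟩
    rw [hf u hu, nodePt, fwd_zero]
    exact flow_iterate_node _ x
  | edge a b e h hf =>
    obtain ⟨c | x, s⟩ := e
    · set n := (H - ((φ.coverGraph v).init (c, s)).height).toNat with hn
      have hedge : Trav True (fun u => oarc VEdge.point (c, s) ((u - a) / (b - a))) a b _ _ _ :=
        Traverses.edge a b (c, s) h fun u _ => rfl
      refine ⟨_, _, (φ.coverMap v).mapPath^[n] [(c, s)], (Trav.iterate n hedge).congr fun u hu => ?_, ?_⟩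
      · rw [hf u hu, oarc_edgeArc_inl, fwd_zero]
        unfold GraphMap.flowTo
        rw [height_oarc]
      · have := Pieces.cons 0 _ [] ((hT.legal (c, s)).iterate n) .nil
        rwa [List.append_nil] at this
    -- The upper end of the horizontal edge is a value of `f`, so it too is at height at most `H`;
    -- otherwise the truncated exponent would separate the two ends.
    · have hx : x.height + 1 ≤ H := by
        have hend := hH (cond s b a) (by cases s <;> simp [h.le])
        rw [hf _ (by cases s <;> simp [h.le])] at hend
        have hba : b - a ≠ 0 := by linarith
        have h1 : (oarc edgeArc (Sum.inr x, s) ((cond s b a - a) / (b - a)) : φ.Cover v) =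
            fwd (.node x) 1 := by
          cases s <;> simp [oarc, edgeArc, hba]
        rw [h1, fwd_one, fwd_zero] at hend
        exact (height_next x) ▸ hend
      refine ⟨Node.next^[(H - x.height).toNat] x, _, [], .rest a b _ h.le (fun _ => trivial) fun u hu => ?_,
        Pieces.cons 0 [] [] IsLegal.nil .nil⟩
      rw [hf u hu, ← flow_iterate_node]
      rcases oarc_edgeArc_inr x s (div_mem_Icc h hu) with h1 | h1 <;> rw [h1]
      · rfl
      · rw [← iterate_eq_flowTo (i := (H - x.height).toNat - 1)]
        · refine (Function.iterate_succ_apply flow _ (VPoint.node x)).symm.trans ?_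
          congr 1
          omega
        · change x.next.height + _ = _
          rw [height_next]; omega
  | trans a b c x y z p q h1 h2 ih1 ih2 =>
    obtain ⟨x₁, y₁, l₁, h3, h4⟩ := ih1 fun u hu => hH u ⟨hu.1, hu.2.trans h2.le⟩
    obtain ⟨x₂, y₂, l₂, h5, h6⟩ := ih2 fun u hu => hH u ⟨h1.le.trans hu.1, hu.2⟩
    have h7 := isArcSystem_point.traverses_right h3
    have h8 := isArcSystem_point.traverses_left h5
    obtain rfl : y₁ = x₂ := VPoint.node.inj (h7.symm.trans h8)
    exact ⟨x₁, y₂, l₁ ++ l₂, .trans _ _ _ _ _ _ _ _ h3 h5, by rw [List.length_append]; exact h4.append h6⟩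

/-- A geodesic passes through nodes and edges. -/
theorem exists_skelTrav [Finite E] (hwt : ∀ e, 0 < wt e) {γ : ℝ → φ.Cover v} {I : Set ℝ}
    (hγ : IsGeodesicOn edgeArc (edgeLength wt) (φ.oneSkeleton v) γ I) {t₀ : ℝ} (hI : Ici t₀ ⊆ I)
    {x : φ.Node v} (hx : γ t₀ = nodePt x) (T : ℝ) : ∃ b ≥ T, ∃ l y, SkelTrav γ t₀ b x l y := by
  have hw := edgeLength_pos (φ := φ) (v := v) hwt
  have hfin := finite_edgeLength (φ := φ) (v := v) wt
  obtain ⟨m, hm, hmin⟩ := exists_min_wt hw hfin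
  have key : ∀ n : ℕ, ∃ b ≥ t₀ + n * m, ∃ l y, SkelTrav γ t₀ b x l y := by
    intro n
    induction n with
    | zero => exact ⟨t₀, by simp, [], x, Traverses.point hx.symm⟩
    | succ n ih =>
      obtain ⟨b, hb, l, y, h⟩ := ih
      obtain ⟨e, rfl, he⟩ := isArcSystem_edgeArc.geodesic_next hw hfin (fun i u hu => edgeArc_mem i hu)
        skel_chain hγ ((Ici_subset_Ici.2 h.le).trans hI) (isArcSystem_edgeArc.traverses_right h)
      refine ⟨b + edgeLength wt e.1, ?_, _, _, h.trans _ _ _ _ _ _ _ _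
        (Traverses.edge b (b + edgeLength wt e.1) e (by linarith [hw e.1]) fun u hu => ?_)⟩
      · push_cast
        linarith [hmin e.1]
      · have := he (u - b) ⟨by linarith [hu.1], by linarith [hu.2]⟩
        rw [add_sub_cancel] at this
        rw [this, add_sub_cancel_left]
  obtain ⟨n, hn⟩ := exists_nat_ge ((T - t₀) / m)
  obtain ⟨b, hb, h⟩ := key n
  refine ⟨b, ?_, h⟩
  rw [div_le_iff₀ hm] at hn
  linarith

/-- The initial piece of a geodesic ray, extended backwards to a node. -/
theorem exists_start [Finite E] (hwt : ∀ e, 0 < wt e) {γ : ℝ → φ.Cover v} {I : Set ℝ}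
    (hγ : IsGeodesicOn edgeArc (edgeLength wt) (φ.oneSkeleton v) γ I) (hI : Ici (0 : ℝ) ⊆ I) :
    ∃ (γ' : ℝ → φ.Cover v) (a t : ℝ) (x y : φ.Node v) (l : List ((φ.VEdge v ⊕ φ.Node v) × Bool)),
      a ≤ 0 ∧ 0 ≤ t ∧ (∀ s, 0 ≤ s → γ' s = γ s) ∧ SkelTrav γ' a t x l y := by
  have hw := edgeLength_pos (φ := φ) (v := v) hwt
  have hfin := finite_edgeLength (φ := φ) (v := v) wt
  obtain ⟨i, u, hu, h0⟩ := exists_edgeArc (hγ.1 0 (hI (mem_Ici.2 le_rfl)))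
  have hnode : ∀ x, γ 0 = nodePt x → ∃ (γ' : ℝ → φ.Cover v) (a t : ℝ) (x y : φ.Node v)
      (l : List ((φ.VEdge v ⊕ φ.Node v) × Bool)),
      a ≤ 0 ∧ 0 ≤ t ∧ (∀ s, 0 ≤ s → γ' s = γ s) ∧ SkelTrav γ' a t x l y := fun x hx =>
    ⟨γ, 0, 0, x, x, [], le_rfl, le_rfl, fun _ _ => rfl, Traverses.point hx.symm⟩
  rcases mem_cases hu with hu | rfl | rfl
  · obtain ⟨e, s₀, hs₀, he⟩ := isArcSystem_edgeArc.geodesic_start hw hfin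
      (fun i u hu => edgeArc_mem i hu) skel_chain hγ hI hu h0
    have hpos := hw e.1
    refine ⟨fun s => if s < 0 then oarc edgeArc e (s₀ + s / edgeLength wt e.1) else γ s,
      -(s₀ * edgeLength wt e.1), (1 - s₀) * edgeLength wt e.1, _, _, [e], ?_, ?_, ?_,
      .edge _ _ e ?_ fun u hu => ?_⟩
    · have := mul_pos hs₀.1 hpos; linarith
    · exact mul_nonneg (by linarith [hs₀.2]) hpos.le
    · intro s hs
      simp [not_lt.2 hs]
    · nlinarith
    · have h1 : (u - -(s₀ * edgeLength wt e.1)) / ((1 - s₀) * edgeLength wt e.1 - -(s₀ * edgeLength wt e.1)) =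
        s₀ + u / edgeLength wt e.1 := by
        have : (1 - s₀) * edgeLength wt e.1 - -(s₀ * edgeLength wt e.1) = edgeLength wt e.1 := by ring
        rw [this]; field_simp; ring
      rw [h1]
      split_ifs with hlt
      · rfl
      · have := he u ⟨not_lt.1 hlt, hu.2⟩
        rwa [zero_add] at this
  · exact hnode _ (h0.trans (isArcSystem_edgeArc.src i))
  · exact hnode _ (h0.trans (isArcSystem_edgeArc.tgt i))

theorem vert_path {x y : φ.Node v} {l : List (φ.VEdge v × Bool)} (h : (φ.coverGraph v).IsPath x l y) :
    (φ.skelGraph v).IsPath x (l.map fun a => (Sum.inl a.1, a.2)) y := by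
  induction l generalizing x with
  | nil => exact h
  | cons a l ih => exact ⟨(skel_init a).trans h.1, by rw [skel_term]; exact ih h.2⟩

/-- The reduced path is a path of the 1-skeleton with the same ends. Hence divergence of orbits in
the 1-skeleton forces long reduced words. -/
theorem pathDist_le_red (hwt : ∀ e, 0 < wt e) {W : ℝ} (hW : ∀ e, wt e ≤ W) {f : ℝ → φ.VPoint v}
    {R : Prop} {a b : ℝ} {x y : φ.Node v} {l : List (φ.VEdge v × Bool)} (h : Trav R f a b x l y) :
    pathDist edgeArc (edgeLength wt) (φ.oneSkeleton v) (fwd (f a) 0) (fwd (f b) 0) ≤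
      (red l).length * W := by
  have h1 := isArcSystem_edgeArc.chain_of_path (wt := edgeLength wt) (S := φ.oneSkeleton v)
    (vert_path h.isPath.red) fun e _ u hu => edgeArc_mem e.1 hu
  rw [isArcSystem_point.traverses_left h, isArcSystem_point.traverses_right h]
  refine (pathDist_le (edgeLength_pos hwt) h1).trans ?_
  unfold pathLen
  rw [List.map_map]
  refine (List.sum_le_card_nsmul _ W ?_).trans ?_
  · intro r hr
    obtain ⟨a, -, rfl⟩ := List.mem_map.1 hr
    exact hW a.1.1
  · simp

/-- The combinatorial heart of the matter, in terms of parametrized paths. -/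
theorem exists_odd_point (hT : IsTreeTrainTrack (φ.coverMap v)) : ∃ n₀ : ℕ, ∀ (k : ℕ)
    (f : ℝ → φ.VPoint v) (t₀ t₁ t₂ t₃ t₄ : ℝ) (x₀ x₁ x₂ x₃ x₄ : φ.Node v)
    (L Q₀ Qa Qb : List (φ.VEdge v × Bool)), L.length ≤ 1 → (L = [] ∨ Q₀ = []) →
    Trav True f t₀ t₁ x₀ L x₁ → Trav True f t₁ t₂ x₁ Q₀ x₂ → Trav True f t₂ t₃ x₂ Qa x₃ →
    Trav True f t₃ t₄ x₃ Qb x₄ → red (Q₀ ++ (Qa ++ Qb)) = red Q₀ ++ red (Qa ++ Qb) →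
    (∀ r ∈ Icc t₃ t₄, ∀ p z, Trav True f t₂ r x₂ p z → k * (2 * n₀) + 2 ≤ (red p).length) →
    (φ.coverMap v).Pieces k (Q₀ ++ (Qa ++ Qb)) →
    ∃ P : φ.VPoint v, ∃ s ∈ Icc t₂ t₃, f s = P ∧ (∀ n x, flow^[n] P ≠ .node x) ∧
      ∀ n, Odd {u ∈ Icc t₁ t₄ | flow^[n] (f u) = flow^[n] P}.ncard ∧
        ∀ u ∈ Icc t₀ t₁, flow^[n] (f u) ≠ flow^[n] P := by
  obtain ⟨n₀, hn₀⟩ := hT.exists_edge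
  refine ⟨n₀, fun k f t₀ t₁ t₂ t₃ t₄ x₀ x₁ x₂ x₃ x₄ L Q₀ Qa Qb hL hLQ h0 h1 h2 h3 hred hfar hk => ?_⟩
  have h23 := h2.trans _ _ _ _ _ _ _ _ h3
  have h123 := h1.trans _ _ _ _ _ _ _ _ h23
  have h0123 := h0.trans _ _ _ _ _ _ _ _ h123
  -- Splitting the word `Qb` corresponds to stopping at some time in [t₃, t₄], which turns the
  -- length condition over times into one over prefixes.
  obtain ⟨c, hc, hodd⟩ := hn₀ k _ _ L Q₀ Qa Qb hL hLQ h0123.isPath hred (fun R₁ R₂ hR => by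
    obtain ⟨s, z, h4, h5⟩ := isArcSystem_point.traverses_split h3 R₁ R₂ hR
    exact hfar s ⟨h4.le, h5.le⟩ _ _ (h2.trans _ _ _ _ _ _ _ _ h4)) hk
  -- A point whose orbit avoids nodes always lies inside an edge, so its images are counted by
  -- `cnt`. An odd count is positive, which provides a time in [t₂, t₃] at this point.
  obtain ⟨ξ, hξ, hgen⟩ := exists_generic c
  obtain ⟨hfin, hcard⟩ := isArcSystem_point.traverses_count h2 c hξ
  have hpos : 0 < cnt c Qa := hc.pos
  rw [← hcard, ncard_pos hfin] at hpos
  obtain ⟨s, hs, hsξ⟩ := hpos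
  refine ⟨_, s, hs, rfl, by rw [hsξ]; exact hgen, fun n => ?_⟩
  rw [hsξ]
  obtain ⟨c', hc', ξ', hξ', hPξ⟩ := flow_generic hξ (hgen n)
  obtain ⟨ho, hz⟩ := hodd n c' hc'
  rw [hPξ]
  refine ⟨?_, fun u hu huP => ?_⟩
  · obtain ⟨-, h⟩ := isArcSystem_point.traverses_count (Trav.iterate n h123) c' hξ'
    rw [h]; exact ho
  · obtain ⟨hfin, h⟩ := isArcSystem_point.traverses_count (Trav.iterate n h0) c' hξ'
    rw [hz, ncard_eq_zero hfin] at h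
    exact eq_empty_iff_forall_notMem.1 h u ⟨hu, huP⟩

end GraphMap

namespace GraphMap

variable {V E : Type*} {Γ : OrientedGraph V E} {φ : GraphMap Γ} {v : V} {wt : E → ℝ} {δ : ℝ}

/-! ### Levels -/

theorem level_chain {n : ℕ} {z P : φ.VPoint v} (hz : flow^[n] z = P) {i : ℕ} (hi : i ≤ n) :
    ∃ a, ChainLength (fwd (φ := φ) (v := v)) (fun _ => 1) (level n P) (fwd z i) (fwd P 0) a := by
  obtain ⟨k, rfl⟩ := Nat.exists_eq_add_of_le hi
  clear hi
  induction k generalizing i with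
  | zero => exact ⟨0, by rw [fwd_natCast, ← hz, add_zero]; exact .nil _⟩
  | succ k ih =>
    obtain ⟨a, ha⟩ := ih (i := i + 1) (by rw [← hz]; congr 1; omega)
    have h1 := ChainLength.single (arc := fwd (φ := φ) (v := v)) (wt := fun _ => 1)
      (S := level (i + (k + 1)) P) (i := flow^[i] z) (s := 0) (t := 1) (by simp) (by simp)
      fun u hu => mem_iUnion₂.2 ⟨z, hz, i + u, ⟨by linarith [hu.1, (Nat.cast_nonneg i : (0 : ℝ) ≤ i)], by
        push_cast; linarith [hu.2, (Nat.cast_nonneg k : (0 : ℝ) ≤ k)]⟩, fwd_add_nat z i hu.1⟩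
    rw [fwd_one, ← fwd_natCast, ← Function.iterate_succ_apply' flow, ← fwd_natCast] at h1
    have h2 : i + 1 + k = i + (k + 1) := by omega
    rw [h2] at ha
    exact ⟨_, h1.trans ha⟩

/-- Height is 1-Lipschitz on levels as well, so vertical position alone gives the required distances
from root and leaves. -/
theorem le_levelDist {T : Set (φ.Cover v)} {p q : φ.Cover v} {a : ℝ}
    (h : ChainLength (fwd (φ := φ) (v := v)) (fun _ => 1) T p q a) :
    |coverHeight p - coverHeight q| ≤ levelDist T p q := by
  refine le_pathDist (fun x s hs t ht => ?_) h
  rw [coverHeight_fwd _ hs.1, coverHeight_fwd _ ht.1, mul_one]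
  simp

theorem mem_level_iff {n : ℕ} {P : φ.VPoint v} {p : φ.Cover v} : p ∈ level n P ↔
    ∃ z, flow^[n] z = P ∧ ∃ s ∈ Icc (0 : ℝ) n, fwd z s = p := by
  simp [level, levelLeaves, forwardPath]

/-- Separation from an odd intersection with all levels above a given point. -/
theorem exists_separating (hirr : φ.transitionMatrix.IsIrreducible) (hwt : ∀ e, 0 < wt e)
    {γ : ℝ → φ.Cover v} {I : Set ℝ}
    (hγ : IsGeodesicOn edgeArc (edgeLength wt) (φ.oneSkeleton v) γ I) {B : ℝ} {H : ℤ}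
    (hmerge : ∀ s ∈ I, ∀ t ∈ I, s + B ≤ t → ∀ i j, flow^[i] (γ s).1 ≠ flow^[j] (γ t).1)
    {t₀ t₁ t₂ t₃ t₄ : ℝ} (hH : ∀ s ∈ I, s ∈ Icc t₀ t₄ → (γ s).1.height ≤ H) {H₁ : ℤ}
    (hH₁ : ∀ s ∈ Icc t₁ t₄, H₁ ≤ (γ s).1.height) (ht01 : t₀ ≤ t₁) (ht12 : t₁ ≤ t₂)
    (hI : Icc t₁ t₄ ⊆ I) (hI' : ∀ s ∈ I, t₀ ≤ s ∨ s + B ≤ t₂) (ht34 : t₃ + B ≤ t₄) (hB : 0 < B)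
    {P : φ.VPoint v} {s₀ : ℝ} (hs₀ : s₀ ∈ Icc t₂ t₃) (hP : flowTo H (γ s₀).1 = P)
    (hgen : ∀ n x, flow^[n] P ≠ .node x)
    (hodd : ∀ n, Odd {u ∈ Icc t₁ t₄ | flow^[n] (flowTo H (γ u).1) = flow^[n] P}.ncard)
    (hnone : ∀ n, ∀ u ∈ I, u ∈ Icc t₀ t₁ → flow^[n] (flowTo H (γ u).1) ≠ flow^[n] P) (K : ℝ) :
    ∃ (y : φ.VPoint v) (n₀ : ℕ), ∀ n ≥ n₀,
      Odd (γ '' I ∩ level n (flow^[n] y)).ncard ∧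
      ∀ c ∈ γ '' I ∩ level n (flow^[n] y),
        K < levelDist (level n (flow^[n] y)) c (fwd (flow^[n] y) 0) ∧
        ∀ z ∈ levelLeaves n (flow^[n] y), K < levelDist (level n (flow^[n] y)) c (fwd z 0) := by
  obtain ⟨K', hK'⟩ := exists_nat_gt K
  have hs₀' : s₀ ∈ Icc t₁ t₄ := ⟨ht12.trans hs₀.1, by linarith [hs₀.2]⟩
  have hs₀I := hI hs₀'
  have hPH : P.height = H := by
    rw [← hP]; exact height_flowTo (hH s₀ hs₀I ⟨ht01.trans hs₀'.1, hs₀'.2⟩)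
  have hH₁H : H₁ ≤ H := (hH₁ s₀ hs₀').trans (hH s₀ hs₀I ⟨ht01.trans hs₀'.1, hs₀'.2⟩)
  -- The leaves then lie at height at most H₁ - K', below the whole segment by K'. Taking n ≥ N + K'
  -- puts the root at height at least H + K'.
  set N : ℕ := (H - H₁).toNat + K' with hN
  obtain ⟨y, hy⟩ := exists_iterate_eq hirr N (p := P) fun x => hgen 0 x
  have hyH : y.height = H - N := by
    have := height_iterate N y
    rw [hy, hPH] at this; omega
  refine ⟨y, N + K', fun n hn => ?_⟩
  obtain ⟨j, rfl⟩ : ∃ j, n = j + N := ⟨n - N, by omega⟩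
  have hjK : K' ≤ j := by omega
  have hny : flow^[j + N] y = flow^[j] P := by rw [Function.iterate_add_apply, hy]
  rw [hny]
  have hpt : ∀ s ∈ Icc t₁ t₄, flow^[j] (flowTo H (γ s).1) = flow^[j] P → ∃ (z : φ.VPoint v) (i : ℕ),
      K' ≤ i ∧ i ≤ N ∧ flow^[j + N] z = flow^[j] P ∧ fwd z i = γ s := by
    intro s hs hsP
    have hsI := hI hs
    have hsH := hH s hsI ⟨ht01.trans hs.1, hs.2⟩
    -- Nodes flow to nodes, but the images of P are never nodes. So intersection points are not on
    -- horizontal edges, and each has preimages of every order, down to the leaves.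
    have hnn : ∀ x, (γ s).1 ≠ .node x := by
      intro x hx
      apply hgen j (Node.next^[j + (H - (γ s).1.height).toNat] x)
      rw [← hsP, ← flow_iterate_node, ← hx, Function.iterate_add_apply]
      rfl
    have hγs : γ s = fwd (γ s).1 0 := by
      have h1 : γ s = fwd (γ s).1 (γ s).2.1 := by rw [fwd_of_lt _ (γ s).2.2]
      have h2 := hγ.1 s hsI
      rw [h1] at h2
      rcases mem_oneSkeleton (γ s).2.2 h2 with h3 | ⟨x, hx⟩
      · rw [h3] at h1; exact h1
      · exact absurd hx (hnn x)
    have hlow := hH₁ s hs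
    obtain ⟨i, hi⟩ : ∃ i : ℕ, (γ s).1.height - (H - N) = i :=
      ⟨((γ s).1.height - (H - N)).toNat, by omega⟩
    obtain ⟨z, hz⟩ := exists_iterate_eq hirr i hnn
    refine ⟨z, i, by omega, by omega, ?_, ?_⟩
    · rw [← hsP]
      have hji : j + N = (j + (H - (γ s).1.height).toNat) + i := by omega
      rw [hji, Function.iterate_add_apply, hz, Function.iterate_add_apply]
      rfl
    · rw [fwd_natCast, hz, ← hγs]
  have hset : γ '' I ∩ level (j + N) (flow^[j] P) =
      γ '' {u ∈ Icc t₁ t₄ | flow^[j] (flowTo H (γ u).1) = flow^[j] P} := by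
    ext p
    constructor
    · rintro ⟨⟨s, hs, rfl⟩, hp⟩
      obtain ⟨z, hz, u, hu, hzu⟩ := mem_level_iff.1 hp
      have hw : (γ s).1 = flow^[⌊u⌋₊] z := by rw [← hzu]; rfl
      have hun : ⌊u⌋₊ ≤ j + N := Nat.floor_le_of_le hu.2
      obtain ⟨i, hi⟩ := Nat.exists_eq_add_of_le hun
      have h1 : flow^[i] (γ s).1 = flow^[j] P := by
        rw [hw, ← Function.iterate_add_apply, ← hz, hi, add_comm]
      have h2 : flow^[i] (γ s).1 = flow^[j + (H - (γ s₀).1.height).toNat] (γ s₀).1 := by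
        rw [h1, Function.iterate_add_apply, ← hP]; rfl
      -- A point of γ on the level has an orbit that merges with that of `γ s₀`. It is therefore
      -- within B of `s₀` along γ, which confines it to the chosen segment.
      have hsub : ¬ s₀ + B ≤ s := fun h => hmerge s₀ hs₀I s hs h _ _ h2.symm
      have hsub' : ¬ s + B ≤ s₀ := fun h => hmerge s hs s₀ hs₀I h _ _ h2
      have hst : s ∈ Icc t₀ t₄ := by
        refine ⟨?_, by linarith [hs₀.2]⟩
        rcases hI' s hs with h | h
        · exact h
        · exact absurd (h.trans hs₀.1) hsub'
      have hsH := hH s hs hst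
      have h3 : flow^[j] (flowTo H (γ s).1) = flow^[j] P := by
        rw [← h1, iterate_flowTo hsH]
        symm
        apply iterate_eq_flowTo
        have := congrArg VPoint.height h1
        rw [height_iterate, height_iterate, hPH] at this
        exact this
      refine ⟨s, ⟨⟨?_, hst.2⟩, h3⟩, rfl⟩
      by_contra hlt
      exact hnone j s hs ⟨hst.1, (not_le.1 hlt).le⟩ h3
    · rintro ⟨s, ⟨hs, hsP⟩, rfl⟩
      refine ⟨⟨s, hI hs, rfl⟩, mem_level_iff.2 ?_⟩
      obtain ⟨z, i, -, hi, hz, h⟩ := hpt s hs hsP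
      exact ⟨z, hz, i, ⟨by positivity, by exact_mod_cast (show i ≤ j + N by omega)⟩, h⟩
  rw [hset]
  constructor
  · rw [InjOn.ncard_image]
    · exact hodd j
    · intro s hs t ht hst
      have h1 := hγ.2 s (hI hs.1) t (hI ht.1)
      rw [hst, pathDist_self (edgeLength_pos hwt)] at h1
      exact sub_eq_zero.1 (abs_eq_zero.1 h1.symm)
  · rintro _ ⟨s, ⟨hs, hsP⟩, rfl⟩
    obtain ⟨z, i, hKi, hiN, hz, hzs⟩ := hpt s hs hsP
    have hheight : ∀ z : φ.VPoint v, flow^[j + N] z = flow^[j] P → z.height = H - N := by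
      intro z hz
      have := congrArg VPoint.height hz
      rw [height_iterate, height_iterate, hPH] at this
      push_cast at this
      omega
    obtain ⟨a, ha⟩ := level_chain hz (i := i) (by omega)
    have hc : coverHeight (γ s) = H - N + i := by
      rw [← hzs, coverHeight_fwd _ (Nat.cast_nonneg i), hheight z hz]; push_cast; ring
    have hr : coverHeight (fwd (flow^[j] P) 0) = H + j := by
      rw [coverHeight_fwd _ le_rfl, height_iterate, hPH]; push_cast; ring
    rw [hzs] at ha
    have hKi' : (K' : ℝ) ≤ i := by exact_mod_cast hKi
    have hiN' : (i : ℝ) ≤ N := by exact_mod_cast hiN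
    have hjK' : (K' : ℝ) ≤ j := by exact_mod_cast hjK
    refine ⟨?_, fun z' hz' => ?_⟩
    · refine lt_of_lt_of_le ?_ (le_levelDist ha)
      rw [hc, hr, abs_sub_comm]
      refine lt_of_lt_of_le ?_ (le_abs_self _)
      linarith
    · obtain ⟨a', ha'⟩ := level_chain hz' (i := 0) (Nat.zero_le _)
      rw [Nat.cast_zero] at ha'
      refine lt_of_lt_of_le ?_ (le_levelDist (ha.trans ha'.symm))
      rw [hc, coverHeight_fwd _ le_rfl, hheight z' hz']
      refine lt_of_lt_of_le ?_ (le_abs_self _)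
      push_cast
      linarith

end GraphMap

namespace GraphMap

variable {V E : Type*} {Γ : OrientedGraph V E} {φ : GraphMap Γ} {v : V} {wt : E → ℝ} {δ : ℝ}

/-! ### Deviating geodesics are separated -/

theorem flowTo_node (H : ℤ) {p : φ.Cover v} {x : φ.Node v} (h : p = nodePt x) :
    flowTo H p.1 = .node (Node.next^[(H - x.height).toNat] x) := by
  rw [h, nodePt, fwd_zero]
  exact flow_iterate_node _ x

theorem le_length_red (hwt : ∀ e, 0 < wt e) {W : ℝ} (hW0 : 0 ≤ W) (hW : ∀ e, wt e ≤ W)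
    {f : ℝ → φ.VPoint v} {R : Prop} {a b : ℝ} {x y : φ.Node v} {l : List (φ.VEdge v × Bool)} {n : ℕ}
    (h : Trav R f a b x l y) (hn : n * W <
      pathDist edgeArc (edgeLength wt) (φ.oneSkeleton v) (fwd (f a) 0) (fwd (f b) 0)) :
    n ≤ (red l).length := by
  by_contra hlt
  have h1 : ((red l).length : ℝ) ≤ n := by exact_mod_cast (not_le.1 hlt).le
  have h2 := hn.trans_le (pathDist_le_red hwt hW h)
  exact absurd h2 (not_lt.2 (mul_le_mul_of_nonneg_right h1 hW0))

theorem coverHeight_orbit {H : ℤ} {p : φ.VPoint v} (h : p.height ≤ H) :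
    coverHeight (orbit wt p (H - p.height).toNat).pt = H := by
  change coverHeight (fwd (flowTo H p) 0) = H
  rw [coverHeight_fwd _ le_rfl, height_flowTo h, add_zero]

/-- The segment [a, b] of the line is cut at o and m, with buffers of length at least B at both ends
and 2B in the middle. The tripod at o yields a time `s₂` from which the reduced path continues
without cancelling against what precedes, and the crossing point is sought between `s₂` and m. -/
theorem exists_separating_line [Finite E] (hT : IsTreeTrainTrack (φ.coverMap v))
    (hirr : φ.transitionMatrix.IsIrreducible) (hwt : ∀ e, 0 < wt e) {γ : ℝ → φ.Cover v}
    (hγ : IsGeodesicOn edgeArc (edgeLength wt) (φ.oneSkeleton v) γ univ) {B : ℝ} (hB : 0 < B)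
    (hmerge : ∀ s ∈ univ, ∀ t ∈ univ, s + B ≤ t → ∀ i j, flow^[i] (γ s).1 ≠ flow^[j] (γ t).1)
    (hfar : ∀ s₀ ∈ univ, ∀ t₀ ∈ univ, ∀ D : ℝ, ∃ h₀ : ℝ, ∀ s t, s₀ ≤ s → s + B ≤ t → t ≤ t₀ → ∀ i j : ℕ,
      h₀ ≤ coverHeight (orbit wt (γ s).1 i).pt → h₀ ≤ coverHeight (orbit wt (γ t).1 j).pt →
      D < pathDist edgeArc (edgeLength wt) (φ.oneSkeleton v) (orbit wt (γ s).1 i).pt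
        (orbit wt (γ t).1 j).pt) (K : ℝ) :
    ∃ (y : φ.VPoint v) (n₀ : ℕ), ∀ n ≥ n₀,
      Odd (γ '' univ ∩ level n (flow^[n] y)).ncard ∧
      ∀ c ∈ γ '' univ ∩ level n (flow^[n] y),
        K < levelDist (level n (flow^[n] y)) c (fwd (flow^[n] y) 0) ∧
        ∀ z ∈ levelLeaves n (flow^[n] y), K < levelDist (level n (flow^[n] y)) c (fwd z 0) := by
  obtain ⟨W, hW0, hW, -⟩ := exists_bound φ v wt
  obtain ⟨n₀, hn₀⟩ := exists_odd_point hT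
  obtain ⟨γ', α, a, x', x, l', -, ha, hγ', hstart⟩ := exists_start hwt hγ (subset_univ _)
  have hax : γ a = nodePt x := (hγ' a ha).symm.trans (isArcSystem_edgeArc.traverses_right hstart)
  obtain ⟨o, ho, l₁, x₁, h₁⟩ := exists_skelTrav hwt hγ (subset_univ _) hax (a + B)
  obtain ⟨m, hm, l₂, x₂, h₂⟩ := exists_skelTrav hwt hγ (subset_univ _)
    (isArcSystem_edgeArc.traverses_right h₁) (o + 2 * B)
  obtain ⟨b, hb, l₃, x₃, h₃⟩ := exists_skelTrav hwt hγ (subset_univ _)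
    (isArcSystem_edgeArc.traverses_right h₂) (m + B)
  have h : SkelTrav γ a b x (l₁ ++ (l₂ ++ l₃)) x₃ := h₁.trans _ _ _ _ _ _ _ _ (h₂.trans _ _ _ _ _ _ _ _ h₃)
  set k := (l₁ ++ (l₂ ++ l₃)).length
  -- The segment, and with it the number k of pieces, is fixed before the height. The required
  -- distance translates into reduced words of length at least k * (2 * n₀) + 2.
  obtain ⟨h₀, hh₀⟩ := hfar a (mem_univ _) b (mem_univ _) ((k * (2 * n₀) + 2 : ℕ) * W)
  obtain ⟨H₁, hH₁⟩ := h.bounded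
  set H : ℤ := max H₁ ⌈h₀⌉
  have hH : ∀ s ∈ Icc a b, (γ s).1.height ≤ H := fun s hs =>
    (le_abs_self _).trans ((hH₁ s hs).trans (le_max_left _ _))
  have hHh : h₀ ≤ H := (Int.le_ceil h₀).trans (by exact_mod_cast le_max_right _ _)
  obtain ⟨y, y', l, hl, hk⟩ := h.flowTo hT hH
  obtain ⟨U, Q, rfl, hU, hQ⟩ := isArcSystem_point.traverses_cut hl (s := o)
    ⟨h₁.le, by linarith⟩ (flowTo_node H (isArcSystem_edgeArc.traverses_right h₁))
  obtain ⟨U₁, U₂, W₁, W₂, rfl, rfl, hmk, hred⟩ := exists_tripod U Q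
  obtain ⟨s₁, z₁, hU₁, hU₂⟩ := isArcSystem_point.traverses_split hU _ _ rfl
  obtain ⟨s₂, z₂, hW₁, hW₂⟩ := isArcSystem_point.traverses_split hQ _ _ rfl
  have hz : z₁ = z₂ := by
    have := (hU₂.trans _ _ _ _ _ _ _ _ hW₁).isPath.red
    rwa [red_eq_nil hmk] at this
  -- The two arms of the tripod that close up end at the same flowed point at times s₁ ≤ o ≤ s₂.
  -- Orbits of points at least B apart never merge, so s₂ < s₁ + B.
  have hs₂o : s₂ ≤ o + B := by
    have h5 := (isArcSystem_point.traverses_left hU₂).trans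
      (hz ▸ (isArcSystem_point.traverses_right hW₁).symm)
    have h6 : ¬ s₁ + B ≤ s₂ := fun h => hmerge s₁ (mem_univ _) s₂ (mem_univ _) h _ _ h5
    have := hU₂.le
    linarith
  obtain ⟨Qa, Qb, rfl, hQa, hQb⟩ := isArcSystem_point.traverses_cut hW₂ (s := m)
    ⟨by linarith, h₃.le⟩ (flowTo_node H (isArcSystem_edgeArc.traverses_right h₂))
  have hs₂ : a + B ≤ s₂ := ho.le.trans hW₁.le
  obtain ⟨P, s₀, hs₀, hP, hgen, hodd⟩ := hn₀ k (fun u => flowTo H (γ u).1) a a s₂ m b _ _ _ _ _ []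
    ((U₁ ++ U₂) ++ W₁) Qa Qb (by simp) (Or.inl rfl)
    (Traverses.point (isArcSystem_point.traverses_left hl).symm)
    (hU.trans _ _ _ _ _ _ _ _ hW₁) hQa hQb (by
      rw [List.append_assoc _ W₁, hred]) (fun r hr p z hp => by
      refine le_length_red hwt hW0 hW hp (hh₀ s₂ r (by linarith) ?_ hr.2 _ _ ?_ ?_)
      · linarith [hr.1]
      · rw [coverHeight_orbit (hH s₂ ⟨by linarith, by linarith [h₃.le]⟩)]; exact hHh
      · rw [coverHeight_orbit (hH r ⟨by linarith [hr.1], hr.2⟩)]; exact hHh)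
    (by simpa only [List.append_assoc] using hk)
  exact exists_separating hirr hwt hγ hmerge (t₀ := a) (t₁ := a) (t₂ := s₂) (t₃ := m) (t₄ := b)
    (fun s _ hs => hH s hs) (H₁ := -H₁) (fun s hs => neg_le_of_abs_le (hH₁ s hs)) le_rfl
    (by linarith) (subset_univ _) (fun s _ => by
      rcases le_total a s with h | h
      · exact Or.inl h
      · exact Or.inr (by linarith)) hb.le hB hs₀ hP hgen (fun n => (hodd n).1) (fun n u _ hu =>
        (hodd n).2 u hu) K

/-- A ray needs no buffer on the left, but it may start inside an edge, and its initial point may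
flow into the interior of an edge even if it is a point of the segment's first edge. The path is
extended backwards to a node, and the one edge `L` containing the flowed initial point is treated
separately: it must contribute no crossing at all. -/
theorem exists_separating_ray [Finite E] (hT : IsTreeTrainTrack (φ.coverMap v))
    (hirr : φ.transitionMatrix.IsIrreducible) (hwt : ∀ e, 0 < wt e) {γ : ℝ → φ.Cover v}
    (hγ : IsGeodesicOn edgeArc (edgeLength wt) (φ.oneSkeleton v) γ (Ici 0)) {B : ℝ} (hB : 0 < B)
    (hmerge : ∀ s ∈ Ici (0 : ℝ), ∀ t ∈ Ici (0 : ℝ), s + B ≤ t → ∀ i j, flow^[i] (γ s).1 ≠ flow^[j] (γ t).1)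
    (hfar : ∀ s₀ ∈ Ici (0 : ℝ), ∀ t₀ ∈ Ici (0 : ℝ), ∀ D : ℝ, ∃ h₀ : ℝ, ∀ s t, s₀ ≤ s → s + B ≤ t →
      t ≤ t₀ → ∀ i j : ℕ,
      h₀ ≤ coverHeight (orbit wt (γ s).1 i).pt → h₀ ≤ coverHeight (orbit wt (γ t).1 j).pt →
      D < pathDist edgeArc (edgeLength wt) (φ.oneSkeleton v) (orbit wt (γ s).1 i).pt
        (orbit wt (γ t).1 j).pt) (K : ℝ) :
    ∃ (y : φ.VPoint v) (n₀ : ℕ), ∀ n ≥ n₀,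
      Odd (γ '' Ici 0 ∩ level n (flow^[n] y)).ncard ∧
      ∀ c ∈ γ '' Ici 0 ∩ level n (flow^[n] y),
        K < levelDist (level n (flow^[n] y)) c (fwd (flow^[n] y) 0) ∧
        ∀ z ∈ levelLeaves n (flow^[n] y), K < levelDist (level n (flow^[n] y)) c (fwd z 0) := by
  obtain ⟨W, hW0, hW, -⟩ := exists_bound φ v wt
  obtain ⟨n₀, hn₀⟩ := exists_odd_point hT
  obtain ⟨γ', α, T, x₀, x₁, l₁, hα, hT0, hγ', h₁⟩ := exists_start hwt hγ Subset.rfl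
  have hTx : γ T = nodePt x₁ := (hγ' T hT0).symm.trans (isArcSystem_edgeArc.traverses_right h₁)
  obtain ⟨m, hm, l₂, x₂, h₂⟩ := exists_skelTrav hwt hγ (Ici_subset_Ici.2 hT0) hTx (T + B)
  obtain ⟨b, hb, l₃, x₃, h₃⟩ := exists_skelTrav hwt hγ (Ici_subset_Ici.2 (hT0.trans h₂.le))
    (isArcSystem_edgeArc.traverses_right h₂) (m + B)
  have h : SkelTrav γ' α b x₀ (l₁ ++ (l₂ ++ l₃)) x₃ := h₁.trans _ _ _ _ _ _ _ _
    ((h₂.trans _ _ _ _ _ _ _ _ h₃).congr fun u hu => hγ' u (hT0.trans hu.1))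
  set k := (l₁ ++ (l₂ ++ l₃)).length
  have hb0 : 0 ≤ b := hT0.trans (h₂.le.trans h₃.le)
  obtain ⟨h₀, hh₀⟩ := hfar 0 (mem_Ici.2 le_rfl) b hb0 ((k * (2 * n₀) + 2 : ℕ) * W)
  obtain ⟨H₁, hH₁⟩ := h.bounded
  set H : ℤ := max H₁ ⌈h₀⌉
  have hH : ∀ s ∈ Icc α b, (γ' s).1.height ≤ H := fun s hs =>
    (le_abs_self _).trans ((hH₁ s hs).trans (le_max_left _ _))
  have hHγ : ∀ s, 0 ≤ s → s ≤ b → (γ s).1.height ≤ H := fun s hs hsb => by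
    have := hH s ⟨hα.trans hs, hsb⟩
    rwa [hγ' s hs] at this
  have hHh : h₀ ≤ H := (Int.le_ceil h₀).trans (by exact_mod_cast le_max_right _ _)
  obtain ⟨y, y', l, hl, hk⟩ := h.flowTo hT hH
  obtain ⟨U, Q, rfl, hU, hQ⟩ := isArcSystem_point.traverses_cut hl (s := T)
    ⟨h₁.le, h₂.le.trans h₃.le⟩ (flowTo_node H (isArcSystem_edgeArc.traverses_right h₁))
  -- Only part of `L`, the times from 0 to `s₂`, belongs to the ray. Crossings are counted from the
  -- node at `s₂` on, and the absence of crossings on all of `L` takes care of the rest.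
  obtain ⟨s₁, s₂, p, L, q, z₁, z₂, hs₁, hs₂, rfl, hL, -, -, hp, hL', hq⟩ :=
    isArcSystem_point.traverses_locate hU 0 ⟨hα, hT0⟩
  have hmx : γ' m = nodePt x₂ :=
    (hγ' m (hT0.trans h₂.le)).trans (isArcSystem_edgeArc.traverses_right h₂)
  obtain ⟨Qa, Qb, rfl, hQa, hQb⟩ := isArcSystem_point.traverses_cut hQ (s := m)
    ⟨h₂.le, h₃.le⟩ (flowTo_node H hmx)
  have hs₂T := hq.le
  obtain ⟨P, s₀, hs₀, hP, hgen, hodd⟩ := hn₀ k (fun u => flowTo H (γ' u).1) s₁ s₂ s₂ m b _ _ _ _ _ L []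
    (q ++ Qa) Qb hL (Or.inr rfl) hL'
    (Traverses.point (isArcSystem_point.traverses_left hq).symm)
    (hq.trans _ _ _ _ _ _ _ _ hQa) hQb (by simp [red]) (fun r hr p z hp => by
      have hr0 : 0 ≤ r := (hs₂.trans hs₂T).trans (h₂.le.trans hr.1)
      refine le_length_red hwt hW0 hW hp ?_
      rw [hγ' s₂ hs₂, hγ' r hr0]
      refine hh₀ s₂ r hs₂ (by linarith [hr.1]) hr.2 _ _ ?_ ?_
      · rw [coverHeight_orbit (hHγ s₂ hs₂ (by linarith [h₃.le]))]; exact hHh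
      · rw [coverHeight_orbit (hHγ r hr0 hr.2)]; exact hHh)
    (hk.infix ⟨p ++ L, [], by simp⟩)
  refine exists_separating hirr hwt hγ hmerge (t₀ := 0) (t₁ := s₂) (t₂ := s₂) (t₃ := m) (t₄ := b)
    (H := H) (P := P) (s₀ := s₀)
    (fun s _ hs => hHγ s hs.1 hs.2) (H₁ := -H₁) (fun s hs => ?_) hs₂ le_rfl
    (fun u hu => hs₂.trans hu.1) (fun s hs => Or.inl hs) hb.le hB hs₀ ?_ hgen (fun n => ?_)
    (fun n u _ hu => ?_) K
  · have := hH₁ s ⟨hα.trans (hs₂.trans hs.1), hs.2⟩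
    rw [hγ' s (hs₂.trans hs.1)] at this
    exact neg_le_of_abs_le this
  · rw [← hγ' s₀ (hs₂.trans hs₀.1)]; exact hP
  · have h5 := (hodd n).1
    have h6 : {u ∈ Icc s₂ b | flow^[n] (flowTo H (γ' u).1) = flow^[n] P} =
        {u ∈ Icc s₂ b | flow^[n] (flowTo H (γ u).1) = flow^[n] P} := by
      ext u
      simp only [mem_ofPred_eq]
      refine and_congr_right fun hu => ?_
      rw [hγ' u (hs₂.trans hu.1)]
    rwa [h6] at h5
  · rw [← hγ' u hu.1]
    exact (hodd n).2 u ⟨hs₁.trans hu.1, hu.2⟩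

theorem LaddersQuasiconvex.mono {R R' : ℝ} (h : φ.LaddersQuasiconvex v wt R) (hR : R ≤ R') :
    φ.LaddersQuasiconvex v wt R' := fun M x p hp q hq A hA a ha => by
  obtain ⟨b, hb, hd⟩ := h M x p hp q hq A hA a ha
  exact ⟨b, hb, hd.trans hR⟩

end GraphMap

end MappingTorus

theorem mainTheorem8 {V E : Type*} [Finite V] [Finite E] (Γ : MappingTorus.OrientedGraph V E)
    (hconn : Γ.Connected) (φ : MappingTorus.GraphMap Γ) (v : V) (hinj : φ.PiOneInjective v)
    (htt : φ.IsTrainTrack) (hexp : ∀ e, φ.IsExpanding e) (hirr : φ.transitionMatrix.IsIrreducible)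
    (wt : E → ℝ) (hwt : ∀ e, 0 < wt e)
    (δ : ℝ) (hδ : 0 ≤ δ) (hhyp : φ.CoverHyperbolic v wt δ) :
    ∃ lam₀ : ℝ, 0 ≤ lam₀ ∧ ∀ lam ≥ lam₀,
      φ.LaddersQuasiconvex v wt lam ∧ φ.LevelSeparated v wt δ lam := by
  have hT := MappingTorus.GraphMap.isTreeTrainTrack_coverMap (v := v) hconn hinj htt hexp hirr
  obtain ⟨R₁, hR₁, hquasi⟩ := MappingTorus.GraphMap.exists_laddersQuasiconvex hwt hδ hhyp
  obtain ⟨R₂, hR₂, hdev⟩ := MappingTorus.GraphMap.exists_deviation hwt hδ hhyp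
  -- One constant is needed for quasiconvexity of ladders, the other to make the ladderlike scale
  -- large enough for the deviation argument.
  refine ⟨max R₁ R₂, hR₁.trans (le_max_left _ _), fun lam hlam =>
    ⟨hquasi.mono ((le_max_left _ _).trans hlam), fun M K _ _ γ I ξ hI hξ hγ hd => ?_⟩⟩
  obtain ⟨B, hB, h⟩ := hdev lam ((le_max_right _ _).trans hlam) M
  rcases hI with rfl | rfl
  · obtain ⟨hmerge, hfar⟩ := h γ _ ξ Set.ordConnected_univ hξ hγ hd.2
    exact MappingTorus.GraphMap.exists_separating_line hT hirr hwt hγ hB hmerge hfar (M + K)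
  · obtain ⟨hmerge, hfar⟩ := h γ _ ξ Set.ordConnected_Ici hξ hγ hd.2
    exact MappingTorus.GraphMap.exists_separating_ray hT hirr hwt hγ hB hmerge hfar (M + K)

end
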